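/- Let $m,n\in\mathbb{N}$, let $p>1$, and let $F\colon\mathbb{R}^{m\times n}\to\mathbb{R}$ be $p$-homogeneous, i.e. $F(tA)=t^pF(A)$ for all $t>0$ and all matrices $A$, and quasiconcave, i.e., with $Q=[0,1]^n$, $$\int_{Q} F(D\varphi)\,dx\le F\Big(\int_Q D\varphi\,dx\Big)$$ for every $\varphi\in C^\infty(\mathbb{R}^n,\mathbb{R}^m)$ whose derivative $D\varphi$ is $Q$-periodic (the left-hand integrand being integrable over $Q$). Let $|\cdot|$ be the operator norm on $\mathbb{R}^{m\times n}$, and let $\|f\|_{L\log L(\omega)}=\inf\{t>0:\int_\omega \Phi(|f|/t)\,dx\le 1\}$, $\Phi(s)=s\log(e+s)$, be the Luxemburg norm of $L\log L(\omega)$. For an open set $\Omega\subset\mathbb{R}^n$, let $u\colon\Omega\to\mathbb{R}^m$ denote a locally integrable map with weak derivative $Du$. We write $\omega\Subset\tilde\omega$ if $\overline\omega$ is a compact subset of $\tilde\omega$. (a) If $\Omega$ is open, $Du\in L^p_{\rm loc}(\Omega,\mathbb{R}^{m\times n})$ and $F(Du)\ge 0$ a.e. in $\Omega$, then $F(Du)\in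 L\log L_{\rm loc}(\Omega)$. Moreover, for all open sets $\omega\Subset\tilde\omega$ there is a nondecreasing function $C\colon[0,\infty)\to[0,\infty)$, depending only on $F,p,\omega,\tilde\omega$, such that for every open $\Omega$ with $\tilde\omega\Subset\Omega$ and every such $u$ $$\|F(Du)\|_{L\log L(\omega)}\le C\big(\|Du\|_{L^p(\tilde\omega)}\big).$$ (b) For every $c>0$ there is $\varepsilon_0>0$, depending only on $F,p,c$, such that for all $\varepsilon\in(0,\varepsilon_0)$: if $\Omega$ is open, $Du\in L^p_{\rm loc}(\Omega,\mathbb{R}^{m\times n})$ and $F(Du)\ge c|Du|^p$ a.e. in $\Omega$, then $Du\in L^{p+\varepsilon}_{\rm loc}(\Omega)$. Moreover, for all open sets $\omega\Subset\tilde\omega$ there is a nondecreasing function $C\colon[0,\infty)\to[0,\infty)$, depending only on $F,p,c,\omega,\tilde\omega$, such that for all $\varepsilon\in(0,\varepsilon_0)$, every open $\Omega$ with $\tilde\omega\Subset\Omega$ and every such $u$ $$\|Du\|_{L^{p+\varepsilon}(\omega)}\le C\big(\|Du\|_{L^p(\tilde\omega)}\big).$$ -/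

import Mathlib

open MeasureTheory Set
open scoped ENNReal NNReal ContDiff Matrix.Norms.L2Operator

noncomputable section

namespace QuasiconcaveIntegrability

/-- The Jacobian matrix `Dφ(x)`, with entries `∂_j φ_i (x)`. -/
def jacobian {m n : ℕ} (φ : EuclideanSpace ℝ (Fin n) → EuclideanSpace ℝ (Fin m))
    (x : EuclideanSpace ℝ (Fin n)) : Matrix (Fin m) (Fin n) ℝ :=
  Matrix.of fun i j => fderiv ℝ φ x (EuclideanSpace.single j 1) i

/-- The closed unit cube `[0,1]^n`. -/
def unitCube (n : ℕ) : Set (EuclideanSpace ℝ (Fin n)) :=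
  {x | ∀ i, x i ∈ Icc (0 : ℝ) 1}

/-- Periodicity with respect to the unit cube. -/
def IsCubePeriodic {n : ℕ} {α : Type*} (g : EuclideanSpace ℝ (Fin n) → α) : Prop :=
  ∀ (x : EuclideanSpace ℝ (Fin n)) (j : Fin n), g (x + EuclideanSpace.single j 1) = g x

/-- Quasiconcavity in the sense of Morrey, over the unit cube `Q = [0,1]^n` (by translation and
scaling, any other axis-parallel cube gives the same condition).
Since `Q` has measure one, the integrals are averages. The integrability clause says that the left
side is meaningful; it is automatic when `F` is Borel measurable and locally bounded. -/
def IsQuasiconcave {m n : ℕ} (F : Matrix (Fin m) (Fin n) ℝ → ℝ) : Prop :=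
  ∀ φ : EuclideanSpace ℝ (Fin n) → EuclideanSpace ℝ (Fin m),
    ContDiff ℝ ∞ φ → IsCubePeriodic (jacobian φ) →
      IntegrableOn (fun x => F (jacobian φ x)) (unitCube n) volume ∧
      ∫ x in unitCube n, F (jacobian φ x) ≤ F (∫ x in unitCube n, jacobian φ x)

/-- (Positive) homogeneity of degree `p`. -/
def IsHomogeneousOfDegree {m n : ℕ} (p : ℝ) (F : Matrix (Fin m) (Fin n) ℝ → ℝ) : Prop :=
  ∀ (t : ℝ) (A : Matrix (Fin m) (Fin n) ℝ), 0 < t → F (t • A) = t ^ p * F A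

/-- `G` is the weak (distributional) derivative matrix of the locally integrable map `u` on the
open set `Ω`: `∫ u_i ∂_j ζ = - ∫ G_ij ζ` for all `ζ ∈ C_c^∞(Ω)`. -/
structure HasWeakGradient {m n : ℕ} (Ω : Set (EuclideanSpace ℝ (Fin n)))
    (u : EuclideanSpace ℝ (Fin n) → EuclideanSpace ℝ (Fin m))
    (G : EuclideanSpace ℝ (Fin n) → Matrix (Fin m) (Fin n) ℝ) : Prop where
  locallyIntegrable : LocallyIntegrableOn u Ω volume
  locallyIntegrable_grad : LocallyIntegrableOn G Ω volume
  integral_eq : ∀ ζ : EuclideanSpace ℝ (Fin n) → ℝ, ContDiff ℝ ∞ ζ → HasCompactSupport ζ →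
    tsupport ζ ⊆ Ω → ∀ (i : Fin m) (j : Fin n),
      ∫ x in Ω, u x i * fderiv ℝ ζ x (EuclideanSpace.single j 1) = - ∫ x in Ω, G x i j * ζ x

/-- `G ∈ L^p_loc(Ω)`. The norm on matrices is the (Euclidean) operator norm. -/
def MemLpLoc {m n : ℕ} (G : EuclideanSpace ℝ (Fin n) → Matrix (Fin m) (Fin n) ℝ) (p : ℝ)
    (Ω : Set (EuclideanSpace ℝ (Fin n))) : Prop :=
  ∀ K : Set (EuclideanSpace ℝ (Fin n)), IsCompact K → K ⊆ Ω →
    MemLp G (ENNReal.ofReal p) (volume.restrict K)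

/-- The Young function `t log(e + t)`. -/
def llogYoung (t : ℝ) : ℝ := t * Real.log (Real.exp 1 + t)

/-- The Luxemburg norm of `L log L`:
`inf {t > 0 : ∫ Φ(|f| / t) dμ ≤ 1}` with `Φ(s) = s log(e + s)` (`∞` if there is no such `t`). -/
def llogNorm {α : Type*} [MeasurableSpace α] (f : α → ℝ) (μ : Measure α) : ℝ≥0∞ :=
  ⨅ (t : ℝ≥0) (_ : 0 < t ∧ ∫⁻ x, ENNReal.ofReal (llogYoung (|f x| / t)) ∂μ ≤ 1), (t : ℝ≥0∞)

/-- Membership in the Orlicz space `L log L`. -/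
def MemLLogL {α : Type*} [MeasurableSpace α] (f : α → ℝ) (μ : Measure α) : Prop :=
  AEStronglyMeasurable f μ ∧ llogNorm f μ < ⊤

/-- `f ∈ L log L_loc(Ω)`. -/
def MemLLogLLoc {n : ℕ} (f : EuclideanSpace ℝ (Fin n) → ℝ)
    (Ω : Set (EuclideanSpace ℝ (Fin n))) : Prop :=
  ∀ K : Set (EuclideanSpace ℝ (Fin n)), IsCompact K → K ⊆ Ω → MemLLogL f (volume.restrict K)

/-- `s ⋐ t`: the closure of `s` is a compact subset of `t`. -/
def CompactlyContained {n : ℕ} (s t : Set (EuclideanSpace ℝ (Fin n))) : Prop :=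
  IsCompact (closure s) ∧ closure s ⊆ t

end QuasiconcaveIntegrability

end

open QuasiconcaveIntegrability

/-!
Testing quasiconcavity with maps oscillating in one coordinate direction shows that `F` is concave
in each matrix entry; together with homogeneity this makes it locally Lipschitz with the growth
`|F(A) - F(B)| ≤ L (|A| + |B|)^(p-1) |A - B|` (`exists_growthBound`).

Quasiconcavity turns into higher integrability through a Caccioppoli inequality. Periodicity and
scaling give `∫ F(Dφ) ≤ 0` for compactly supported smooth `φ` (`integral_comp_jacobian_nonpos`).
Testing with `φ = η (u - b)` for a cutoff function `η` and a constant `b`, homogeneity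
`F(η Du) = η^p F(Du)` and the Lipschitz bound leave
`∫ η^p F(Du) ≤ C ∫ (|η Du| + |u - b| |Dη|)^(p-1) |u - b| |Dη|`. Every term on the right carries a
factor `u - b`, so the Poincaré-Sobolev inequality bounds it by a power of the integral of `|Du|^q`
with some `q < p` (`exists_poincare_gain`, `exists_caccioppoli`). After approximating `u` by smooth
maps this is the reverse Hölder inequality `⨍_B F(Du) ≤ C (⨍_{2B} |Du|^q)^(p/q)`
(`exists_reverse_holder`), where `F(Du) ≥ 0` allows to drop the cutoff function on the left.

Now let `f` and `h` be `F(Du)` and `|Du|`, weighted with powers of a distance function that cuts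
them off outside the domain. A stopping time and Vitali covering argument gives
`∫_{h > l} f ≤ C l^(p-q) ∫_{h > l/2} h^q` for all large levels `l`
(`exists_level_set_inequality`). Integrating it against `dl / l` bounds `∫ f log⁺ h` by
`C ∫ h^p` (`lintegral_mul_log_le`), which is the `L log L` estimate since `F(Du) ≤ L |Du|^p`.
If `f ≥ c h^p`, integrating it against `l^(ε-1) dl` bounds `∫ h^(p+ε)` by `C ε / c` times itself
plus a constant times `∫ h^p`, and the first term is absorbed when `ε` is small
(`lintegral_rpow_add_le`).
-/

/-! ### Integrals over the unit cube -/

lemma measurePreserving_ofLp_unitCube (n : ℕ) :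
    MeasurePreserving (fun x : EuclideanSpace ℝ (Fin n) => WithLp.ofLp x)
      (volume.restrict (unitCube n))
      (Measure.pi fun _ : Fin n => volume.restrict (Icc (0 : ℝ) 1)) := by
  have h := (PiLp.volume_preserving_ofLp (Fin n)).restrict_preimage
    (s := Set.univ.pi fun _ : Fin n => Icc (0 : ℝ) 1)
    (MeasurableSet.univ_pi fun _ => measurableSet_Icc)
  rw [volume_pi, Measure.restrict_pi_pi] at h
  have hs : unitCube n = WithLp.ofLp ⁻¹' Set.univ.pi fun _ : Fin n => Icc (0 : ℝ) 1 := by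
    ext x
    simp only [unitCube, mem_ofPred_eq, mem_preimage, mem_univ_pi]
  rw [hs]
  exact h

instance isProbabilityMeasure_restrict_Icc_zero_one :
    IsProbabilityMeasure ((volume : Measure ℝ).restrict (Icc 0 1)) := ⟨by simp⟩

lemma aestronglyMeasurable_of_comp_coord {n : ℕ} {E : Type*} [NormedAddCommGroup E]
    {f : ℝ → E} (j : Fin n)
    (h : AEStronglyMeasurable (fun x : EuclideanSpace ℝ (Fin n) => f (x j))
      (volume.restrict (unitCube n))) :
    AEStronglyMeasurable f (volume.restrict (Icc 0 1)) := by
  obtain _ | n := n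
  · exact j.elim0
  have hme : MeasurableEmbedding
      (fun x : EuclideanSpace ℝ (Fin (n + 1)) => WithLp.ofLp x) :=
    (MeasurableEquiv.toLp 2 (Fin (n + 1) → ℝ)).symm.measurableEmbedding
  have h1 : AEStronglyMeasurable (fun x : Fin (n + 1) → ℝ => f (x j))
      (Measure.pi fun _ : Fin (n + 1) => volume.restrict (Icc (0 : ℝ) 1)) :=
    ((measurePreserving_ofLp_unitCube (n + 1)).aestronglyMeasurable_comp_iff hme).1 h
  have h2 := measurePreserving_piFinSuccAbove
    (fun _ : Fin (n + 1) => (volume : Measure ℝ).restrict (Icc (0 : ℝ) 1)) j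
  have h3 : AEStronglyMeasurable (fun y : ℝ × (Fin n → ℝ) => f y.1)
      (((volume : Measure ℝ).restrict (Icc (0 : ℝ) 1)).prod
        (Measure.pi fun _ : Fin n => (volume : Measure ℝ).restrict (Icc (0 : ℝ) 1))) := by
    rw [← h2.aestronglyMeasurable_comp_iff (MeasurableEquiv.measurableEmbedding _)]
    exact h1
  exact h3.of_comp_fst (NeZero.ne _)

lemma integral_unitCube_comp_coord {n : ℕ} {E : Type*} [NormedAddCommGroup E] [NormedSpace ℝ E]
    {f : ℝ → E} (j : Fin n) (h : AEStronglyMeasurable f (volume.restrict (Icc 0 1))) :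
    ∫ x in unitCube n, f (x j) = ∫ t in Icc (0 : ℝ) 1, f t := by
  have hme : MeasurableEmbedding
      (fun x : EuclideanSpace ℝ (Fin n) => WithLp.ofLp x) :=
    (MeasurableEquiv.toLp 2 (Fin n → ℝ)).symm.measurableEmbedding
  rw [← integral_comp_eval (μ := fun _ : Fin n => (volume : Measure ℝ).restrict (Icc (0 : ℝ) 1))
    (i := j) h]
  exact (measurePreserving_ofLp_unitCube n).integral_comp hme (fun x => f (x j))

lemma integrableOn_of_comp_coord {n : ℕ} {E : Type*} [NormedAddCommGroup E]
    {f : ℝ → E} (j : Fin n)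
    (h : IntegrableOn (fun x : EuclideanSpace ℝ (Fin n) => f (x j)) (unitCube n)) :
    IntegrableOn f (Icc 0 1) := by
  have hm := aestronglyMeasurable_of_comp_coord j h.aestronglyMeasurable
  have hmp : MeasurePreserving (fun x : EuclideanSpace ℝ (Fin n) => x j)
      (volume.restrict (unitCube n)) (volume.restrict (Icc (0 : ℝ) 1)) :=
    (measurePreserving_eval (fun _ : Fin n => (volume : Measure ℝ).restrict (Icc (0 : ℝ) 1)) j).comp
      (measurePreserving_ofLp_unitCube n)
  exact (hmp.integrable_comp hm).1 h

/-! ### A smooth periodic two-valued function -/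

/-- A smooth function of period one which on `[0,1]` equals `t₁` on an interval of length `l - δ`
and `t₂` on intervals of total length `1 - l - δ`, with two transitions of length `δ`. -/
noncomputable def smoothStep (t₁ t₂ l δ : ℝ) (s : ℝ) : ℝ :=
  t₂ + (t₁ - t₂) * (Real.smoothTransition (Int.fract s / δ - 1) -
    Real.smoothTransition (Int.fract s / δ - (l / δ + 1)))

lemma contDiff_smoothStep {t₁ t₂ l δ : ℝ} (hδ : 0 < δ) (hl : 0 < l) (hl' : l + 3 * δ ≤ 1) :
    ContDiff ℝ ∞ (smoothStep t₁ t₂ l δ) := by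
  set b : ℝ → ℝ := fun s => t₂ + (t₁ - t₂) * (Real.smoothTransition (s / δ - 1) -
    Real.smoothTransition (s / δ - (l / δ + 1))) with hb
  have hbs : ContDiff ℝ ∞ b := by
    have h1 : ContDiff ℝ ∞ fun s : ℝ => Real.smoothTransition (s / δ - 1) :=
      Real.smoothTransition.contDiff.comp ((contDiff_id.div_const _).sub contDiff_const)
    have h2 : ContDiff ℝ ∞ fun s : ℝ => Real.smoothTransition (s / δ - (l / δ + 1)) :=
      Real.smoothTransition.contDiff.comp ((contDiff_id.div_const _).sub contDiff_const)
    exact contDiff_const.add (contDiff_const.mul (h1.sub h2))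
  have hb0 : ∀ s ≤ δ, b s = t₂ := by
    intro s hs
    have h1 : s / δ - 1 ≤ 0 := by rw [sub_nonpos, div_le_one hδ]; exact hs
    have h2 : s / δ - (l / δ + 1) ≤ 0 := by have : 0 < l / δ := by positivity
                                            linarith
    simp [hb, Real.smoothTransition.zero_of_nonpos h1, Real.smoothTransition.zero_of_nonpos h2]
  have hb1 : ∀ s, 1 - δ ≤ s → b s = t₂ := by
    intro s hs
    have h2 : 1 ≤ s / δ - (l / δ + 1) := by
      have : s / δ - (l / δ + 1) = (s - l - δ) / δ := by field_simp; ring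
      rw [this, le_div_iff₀ hδ]; linarith
    have h1 : 1 ≤ s / δ - 1 := by have : 0 < l / δ := by positivity
                                  linarith
    simp [hb, Real.smoothTransition.one_of_one_le h1, Real.smoothTransition.one_of_one_le h2]
  rw [contDiff_iff_contDiffAt]
  intro s
  by_cases hs : Int.fract s = 0
  · -- near an integer the function is constant
    have : smoothStep t₁ t₂ l δ =ᶠ[nhds s] fun _ => t₂ := by
      have hs' : s = (⌊s⌋ : ℝ) := by rw [Int.fract] at hs; linarith
      have hδ1 : δ < 1 := by linarith
      filter_upwards [Metric.ball_mem_nhds s hδ] with y hy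
      rw [Metric.mem_ball, Real.dist_eq, abs_lt] at hy
      change b (Int.fract y) = t₂
      rcases le_or_gt s y with h | h
      · have : ⌊y⌋ = ⌊s⌋ := by rw [Int.floor_eq_iff]; constructor <;> linarith
        apply hb0; rw [Int.fract, this]; linarith
      · have : ⌊y⌋ = ⌊s⌋ - 1 := by
          rw [Int.floor_eq_iff]; push_cast; constructor <;> linarith
        apply hb1; rw [Int.fract, this]; push_cast; linarith
    exact contDiffAt_const.congr_of_eventuallyEq this
  · have h0 : 0 < Int.fract s := lt_of_le_of_ne (Int.fract_nonneg s) (Ne.symm hs)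
    have : smoothStep t₁ t₂ l δ =ᶠ[nhds s] fun y => b (y - ⌊s⌋) := by
      have h1 : (⌊s⌋ : ℝ) < s := by rw [Int.fract] at h0; linarith
      filter_upwards [Ioo_mem_nhds h1 (Int.lt_floor_add_one s)] with y hy
      have : ⌊y⌋ = ⌊s⌋ := by rw [Int.floor_eq_iff]; exact ⟨hy.1.le, hy.2⟩
      change b (Int.fract y) = _
      rw [Int.fract, this]
    exact (hbs.comp (contDiff_id.sub contDiff_const)).contDiffAt.congr_of_eventuallyEq this

lemma smoothStep_add_one (t₁ t₂ l δ s : ℝ) :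
    smoothStep t₁ t₂ l δ (s + 1) = smoothStep t₁ t₂ l δ s := by
  simp [smoothStep]

/-- The integral of `f ∘ smoothStep` over a period, in terms of the plateau values and of the
two transition profiles. -/
lemma integral_comp_smoothStep {t₁ t₂ l δ : ℝ} (hδ : 0 < δ) (hl : δ < l) (hl' : l + 3 * δ ≤ 1)
    (f : ℝ → ℝ) (hf : IntegrableOn (fun s => f (smoothStep t₁ t₂ l δ s)) (Icc 0 1)) :
    ∫ s in Icc (0 : ℝ) 1, f (smoothStep t₁ t₂ l δ s) =
      (l - δ) * f t₁ + (1 - l - δ) * f t₂ +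
      δ * ((∫ r in (0 : ℝ)..1, f (t₂ + (t₁ - t₂) * Real.smoothTransition r)) +
        ∫ r in (0 : ℝ)..1, f (t₂ + (t₁ - t₂) * (1 - Real.smoothTransition r))) := by
  have hfr : ∀ s ∈ Ico (0 : ℝ) 1, Int.fract s = s := fun s hs => Int.fract_eq_self.2 ⟨hs.1, hs.2⟩
  rw [integral_Icc_eq_integral_Ioc, ← intervalIntegral.integral_of_le zero_le_one]
  have hI : ∀ a b, 0 ≤ a → a ≤ b → b ≤ 1 →
      IntervalIntegrable (fun s => f (smoothStep t₁ t₂ l δ s)) volume a b := by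
    intro a b ha hab hb
    rw [intervalIntegrable_iff_integrableOn_Ioc_of_le hab]
    exact hf.mono_set fun x hx => ⟨ha.trans hx.1.le, hx.2.trans hb⟩
  have e1 : ∫ s in (0 : ℝ)..δ, f (smoothStep t₁ t₂ l δ s) = ∫ s in (0 : ℝ)..δ, f t₂ := by
    apply intervalIntegral.integral_congr
    intro s hs
    rw [uIcc_of_le hδ.le] at hs
    have h1 : s / δ - 1 ≤ 0 := by rw [sub_nonpos, div_le_one hδ]; exact hs.2
    have h2 : s / δ - (l / δ + 1) ≤ 0 := by
      have : 0 < l / δ := div_pos (hδ.trans hl) hδ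
      linarith
    simp only [smoothStep, hfr s ⟨hs.1, by linarith [hs.2]⟩,
      Real.smoothTransition.zero_of_nonpos h1, Real.smoothTransition.zero_of_nonpos h2]
    simp
  have e2 : ∫ s in δ..(2 * δ), f (smoothStep t₁ t₂ l δ s) =
      ∫ s in δ..(2 * δ), f (t₂ + (t₁ - t₂) * Real.smoothTransition (s / δ - 1)) := by
    apply intervalIntegral.integral_congr
    intro s hs
    rw [uIcc_of_le (by linarith)] at hs
    have h2 : s / δ - (l / δ + 1) ≤ 0 := by
      have : s / δ - (l / δ + 1) = (s - l - δ) / δ := by field_simp; ring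
      rw [this]; exact div_nonpos_of_nonpos_of_nonneg (by linarith [hs.2]) hδ.le
    simp only [smoothStep, hfr s ⟨by linarith [hs.1], by linarith [hs.2]⟩,
      Real.smoothTransition.zero_of_nonpos h2, sub_zero]
  have e3 : ∫ s in (2 * δ)..(l + δ), f (smoothStep t₁ t₂ l δ s) =
      ∫ s in (2 * δ)..(l + δ), f t₁ := by
    apply intervalIntegral.integral_congr
    intro s hs
    rw [uIcc_of_le (by linarith)] at hs
    have h1 : 1 ≤ s / δ - 1 := by
      have : s / δ - 1 = (s - δ) / δ := by field_simp
      rw [this, le_div_iff₀ hδ]; linarith [hs.1]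
    have h2 : s / δ - (l / δ + 1) ≤ 0 := by
      have : s / δ - (l / δ + 1) = (s - l - δ) / δ := by field_simp; ring
      rw [this]; exact div_nonpos_of_nonpos_of_nonneg (by linarith [hs.2]) hδ.le
    simp only [smoothStep, hfr s ⟨by linarith [hs.1], by linarith [hs.2]⟩,
      Real.smoothTransition.zero_of_nonpos h2, Real.smoothTransition.one_of_one_le h1, sub_zero]
    congr 1; ring
  have e4 : ∫ s in (l + δ)..(l + 2 * δ), f (smoothStep t₁ t₂ l δ s) =
      ∫ s in (l + δ)..(l + 2 * δ),
        f (t₂ + (t₁ - t₂) * (1 - Real.smoothTransition (s / δ - (l / δ + 1)))) := by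
    apply intervalIntegral.integral_congr
    intro s hs
    rw [uIcc_of_le (by linarith)] at hs
    have h1 : 1 ≤ s / δ - 1 := by
      have : s / δ - 1 = (s - δ) / δ := by field_simp
      rw [this, le_div_iff₀ hδ]; linarith [hs.1]
    simp only [smoothStep, hfr s ⟨by linarith [hs.1], by linarith [hs.2]⟩,
      Real.smoothTransition.one_of_one_le h1]
  have e5 : ∫ s in (l + 2 * δ)..1, f (smoothStep t₁ t₂ l δ s) =
      ∫ s in (l + 2 * δ)..1, f t₂ := by
    apply intervalIntegral.integral_congr_ae
    have : ∀ᵐ s : ℝ, s ≠ 1 := by simp [ae_iff]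
    filter_upwards [this] with s hs1 hs
    rw [uIoc_of_le (by linarith)] at hs
    have h2 : 1 ≤ s / δ - (l / δ + 1) := by
      have : s / δ - (l / δ + 1) = (s - l - δ) / δ := by field_simp; ring
      rw [this, le_div_iff₀ hδ]; linarith [hs.1]
    have h1 : 1 ≤ s / δ - 1 := by
      have : 0 < l / δ := div_pos (hδ.trans hl) hδ
      linarith
    simp only [smoothStep, hfr s ⟨by linarith [hs.1], lt_of_le_of_ne hs.2 hs1⟩,
      Real.smoothTransition.one_of_one_le h1, Real.smoothTransition.one_of_one_le h2]
    simp
  rw [← intervalIntegral.integral_add_adjacent_intervals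
      (hI 0 δ le_rfl hδ.le (by linarith)) (hI δ 1 hδ.le (by linarith) le_rfl),
    ← intervalIntegral.integral_add_adjacent_intervals
      (hI δ (2 * δ) hδ.le (by linarith) (by linarith))
      (hI (2 * δ) 1 (by linarith) (by linarith) le_rfl),
    ← intervalIntegral.integral_add_adjacent_intervals
      (hI (2 * δ) (l + δ) (by linarith) (by linarith) (by linarith))
      (hI (l + δ) 1 (by linarith) (by linarith) le_rfl),
    ← intervalIntegral.integral_add_adjacent_intervals
      (hI (l + δ) (l + 2 * δ) (by linarith) (by linarith) (by linarith))
      (hI (l + 2 * δ) 1 (by linarith) (by linarith) le_rfl), e1, e2, e3, e4, e5,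
    intervalIntegral.integral_comp_div_sub
      (fun r => f (t₂ + (t₁ - t₂) * Real.smoothTransition r)) hδ.ne',
    intervalIntegral.integral_comp_div_sub
      (fun r => f (t₂ + (t₁ - t₂) * (1 - Real.smoothTransition r))) hδ.ne']
  have a1 : δ / δ - 1 = 0 := by rw [div_self hδ.ne']; ring
  have a2 : 2 * δ / δ - 1 = 1 := by field_simp; ring
  have a3 : (l + δ) / δ - (l / δ + 1) = 0 := by field_simp; ring
  have a4 : (l + 2 * δ) / δ - (l / δ + 1) = 1 := by field_simp; ring
  rw [a1, a2, a3, a4]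
  simp only [intervalIntegral.integral_const, smul_eq_mul]
  ring

lemma integral_smoothStep {t₁ t₂ l δ : ℝ} (hδ : 0 < δ) (hl : δ < l) (hl' : l + 3 * δ ≤ 1) :
    ∫ s in Icc (0 : ℝ) 1, smoothStep t₁ t₂ l δ s = l * t₁ + (1 - l) * t₂ := by
  have hc := (contDiff_smoothStep (t₁ := t₁) (t₂ := t₂) hδ (hδ.trans hl) hl').continuous
  have h := integral_comp_smoothStep hδ hl hl' (fun t => t)
    (hc.continuousOn.integrableOn_compact isCompact_Icc)
  rw [h, ← intervalIntegral.integral_add]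
  · have : ∀ r : ℝ, t₂ + (t₁ - t₂) * Real.smoothTransition r +
        (t₂ + (t₁ - t₂) * (1 - Real.smoothTransition r)) = t₁ + t₂ := fun r => by ring
    simp only [this, intervalIntegral.integral_const, smul_eq_mul]
    ring
  all_goals
    apply Continuous.intervalIntegrable
    have := Real.smoothTransition.continuous
    fun_prop

/-! ### Concavity in each matrix entry -/

lemma hasFDerivAt_line_profile {m n : ℕ} (A : Matrix (Fin m) (Fin n) ℝ) (i : Fin m) (j : Fin n)
    {g : ℝ → ℝ} (hg : Continuous g) (x : EuclideanSpace ℝ (Fin n)) :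
    HasFDerivAt (fun x : EuclideanSpace ℝ (Fin n) =>
      A.toEuclideanLin.toContinuousLinearMap x +
        (∫ s in (0 : ℝ)..x j, g s) • EuclideanSpace.single i (1 : ℝ))
      (A.toEuclideanLin.toContinuousLinearMap +
        (g (x j) • (EuclideanSpace.proj j : EuclideanSpace ℝ (Fin n) →L[ℝ] ℝ)).smulRight
          (EuclideanSpace.single i (1 : ℝ))) x := by
  refine (ContinuousLinearMap.hasFDerivAt _).add (HasFDerivAt.smul_const ?_ _)
  have h1 : HasDerivAt (fun t => ∫ s in (0 : ℝ)..t, g s) (g (x j)) (x j) :=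
    (hg.integral_hasStrictDerivAt 0 _).hasDerivAt
  exact h1.comp_hasFDerivAt x
    (f := fun x : EuclideanSpace ℝ (Fin n) => x j)
    (EuclideanSpace.proj j : EuclideanSpace ℝ (Fin n) →L[ℝ] ℝ).hasFDerivAt

lemma jacobian_line_profile {m n : ℕ} (A : Matrix (Fin m) (Fin n) ℝ) (i : Fin m) (j : Fin n)
    {g : ℝ → ℝ} (hg : Continuous g) (x : EuclideanSpace ℝ (Fin n)) :
    jacobian (fun x : EuclideanSpace ℝ (Fin n) =>
      A.toEuclideanLin.toContinuousLinearMap x +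
        (∫ s in (0 : ℝ)..x j, g s) • EuclideanSpace.single i (1 : ℝ)) x =
      A + g (x j) • Matrix.single i j 1 := by
  ext a b
  simp only [jacobian, (hasFDerivAt_line_profile A i j hg x).fderiv]
  simp [Matrix.toLpLin_apply, Matrix.single_apply]
  by_cases h : i = a <;> by_cases h' : j = b <;> simp [h, h', eq_comm]

lemma contDiff_line_profile {m n : ℕ} (A : Matrix (Fin m) (Fin n) ℝ) (i : Fin m) (j : Fin n)
    {g : ℝ → ℝ} (hg : ContDiff ℝ ∞ g) :
    ContDiff ℝ ∞ (fun x : EuclideanSpace ℝ (Fin n) =>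
      A.toEuclideanLin.toContinuousLinearMap x +
        (∫ s in (0 : ℝ)..x j, g s) • EuclideanSpace.single i (1 : ℝ)) := by
  have h1 : ContDiff ℝ ∞ fun t : ℝ => ∫ s in (0 : ℝ)..t, g s := by
    have hd : ∀ t, HasDerivAt (fun t : ℝ => ∫ s in (0 : ℝ)..t, g s) (g t) t := fun t =>
      (hg.continuous.integral_hasStrictDerivAt 0 t).hasDerivAt
    rw [contDiff_infty_iff_deriv]
    refine ⟨fun t => (hd t).differentiableAt, ?_⟩
    rwa [show deriv (fun t : ℝ => ∫ s in (0 : ℝ)..t, g s) = g from funext fun t => (hd t).deriv]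
  exact (ContinuousLinearMap.contDiff _).add
    ((h1.comp (EuclideanSpace.proj j : EuclideanSpace ℝ (Fin n) →L[ℝ] ℝ).contDiff).smul
      contDiff_const)

/-- Jensen's inequality for a quasiconcave function along a coordinate direction, for smooth
periodic profiles. -/
lemma jensen_line {m n : ℕ} {F : Matrix (Fin m) (Fin n) ℝ → ℝ} (hF : IsQuasiconcave F)
    (A : Matrix (Fin m) (Fin n) ℝ) (i : Fin m) (j : Fin n) {g : ℝ → ℝ}
    (hg : ContDiff ℝ ∞ g) (hp : ∀ s, g (s + 1) = g s) :
    IntegrableOn (fun s => F (A + g s • Matrix.single i j 1)) (Icc 0 1) ∧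
    ∫ s in Icc (0 : ℝ) 1, F (A + g s • Matrix.single i j 1) ≤
      F (A + (∫ s in Icc (0 : ℝ) 1, g s) • Matrix.single i j 1) := by
  have hj := jacobian_line_profile A i j hg.continuous
  obtain ⟨h1, h2⟩ := hF _ (contDiff_line_profile A i j hg) (by
    intro x k
    rw [hj, hj]
    by_cases hk : k = j
    · subst hk; simp [hp]
    · simp [Ne.symm hk])
  simp only [hj] at h1 h2
  have h3 := integrableOn_of_comp_coord (f := fun s => F (A + g s • Matrix.single i j 1)) j h1
  refine ⟨h3, ?_⟩
  have hgi : IntegrableOn g (Icc (0 : ℝ) 1) :=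
    hg.continuous.continuousOn.integrableOn_compact isCompact_Icc
  have hgm : IntegrableOn (fun s => g s • (Matrix.single i j 1 : Matrix (Fin m) (Fin n) ℝ))
    (Icc (0 : ℝ) 1) := hgi.smul_const _
  rw [integral_unitCube_comp_coord (f := fun s => F (A + g s • Matrix.single i j 1)) j
    h3.aestronglyMeasurable, integral_unitCube_comp_coord
      (f := fun s => A + g s • (Matrix.single i j 1 : Matrix (Fin m) (Fin n) ℝ)) j
      (hgm.aestronglyMeasurable.const_add _), integral_add (integrable_const _) hgm,
      integral_smul_const] at h2
  simpa using h2

/-- A quasiconcave function is concave in each matrix entry. No regularity of `F` is needed: on the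
transition layers of `smoothStep` the integral of `F` is `δ` times a number which does not depend
on `δ`, and it disappears as `δ → 0`. -/
lemma concaveOn_line {m n : ℕ} {F : Matrix (Fin m) (Fin n) ℝ → ℝ} (hF : IsQuasiconcave F)
    (A : Matrix (Fin m) (Fin n) ℝ) (i : Fin m) (j : Fin n) :
    ConcaveOn ℝ univ fun t : ℝ => F (A + t • Matrix.single i j 1) := by
  set f : ℝ → ℝ := fun t => F (A + t • Matrix.single i j 1) with hf
  rw [concaveOn_iff_forall_pos]
  refine ⟨convex_univ, fun t₁ _ t₂ _ l l' hl hl' hll => ?_⟩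
  obtain rfl : l' = 1 - l := by linarith
  simp only [smul_eq_mul]
  set I : ℝ := (∫ r in (0 : ℝ)..1, f (t₂ + (t₁ - t₂) * Real.smoothTransition r)) +
        ∫ r in (0 : ℝ)..1, f (t₂ + (t₁ - t₂) * (1 - Real.smoothTransition r)) with hI
  have key : ∀ δ, 0 < δ → δ < l → l + 3 * δ ≤ 1 →
      (l - δ) * f t₁ + (1 - l - δ) * f t₂ + δ * I ≤ f (l * t₁ + (1 - l) * t₂) := by
    intro δ h1 h2 h3
    obtain ⟨j1, j2⟩ := jensen_line hF A i j (contDiff_smoothStep (t₁ := t₁) (t₂ := t₂) h1 hl h3)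
      (smoothStep_add_one t₁ t₂ l δ)
    rw [integral_smoothStep h1 h2 h3] at j2
    rw [hI, ← integral_comp_smoothStep h1 h2 h3 f j1]
    exact j2
  have hlim : Filter.Tendsto (fun δ => (l - δ) * f t₁ + (1 - l - δ) * f t₂ + δ * I)
      (nhdsWithin 0 (Ioi 0)) (nhds (l * f t₁ + (1 - l) * f t₂)) := by
    have : Continuous fun δ => (l - δ) * f t₁ + (1 - l - δ) * f t₂ + δ * I := by fun_prop
    have := this.tendsto 0
    simp only [sub_zero, zero_mul, add_zero] at this
    exact this.mono_left nhdsWithin_le_nhds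
  refine le_of_tendsto hlim ?_
  have h0 : (0 : ℝ) < min l ((1 - l) / 3) := lt_min hl (by linarith)
  filter_upwards [Ioo_mem_nhdsGT h0] with δ hδ
  have := lt_min_iff.1 hδ.2
  exact key δ hδ.1 this.1 (by linarith [this.2])

/-! ### Separately concave functions are locally Lipschitz -/

section SeparatelyConcave

variable {ι : Type*} [DecidableEq ι] {f : (ι → ℝ) → ℝ}

/-- On a cube, a separately concave function is at least its minimum over the vertices: the
coordinates are moved to the endpoints one at a time. -/
lemma SeparatelyConcave.bddBelow [Finite ι]
    (hf : ∀ x i, ConcaveOn ℝ univ fun t => f (Function.update x i t)) {r : ℝ} (hr : 0 < r) :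
    ∃ a, ∀ x : ι → ℝ, (∀ i, |x i| ≤ r) → a ≤ f x := by
  have := Fintype.ofFinite ι
  have key : ∀ s : Finset ι, ∃ a, ∀ x : ι → ℝ, (∀ i, |x i| ≤ r) →
      (∀ i ∉ s, x i = r ∨ x i = -r) → a ≤ f x := by
    intro s
    induction s using Finset.induction_on with
    | empty =>
      have hfin : (Set.pi univ fun _ : ι => ({r, -r} : Set ℝ)).Finite :=
        Set.Finite.pi' (fun _ => Set.toFinite _) |>.subset fun x hx i => hx i (mem_univ i)
      obtain ⟨a, ha⟩ := (hfin.image f).bddBelow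
      exact ⟨a, fun x _ hx => ha ⟨x, fun i _ => by simpa using hx i (by simp), rfl⟩⟩
    | insert i s hi ih =>
      obtain ⟨a, ha⟩ := ih
      refine ⟨a, fun x hx hxs => ?_⟩
      have h1 : ∀ t, t = r ∨ t = -r → a ≤ f (Function.update x i t) := by
        intro t ht
        have ht' : |t| ≤ r := by rcases ht with rfl | rfl <;> simp [abs_of_pos hr]
        apply ha
        · intro k
          by_cases hk : k = i
          · subst hk; simpa using ht'
          · simpa [hk] using hx k
        · intro k hk
          by_cases hki : k = i
          · subst hki; simpa using ht
          · simpa [hki] using hxs k (by simp [hki, hk])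
      have hxi := abs_le.1 (hx i)
      have h2 := (hf x i).min_le_of_mem_Icc (mem_univ (-r)) (mem_univ r) (z := x i)
        ⟨hxi.1, hxi.2⟩
      simp only [Function.update_eq_self] at h2
      exact (le_min (h1 _ (Or.inr rfl)) (h1 _ (Or.inl rfl))).trans h2
  obtain ⟨a, ha⟩ := key Finset.univ
  exact ⟨a, fun x hx => ha x hx (by simp)⟩

/-- By concavity `f x ≤ 2 f x⁰ - f x⁻`, where `x⁰` and `x⁻` arise from `x` by replacing one
coordinate with `0` or with its negative; the last term is bounded below. -/
lemma SeparatelyConcave.bddAbove [Finite ι]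
    (hf : ∀ x i, ConcaveOn ℝ univ fun t => f (Function.update x i t)) {r : ℝ} (hr : 0 < r) :
    ∃ b, ∀ x : ι → ℝ, (∀ i, |x i| ≤ r) → f x ≤ b := by
  have := Fintype.ofFinite ι
  obtain ⟨a, ha⟩ := SeparatelyConcave.bddBelow hf hr
  have key : ∀ s : Finset ι, ∃ b, ∀ x : ι → ℝ, (∀ i, |x i| ≤ r) →
      (∀ i ∉ s, x i = 0) → f x ≤ b := by
    intro s
    induction s using Finset.induction_on with
    | empty =>
      refine ⟨f 0, fun x _ hx => le_of_eq ?_⟩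
      congr 1; ext i; exact hx i (by simp)
    | insert i s hi ih =>
      obtain ⟨b, hb⟩ := ih
      refine ⟨2 * b - a, fun x hx hxs => ?_⟩
      have h0 : f (Function.update x i 0) ≤ b := by
        apply hb
        · intro k
          by_cases hk : k = i
          · subst hk; simpa using hr.le
          · simpa [hk] using hx k
        · intro k hk
          by_cases hki : k = i
          · subst hki; simp
          · simpa [hki] using hxs k (by simp [hki, hk])
      have h1 : a ≤ f (Function.update x i (-x i)) := by
        apply ha
        intro k
        by_cases hk : k = i
        · subst hk; simpa using hx k
        · simpa [hk] using hx k
      have h2 := (hf x i).2 (mem_univ (x i)) (mem_univ (-x i))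
        (by norm_num : (0 : ℝ) ≤ 1 / 2) (by norm_num : (0 : ℝ) ≤ 1 / 2) (by norm_num)
      have h3 : (1 / 2 : ℝ) • x i + (1 / 2 : ℝ) • -x i = 0 := by simp
      rw [h3] at h2
      simp only [Function.update_eq_self, smul_eq_mul] at h2
      linarith
  obtain ⟨b, hb⟩ := key Finset.univ
  exact ⟨b, fun x hx => hb x hx (by simp)⟩

lemma ConcaveOn.abs_sub_le_of_bound {g : ℝ → ℝ} (hg : ConcaveOn ℝ univ g) {r M : ℝ} (hr : 0 < r)
    (hM : ∀ t, |t| ≤ 2 * r → |g t| ≤ M) {s t : ℝ} (hs : |s| ≤ r) (ht : |t| ≤ r) :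
    |g s - g t| ≤ 2 * M / r * |s - t| := by
  wlog hst : s < t generalizing s t
  · rcases eq_or_lt_of_le (not_lt.1 hst) with h | h
    · simp [h]
    · rw [abs_sub_comm, abs_sub_comm s]; exact this ht hs h
  rw [abs_le] at hs ht
  have e0 := abs_le.1 (hM s (abs_le.2 ⟨by linarith, by linarith⟩))
  have e1 := abs_le.1 (hM t (abs_le.2 ⟨by linarith, by linarith⟩))
  have e2 := abs_le.1 (hM (2 * r) (abs_le.2 ⟨by linarith, by linarith⟩))
  have e3 := abs_le.1 (hM (-(2 * r)) (abs_le.2 ⟨by linarith, by linarith⟩))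
  have s1 := hg.slope_anti_adjacent (mem_univ s) (mem_univ (2 * r)) hst (by linarith : t < 2 * r)
  have s2 := hg.slope_anti_adjacent (mem_univ (-(2 * r))) (mem_univ t)
    (by linarith : -(2 * r) < s) hst
  have hM0 : 0 ≤ M := by linarith
  have hpos : 0 < t - s := by linarith
  have b1 : -(2 * M / r) ≤ (g (2 * r) - g t) / (2 * r - t) := by
    rw [neg_le, ← neg_div, div_le_div_iff₀ (by linarith) hr]
    nlinarith
  have b2 : (g s - g (-(2 * r))) / (s - -(2 * r)) ≤ 2 * M / r := by
    rw [div_le_div_iff₀ (by linarith) hr]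
    nlinarith
  have c1 := b1.trans s1
  have c2 := s2.trans b2
  rw [le_div_iff₀ hpos] at c1
  rw [div_le_iff₀ hpos] at c2
  rw [abs_sub_comm s t, abs_of_pos hpos, abs_le]
  constructor <;> linarith

lemma SeparatelyConcave.exists_lipschitz [Fintype ι]
    (hf : ∀ x i, ConcaveOn ℝ univ fun t => f (Function.update x i t)) {r : ℝ} (hr : 0 < r) :
    ∃ L, 0 ≤ L ∧ ∀ x y : ι → ℝ, (∀ i, |x i| ≤ r) → (∀ i, |y i| ≤ r) →
      |f x - f y| ≤ L * ∑ i, |x i - y i| := by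
  obtain ⟨a, ha⟩ := SeparatelyConcave.bddBelow hf (r := 2 * r) (by positivity)
  obtain ⟨b, hb⟩ := SeparatelyConcave.bddAbove hf (r := 2 * r) (by positivity)
  set M := max |a| |b| with hM
  have hbound : ∀ x : ι → ℝ, (∀ i, |x i| ≤ 2 * r) → |f x| ≤ M := fun x hx =>
    abs_le_max_abs_abs (ha x hx) (hb x hx)
  have hM0 : 0 ≤ M := (abs_nonneg a).trans (le_max_left _ _)
  refine ⟨2 * M / r, by positivity, fun x y hx hy => ?_⟩
  have key : ∀ s : Finset ι, |f (s.piecewise x y) - f y| ≤ 2 * M / r * ∑ i ∈ s, |x i - y i| := by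
    intro s
    induction s using Finset.induction_on with
    | empty => simp
    | insert i s hi ih =>
      rw [Finset.sum_insert hi, Finset.piecewise_insert, mul_add]
      have h1 : f (s.piecewise x y) = f (Function.update (s.piecewise x y) i (y i)) := by
        congr 1
        rw [eq_comm, Function.update_eq_self_iff, Finset.piecewise_eq_of_notMem _ _ _ hi]
      have h2 := ConcaveOn.abs_sub_le_of_bound (hf (s.piecewise x y) i) hr (M := M) (by
        intro t ht
        apply hbound
        intro k
        by_cases hk : k = i
        · subst hk; simpa using ht
        · simp only [Function.update_of_ne hk, Finset.piecewise]
          split_ifs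
          · linarith [hx k]
          · linarith [hy k]) (hx i) (hy i)
      simp only [← h1] at h2
      calc _ = |(f (Function.update (s.piecewise x y) i (x i)) - f (s.piecewise x y)) +
            (f (s.piecewise x y) - f y)| := by congr 1; ring
        _ ≤ _ := (abs_add_le _ _).trans (add_le_add h2 ih)
  simpa using key Finset.univ

end SeparatelyConcave

/-! ### Continuity and growth of homogeneous quasiconcave functions -/

lemma abs_apply_le_l2_opNorm {m n : ℕ} (A : Matrix (Fin m) (Fin n) ℝ) (i : Fin m) (j : Fin n) :
    |A i j| ≤ ‖A‖ := by
  have h1 := Matrix.l2_opNorm_mulVec A (EuclideanSpace.single j (1 : ℝ))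
  have h2 := PiLp.norm_apply_le
    (WithLp.toLp 2 (A.mulVec (EuclideanSpace.single j (1 : ℝ)).ofLp)) i
  rw [PiLp.norm_single, norm_one, mul_one] at h1
  refine le_trans ?_ (h2.trans h1)
  simp

lemma apply_zero_of_isHomogeneousOfDegree {m n : ℕ} {p : ℝ} (hp : 0 < p)
    {F : Matrix (Fin m) (Fin n) ℝ → ℝ} (hhom : IsHomogeneousOfDegree p F) : F 0 = 0 := by
  have h := hhom 2 0 (by norm_num)
  rw [smul_zero] at h
  have : (1 : ℝ) < 2 ^ p := Real.one_lt_rpow (by norm_num) hp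
  nlinarith

lemma exists_lipschitz_unitBall {m n : ℕ} {F : Matrix (Fin m) (Fin n) ℝ → ℝ}
    (hF : IsQuasiconcave F) :
    ∃ L, 0 ≤ L ∧ ∀ A B : Matrix (Fin m) (Fin n) ℝ, ‖A‖ ≤ 1 → ‖B‖ ≤ 1 →
      |F A - F B| ≤ L * ‖A - B‖ := by
  obtain ⟨L, hL, h⟩ := SeparatelyConcave.exists_lipschitz
    (f := fun x : Fin m × Fin n → ℝ => F (Matrix.of fun i j => x (i, j))) (by
      rintro x ⟨i, j⟩
      convert concaveOn_line hF (Matrix.of fun a b => Function.update x (i, j) 0 (a, b)) i j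
        using 3 with t
      ext a b
      by_cases h : (a, b) = (i, j)
      · obtain ⟨rfl, rfl⟩ := Prod.mk.inj h
        simp
      · have h' : ¬ (i = a ∧ j = b) := fun h' => h (by rw [h'.1, h'.2])
        simp [Function.update_of_ne h, h']) one_pos
  refine ⟨L * (m * n), by positivity, fun A B hA hB => ?_⟩
  have h1 := h (fun k => A k.1 k.2) (fun k => B k.1 k.2)
    (fun k => (abs_apply_le_l2_opNorm A _ _).trans hA)
    (fun k => (abs_apply_le_l2_opNorm B _ _).trans hB)
  have h2 : ∑ k : Fin m × Fin n, |A k.1 k.2 - B k.1 k.2| ≤ m * n * ‖A - B‖ := by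
    refine (Finset.sum_le_card_nsmul _ _ ‖A - B‖ fun k _ =>
      abs_apply_le_l2_opNorm (A - B) k.1 k.2).trans (le_of_eq ?_)
    simp
  calc _ ≤ _ := h1
    _ ≤ L * (m * n * ‖A - B‖) := by gcongr
    _ = _ := by ring

/-- The Lipschitz bound on the unit ball, rescaled by homogeneity to the ball of radius
`‖A‖ + ‖B‖`. -/
lemma exists_growth_lipschitz {m n : ℕ} {p : ℝ} {F : Matrix (Fin m) (Fin n) ℝ → ℝ}
    (hF : IsQuasiconcave F) (hhom : IsHomogeneousOfDegree p F) :
    ∃ L, 0 ≤ L ∧ ∀ A B : Matrix (Fin m) (Fin n) ℝ,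
      |F A - F B| ≤ L * (‖A‖ + ‖B‖) ^ (p - 1) * ‖A - B‖ := by
  obtain ⟨L, hL, h⟩ := exists_lipschitz_unitBall hF
  refine ⟨L, hL, fun A B => ?_⟩
  set r := ‖A‖ + ‖B‖ with hr
  have hr0 : 0 ≤ r := by positivity
  obtain hr1 | hr1 := hr0.eq_or_lt
  · have hA : A = 0 := norm_eq_zero.1 (by linarith [norm_nonneg A, norm_nonneg B])
    have hB : B = 0 := norm_eq_zero.1 (by linarith [norm_nonneg A, norm_nonneg B])
    simp [hA, hB]
  · have hs : ∀ C : Matrix (Fin m) (Fin n) ℝ, F C = r ^ p * F (r⁻¹ • C) := fun C => by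
      rw [← hhom r _ hr1, smul_smul, mul_inv_cancel₀ hr1.ne', one_smul]
    have hn : ∀ C : Matrix (Fin m) (Fin n) ℝ, ‖r⁻¹ • C‖ = r⁻¹ * ‖C‖ := fun C => by
      rw [norm_smul, Real.norm_of_nonneg (by positivity)]
    have h1 := h (r⁻¹ • A) (r⁻¹ • B)
      (by rw [hn, inv_mul_le_iff₀ hr1]; linarith [norm_nonneg B])
      (by rw [hn, inv_mul_le_iff₀ hr1]; linarith [norm_nonneg A])
    rw [← smul_sub, hn] at h1
    rw [hs A, hs B, ← mul_sub, abs_mul, abs_of_nonneg (by positivity)]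
    calc _ ≤ r ^ p * (L * (r⁻¹ * ‖A - B‖)) := by gcongr
      _ = L * (r ^ p * r⁻¹) * ‖A - B‖ := by ring
      _ = _ := by rw [Real.rpow_sub_one hr1.ne', div_eq_mul_inv]

/-- The properties of a `p`-homogeneous quasiconcave function that enter the estimates, with an
explicit constant. -/
structure GrowthBound {m n : ℕ} (p L : ℝ) (F : Matrix (Fin m) (Fin n) ℝ → ℝ) : Prop where
  nonneg : 0 ≤ L
  lip : ∀ A B : Matrix (Fin m) (Fin n) ℝ,
    |F A - F B| ≤ L * (‖A‖ + ‖B‖) ^ (p - 1) * ‖A - B‖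
  zero : F 0 = 0

namespace GrowthBound

variable {m n : ℕ} {p L : ℝ} {F : Matrix (Fin m) (Fin n) ℝ → ℝ}

lemma abs_le (h : GrowthBound p L F) (hp : 1 < p) (A : Matrix (Fin m) (Fin n) ℝ) :
    |F A| ≤ L * ‖A‖ ^ p := by
  have h1 := h.lip A 0
  simp only [h.zero, norm_zero, sub_zero, add_zero] at h1
  rcases (norm_nonneg A).eq_or_lt with h0 | h0
  · rw [← h0] at h1 ⊢
    rw [mul_zero] at h1
    rwa [Real.zero_rpow (by linarith), mul_zero]
  · rwa [mul_assoc, Real.rpow_sub_one h0.ne', div_mul_cancel₀ _ h0.ne'] at h1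

lemma continuous (h : GrowthBound p L F) (hp : 1 < p) : Continuous F := by
  rw [continuous_iff_continuousAt]
  intro A
  have h1 : Filter.Tendsto (fun B => L * (‖B‖ + ‖A‖) ^ (p - 1) * ‖B - A‖) (nhds A) (nhds 0) := by
    have : Continuous fun B : Matrix (Fin m) (Fin n) ℝ =>
        L * (‖B‖ + ‖A‖) ^ (p - 1) * ‖B - A‖ := by
      refine (continuous_const.mul ?_).mul (by fun_prop)
      exact (by fun_prop : Continuous fun B : Matrix (Fin m) (Fin n) ℝ => ‖B‖ + ‖A‖).rpow_const
        fun _ => Or.inr (by linarith)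
    simpa using this.tendsto A
  rw [ContinuousAt, tendsto_iff_norm_sub_tendsto_zero]
  exact squeeze_zero (fun _ => norm_nonneg _) (fun B => by
    rw [Real.norm_eq_abs]; exact h.lip B A) h1

lemma abs_add_sub_le (h : GrowthBound p L F) (hp : 1 < p) (A E : Matrix (Fin m) (Fin n) ℝ) :
    |F (A + E) - F A| ≤ L * 3 ^ (p - 1) * (‖A‖ ^ (p - 1) * ‖E‖ + ‖E‖ ^ p) := by
  have h1 := h.lip (A + E) A
  rw [add_sub_cancel_left] at h1
  have h2 : ‖A + E‖ + ‖A‖ ≤ 3 * max ‖A‖ ‖E‖ := by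
    have := norm_add_le A E
    linarith [le_max_left ‖A‖ ‖E‖, le_max_right ‖A‖ ‖E‖]
  have h3 : (max ‖A‖ ‖E‖) ^ (p - 1) * ‖E‖ ≤ ‖A‖ ^ (p - 1) * ‖E‖ + ‖E‖ ^ p := by
    rcases le_total ‖A‖ ‖E‖ with h' | h'
    · rw [max_eq_right h']
      have : ‖E‖ ^ (p - 1) * ‖E‖ = ‖E‖ ^ p := by
        rw [← Real.rpow_add_one' (norm_nonneg _) (by linarith)]; congr 1; ring
      rw [this]
      have : 0 ≤ ‖A‖ ^ (p - 1) * ‖E‖ := by positivity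
      linarith
    · rw [max_eq_left h']
      have : 0 ≤ ‖E‖ ^ p := by positivity
      linarith
  have := h.nonneg
  calc _ ≤ _ := h1
    _ ≤ L * (3 * max ‖A‖ ‖E‖) ^ (p - 1) * ‖E‖ := by gcongr
    _ = L * 3 ^ (p - 1) * ((max ‖A‖ ‖E‖) ^ (p - 1) * ‖E‖) := by
      rw [Real.mul_rpow (by norm_num) (by positivity)]; ring
    _ ≤ _ := by gcongr

end GrowthBound

lemma exists_growthBound {m n : ℕ} {p : ℝ} (hp : 1 < p) {F : Matrix (Fin m) (Fin n) ℝ → ℝ}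
    (hF : IsQuasiconcave F) (hhom : IsHomogeneousOfDegree p F) :
    ∃ L, GrowthBound p L F := by
  obtain ⟨L, hL, h⟩ := exists_growth_lipschitz hF hhom
  exact ⟨L, hL, h, apply_zero_of_isHomogeneousOfDegree (by linarith) hhom⟩

/-! ### Quasiconcavity tested with compactly supported maps -/

/-- The point of `ℝⁿ` whose coordinates are the integer parts of those of `x`. -/
noncomputable def coordFloor {n : ℕ} (x : EuclideanSpace ℝ (Fin n)) : EuclideanSpace ℝ (Fin n) :=
  WithLp.toLp 2 fun i => (⌊x i⌋ : ℝ)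

lemma coordFloor_add_single {n : ℕ} (x : EuclideanSpace ℝ (Fin n)) (j : Fin n) :
    coordFloor (x + EuclideanSpace.single j 1) = coordFloor x + EuclideanSpace.single j 1 := by
  ext i
  by_cases h : i = j
  · subst h; simp [coordFloor]
  · simp [coordFloor, h]

section Periodize

variable {n m : ℕ} {ψ : EuclideanSpace ℝ (Fin n) → EuclideanSpace ℝ (Fin m)} {δ : ℝ}

lemma periodize_eventuallyEq_zero (hδ : 0 < δ)
    (h0 : ∀ x, ψ x ≠ 0 → ∀ i, x i ∈ Icc δ (1 - δ)) {x : EuclideanSpace ℝ (Fin n)} {i : Fin n}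
    (hx : Int.fract (x i) = 0) : (fun y => ψ (y - coordFloor y)) =ᶠ[nhds x] fun _ => 0 := by
  have hs : x i = (⌊x i⌋ : ℝ) := by rw [Int.fract] at hx; linarith
  have hδ' : 0 < min δ 1 := lt_min hδ one_pos
  have hc : Continuous fun y : EuclideanSpace ℝ (Fin n) => y i := by fun_prop
  filter_upwards [hc.continuousAt.preimage_mem_nhds (Metric.ball_mem_nhds (x i) hδ')] with y hy
  rw [mem_preimage, Metric.mem_ball, Real.dist_eq, abs_lt] at hy
  have hm1 := min_le_left δ 1
  have hm2 := min_le_right δ 1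
  by_contra hne
  have hi := h0 _ hne i
  have he : (y - coordFloor y) i = Int.fract (y i) := by simp [coordFloor]
  rw [he] at hi
  rcases le_or_gt (x i) (y i) with h | h
  · have : ⌊y i⌋ = ⌊x i⌋ := by rw [Int.floor_eq_iff]; constructor <;> linarith
    rw [Int.fract, this] at hi; linarith [hi.1]
  · have : ⌊y i⌋ = ⌊x i⌋ - 1 := by
      rw [Int.floor_eq_iff]; push_cast; constructor <;> linarith
    rw [Int.fract, this] at hi; push_cast at hi; linarith [hi.2]

lemma periodize_eventuallyEq_translate {x : EuclideanSpace ℝ (Fin n)}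
    (hx : ∀ i, Int.fract (x i) ≠ 0) :
    (fun y => ψ (y - coordFloor y)) =ᶠ[nhds x] fun y => ψ (y - coordFloor x) := by
  have : ∀ᶠ y in nhds x, ∀ i, ⌊y i⌋ = ⌊x i⌋ := by
    rw [Filter.eventually_all]
    intro i
    have hc : Continuous fun y : EuclideanSpace ℝ (Fin n) => y i := by fun_prop
    have h0 : 0 < Int.fract (x i) := lt_of_le_of_ne (Int.fract_nonneg _) (Ne.symm (hx i))
    have h1 : (⌊x i⌋ : ℝ) < x i := by rw [Int.fract] at h0; linarith
    filter_upwards [hc.continuousAt.preimage_mem_nhds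
      (Ioo_mem_nhds h1 (Int.lt_floor_add_one (x i)))] with y hy
    rw [Int.floor_eq_iff]; exact ⟨hy.1.le, hy.2⟩
  filter_upwards [this] with y hy
  simp [coordFloor, hy]

lemma contDiff_periodize (hψ : ContDiff ℝ ∞ ψ) (hδ : 0 < δ)
    (h0 : ∀ x, ψ x ≠ 0 → ∀ i, x i ∈ Icc δ (1 - δ)) :
    ContDiff ℝ ∞ fun y => ψ (y - coordFloor y) := by
  rw [contDiff_iff_contDiffAt]
  intro x
  by_cases hx : ∃ i, Int.fract (x i) = 0
  · obtain ⟨i, hi⟩ := hx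
    exact contDiffAt_const.congr_of_eventuallyEq (periodize_eventuallyEq_zero hδ h0 hi)
  · push Not at hx
    exact (hψ.comp (contDiff_id.sub contDiff_const)).contDiffAt.congr_of_eventuallyEq
      (periodize_eventuallyEq_translate hx)

lemma eventuallyEq_zero_of_coord_notMem (h0 : ∀ x, ψ x ≠ 0 → ∀ i, x i ∈ Icc δ (1 - δ))
    {x : EuclideanSpace ℝ (Fin n)} {i : Fin n} (hx : x i ∉ Icc δ (1 - δ)) :
    ψ =ᶠ[nhds x] fun _ => 0 := by
  have hc : Continuous fun y : EuclideanSpace ℝ (Fin n) => y i := by fun_prop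
  filter_upwards [hc.continuousAt.preimage_mem_nhds (isClosed_Icc.isOpen_compl.mem_nhds hx)]
    with y hy
  by_contra hne
  exact hy (h0 y hne i)

lemma jacobian_congr {φ φ' : EuclideanSpace ℝ (Fin n) → EuclideanSpace ℝ (Fin m)}
    {x : EuclideanSpace ℝ (Fin n)} (h : φ =ᶠ[nhds x] φ') : jacobian φ x = jacobian φ' x := by
  simp only [jacobian, h.fderiv_eq]

lemma jacobian_const (c : EuclideanSpace ℝ (Fin m)) (x : EuclideanSpace ℝ (Fin n)) :
    jacobian (fun _ => c) x = 0 := by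
  ext i j
  simp [jacobian]

lemma jacobian_periodize (hδ : 0 < δ)
    (h0 : ∀ x, ψ x ≠ 0 → ∀ i, x i ∈ Icc δ (1 - δ)) {x : EuclideanSpace ℝ (Fin n)}
    (hx : x ∈ unitCube n) : jacobian (fun y => ψ (y - coordFloor y)) x = jacobian ψ x := by
  by_cases hfr : ∃ i, Int.fract (x i) = 0
  · obtain ⟨i, hi⟩ := hfr
    rw [jacobian_congr (periodize_eventuallyEq_zero hδ h0 hi),
      jacobian_congr (eventuallyEq_zero_of_coord_notMem h0 (i := i) ?_)]
    intro hmem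
    have : ⌊x i⌋ = 0 := by
      rw [Int.floor_eq_iff]
      constructor
      · simpa using (hx i).1
      · simp only [Int.cast_zero, zero_add]; linarith [hmem.2]
    rw [Int.fract, this] at hi
    simp only [Int.cast_zero, sub_zero] at hi
    linarith [hmem.1]
  · push Not at hfr
    rw [jacobian_congr (periodize_eventuallyEq_translate hfr)]
    have : coordFloor x = 0 := by
      ext i
      have h1 : ⌊x i⌋ = 0 := by
        rw [Int.floor_eq_iff]
        constructor
        · simpa using (hx i).1
        · simp only [Int.cast_zero, zero_add]
          refine lt_of_le_of_ne (hx i).2 fun h => hfr i ?_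
          rw [h]; exact Int.fract_one
      simp [coordFloor, h1]
    simp [this]

end Periodize

lemma continuous_jacobian {n m : ℕ} {ψ : EuclideanSpace ℝ (Fin n) → EuclideanSpace ℝ (Fin m)}
    (hψ : ContDiff ℝ ∞ ψ) : Continuous (jacobian ψ) := by
  have h1 : Continuous (fderiv ℝ ψ) := hψ.continuous_fderiv (by simp)
  refine continuous_matrix fun i j => ?_
  simp only [jacobian, Matrix.of_apply]
  have : Continuous fun x => fderiv ℝ ψ x (EuclideanSpace.single j 1) := by fun_prop
  fun_prop

lemma hasCompactSupport_jacobian {n m : ℕ}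
    {ψ : EuclideanSpace ℝ (Fin n) → EuclideanSpace ℝ (Fin m)}
    (hc : HasCompactSupport ψ) : HasCompactSupport (jacobian ψ) := by
  have h := hc.fderiv ℝ
  exact h.comp_left (g := fun T : EuclideanSpace ℝ (Fin n) →L[ℝ] EuclideanSpace ℝ (Fin m) =>
    (Matrix.of fun i j => T (EuclideanSpace.single j 1) i : Matrix (Fin m) (Fin n) ℝ))
    (by ext; simp)

/-- The entry functional on matrices as a continuous linear map. -/
noncomputable def matrixEntry {m n : ℕ} (i : Fin m) (j : Fin n) :
    Matrix (Fin m) (Fin n) ℝ →L[ℝ] ℝ :=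
  LinearMap.toContinuousLinearMap (Matrix.entryLinearMap ℝ ℝ i j)

@[simp] lemma matrixEntry_apply {m n : ℕ} (i : Fin m) (j : Fin n) (A : Matrix (Fin m) (Fin n) ℝ) :
    matrixEntry i j A = A i j := rfl

lemma integral_jacobian_eq_zero {n m : ℕ}
    {ψ : EuclideanSpace ℝ (Fin n) → EuclideanSpace ℝ (Fin m)}
    (hψ : ContDiff ℝ ∞ ψ) (hc : HasCompactSupport ψ) : ∫ x, jacobian ψ x = 0 := by
  have hint : Integrable (jacobian ψ) :=
    (continuous_jacobian hψ).integrable_of_hasCompactSupport (hasCompactSupport_jacobian hc)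
  ext i j
  suffices h : matrixEntry i j (∫ x, jacobian ψ x) = 0 from h
  rw [← ContinuousLinearMap.integral_comp_comm _ hint]
  have hcoord : ContDiff ℝ ∞ fun x => ψ x i := by fun_prop
  have hcc : HasCompactSupport fun x => ψ x i :=
    hc.comp_left (g := fun y : EuclideanSpace ℝ (Fin m) => y i) rfl
  have hd : ∀ x, jacobian ψ x i j = fderiv ℝ (fun x => ψ x i) x (EuclideanSpace.single j 1) := by
    intro x
    have h1 : HasFDerivAt ψ (fderiv ℝ ψ x) x := (hψ.differentiable (by simp) x).hasFDerivAt
    have h2 := (EuclideanSpace.proj i : EuclideanSpace ℝ (Fin m) →L[ℝ] ℝ).hasFDerivAt.comp x h1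
    have h3 : fderiv ℝ (fun x => ψ x i) x = _ := h2.fderiv
    rw [h3]; simp [jacobian]
  simp only [matrixEntry_apply, hd]
  have h := integral_mul_fderiv_eq_neg_fderiv_mul_of_integrable (μ := volume)
    (f := fun _ : EuclideanSpace ℝ (Fin n) => (1 : ℝ)) (g := fun x => ψ x i)
    (v := EuclideanSpace.single j 1) (by simp) (by
      simp only [one_mul]
      simp only [← hd]
      exact (matrixEntry i j).integrable_comp hint) (by
      simp only [one_mul]
      exact hcoord.continuous.integrable_of_hasCompactSupport hcc)
    (fun _ _ => differentiableAt_const _) (fun x _ => hcoord.differentiable (by simp) x)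
  simpa using h

lemma isCubePeriodic_jacobian {n m : ℕ}
    {φ : EuclideanSpace ℝ (Fin n) → EuclideanSpace ℝ (Fin m)} (h : IsCubePeriodic φ) :
    IsCubePeriodic (jacobian φ) := by
  intro x j
  have : φ = fun y => φ (y + EuclideanSpace.single j 1) := funext fun y => (h y j).symm
  conv_rhs => rw [this]
  simp only [jacobian, fderiv_comp_add_right]

/-- A map supported inside the unit cube is tested after periodic extension, written
`y ↦ ψ (y - coordFloor y)`. -/
lemma integral_comp_jacobian_nonpos_of_cube {m n : ℕ} {F : Matrix (Fin m) (Fin n) ℝ → ℝ}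
    (hF : IsQuasiconcave F) (hF0 : F 0 = 0)
    {ψ : EuclideanSpace ℝ (Fin n) → EuclideanSpace ℝ (Fin m)} (hψ : ContDiff ℝ ∞ ψ)
    (hc : HasCompactSupport ψ) {δ : ℝ} (hδ : 0 < δ)
    (h0 : ∀ x, ψ x ≠ 0 → ∀ i, x i ∈ Icc δ (1 - δ)) :
    ∫ x, F (jacobian ψ x) ≤ 0 := by
  have hoff : ∀ x ∉ unitCube n, jacobian ψ x = 0 := by
    intro x hx
    simp only [unitCube, mem_ofPred_eq, not_forall] at hx
    obtain ⟨i, hi⟩ := hx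
    rw [jacobian_congr (eventuallyEq_zero_of_coord_notMem h0 (i := i) ?_), jacobian_const]
    exact fun h => hi ⟨by linarith [h.1], by linarith [h.2]⟩
  have hmeas : MeasurableSet (unitCube n) := by
    have : unitCube n = ⋂ i, (fun x : EuclideanSpace ℝ (Fin n) => x i) ⁻¹' Icc 0 1 := by
      ext x; simp [unitCube]
    rw [this]
    exact MeasurableSet.iInter fun i => measurableSet_Icc.preimage (by fun_prop)
  obtain ⟨-, h⟩ := hF _ (contDiff_periodize hψ hδ h0) (isCubePeriodic_jacobian fun x j => by
    rw [coordFloor_add_single, add_sub_add_right_eq_sub])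
  rw [setIntegral_congr_fun hmeas (g := fun x => F (jacobian ψ x))
      fun x hx => by simp only [jacobian_periodize hδ h0 hx],
    setIntegral_congr_fun hmeas (g := fun x => jacobian ψ x)
      fun x hx => jacobian_periodize hδ h0 hx,
    setIntegral_eq_integral_of_forall_compl_eq_zero fun x hx => by rw [hoff x hx, hF0],
    setIntegral_eq_integral_of_forall_compl_eq_zero hoff,
    integral_jacobian_eq_zero hψ hc, hF0] at h
  exact h

lemma jacobian_comp_smul_sub {n m : ℕ}
    {φ : EuclideanSpace ℝ (Fin n) → EuclideanSpace ℝ (Fin m)} (hφ : Differentiable ℝ φ)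
    (r : ℝ) (c x : EuclideanSpace ℝ (Fin n)) :
    jacobian (fun y => φ (r • (y - c))) x = r • jacobian φ (r • (x - c)) := by
  have h1 : HasFDerivAt (fun y : EuclideanSpace ℝ (Fin n) => r • (y - c))
      (r • ContinuousLinearMap.id ℝ _) x := ((hasFDerivAt_id x).sub_const c).const_smul r
  have h2 := (hφ (r • (x - c))).hasFDerivAt.comp x h1
  have h3 : fderiv ℝ (fun y => φ (r • (y - c))) x = _ := h2.fderiv
  ext i j
  simp [jacobian, h3]

/-- A `p`-homogeneous quasiconcave function has nonpositive integral along the Jacobians of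
compactly supported smooth maps: homogeneity allows to shrink the support into the unit cube. -/
lemma integral_comp_jacobian_nonpos {m n : ℕ} {p : ℝ} {F : Matrix (Fin m) (Fin n) ℝ → ℝ}
    (hF : IsQuasiconcave F) (hhom : IsHomogeneousOfDegree p F) (hF0 : F 0 = 0)
    {ψ : EuclideanSpace ℝ (Fin n) → EuclideanSpace ℝ (Fin m)} (hψ : ContDiff ℝ ∞ ψ)
    (hc : HasCompactSupport ψ) :
    ∫ x, F (jacobian ψ x) ≤ 0 := by
  obtain ⟨R, hR, hsub⟩ := hc.isCompact.isBounded.subset_closedBall_lt 0 0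
  set c : EuclideanSpace ℝ (Fin n) := WithLp.toLp 2 fun _ => 1 / 2 with hcdef
  have h4 : 0 < 4 * R := by positivity
  have hψ' : ContDiff ℝ ∞ fun y => ψ ((4 * R) • (y - c)) :=
    hψ.comp (by fun_prop)
  have hsupp : ∀ x, ψ ((4 * R) • (x - c)) ≠ 0 → ∀ i, x i ∈ Icc (1 / 4 : ℝ) (1 - 1 / 4) := by
    intro x hx i
    have h1 := hsub (subset_tsupport _ hx)
    rw [mem_closedBall_zero_iff, norm_smul, Real.norm_of_nonneg h4.le] at h1
    have h2 : ‖x - c‖ ≤ 1 / 4 := by nlinarith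
    have h3 := (PiLp.norm_apply_le (x - c) i).trans h2
    simp only [hcdef, PiLp.sub_apply, Real.norm_eq_abs, abs_le] at h3
    constructor <;> linarith [h3.1, h3.2]
  have hc' : HasCompactSupport fun y => ψ ((4 * R) • (y - c)) := by
    have e : (fun y => ψ ((4 * R) • (y - c))) =
        ψ ∘ ((Homeomorph.subRight c).trans (Homeomorph.smulOfNeZero (4 * R) h4.ne')) := rfl
    rw [e]
    exact hc.comp_homeomorph _
  have h := integral_comp_jacobian_nonpos_of_cube hF hF0 hψ' hc' (by norm_num) hsupp
  simp only [jacobian_comp_smul_sub (hψ.differentiable (by simp)), hhom _ _ h4] at h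
  rw [integral_const_mul, integral_sub_right_eq_self
    (fun x => F (jacobian ψ ((4 * R) • x))) c, Measure.integral_comp_smul volume
    (fun x => F (jacobian ψ x)), smul_eq_mul, ← mul_assoc] at h
  refine nonpos_of_mul_nonpos_right h (by positivity)

/-! ### A Poincaré inequality with a gain of integrability -/

lemma lintegral_comp_add_smul {n : ℕ} (k : EuclideanSpace ℝ (Fin n) → ℝ≥0∞)
    (a : EuclideanSpace ℝ (Fin n)) {t : ℝ} (ht : 0 < t) :
    ∫⁻ y, k (a + t • y) = ENNReal.ofReal (t⁻¹ ^ n) * ∫⁻ y, k y := by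
  have h1 := (Homeomorph.smulOfNeZero (α := EuclideanSpace ℝ (Fin n)) t
    ht.ne').measurableEmbedding.lintegral_map (μ := volume) (fun y => k (a + y))
  have h2 := Measure.map_addHaar_smul (volume : Measure (EuclideanSpace ℝ (Fin n))) ht.ne'
  have h3 : Measure.map (Homeomorph.smulOfNeZero (α := EuclideanSpace ℝ (Fin n)) t
    ht.ne') volume = ENNReal.ofReal |(t ^ Module.finrank ℝ (EuclideanSpace ℝ (Fin n)))⁻¹| •
      volume := h2
  rw [h3, lintegral_smul_measure, lintegral_add_left_eq_self] at h1
  have h4 : |(t ^ Module.finrank ℝ (EuclideanSpace ℝ (Fin n)))⁻¹| = t⁻¹ ^ n := by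
    rw [finrank_euclideanSpace_fin, abs_of_pos (by positivity), inv_pow]
  rw [h4] at h1
  exact h1.symm

lemma lintegral_rpow_le_of_isProbabilityMeasure {α : Type*} [MeasurableSpace α] {μ : Measure α}
    [IsProbabilityMeasure μ] {f : α → ℝ≥0∞} (hf : AEMeasurable f μ) {r : ℝ} (hr : 1 ≤ r) :
    (∫⁻ x, f x ∂μ) ^ r ≤ ∫⁻ x, f x ^ r ∂μ := by
  have h := eLpNorm'_le_eLpNorm'_of_exponent_le one_pos hr μ hf.aestronglyMeasurable
  simp only [eLpNorm', enorm_eq_self, ENNReal.rpow_one, ne_eq, one_ne_zero, not_false_eq_true,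
    div_self] at h
  calc _ ≤ ((∫⁻ x, f x ^ r ∂μ) ^ (1 / r)) ^ r := by gcongr
    _ = _ := by rw [← ENNReal.rpow_mul, one_div_mul_cancel (by linarith), ENNReal.rpow_one]

lemma norm_fderiv_apply_le_jacobian {m n : ℕ}
    (v : EuclideanSpace ℝ (Fin n) → EuclideanSpace ℝ (Fin m)) (x w : EuclideanSpace ℝ (Fin n)) :
    ‖fderiv ℝ v x w‖ ≤ ‖jacobian v x‖ * ‖w‖ := by
  have h := Matrix.l2_opNorm_mulVec (jacobian v x) w
  convert h using 2
  ext i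
  have hw : w = ∑ j, w j • EuclideanSpace.single j (1 : ℝ) := by
    ext k; simp [Pi.single_apply]
  conv_lhs => rw [hw]
  simp [jacobian, Matrix.mulVec, dotProduct, mul_comm]

lemma enorm_sub_le_lintegral_jacobian {m n : ℕ}
    {v : EuclideanSpace ℝ (Fin n) → EuclideanSpace ℝ (Fin m)} (hv : ContDiff ℝ ∞ v)
    (x y : EuclideanSpace ℝ (Fin n)) :
    ‖v y - v x‖ₑ ≤ ‖y - x‖ₑ * ∫⁻ t in Ioc (0 : ℝ) 1, ‖jacobian v (x + t • (y - x))‖ₑ := by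
  have hc : Continuous fun t : ℝ => fderiv ℝ v (x + t • (y - x)) (y - x) := by
    have h1 : Continuous (fderiv ℝ v) := hv.continuous_fderiv (by simp)
    fun_prop
  have hd : ∀ t : ℝ, HasDerivAt (fun t : ℝ => v (x + t • (y - x)))
      (fderiv ℝ v (x + t • (y - x)) (y - x)) t := by
    intro t
    have h1 := (hv.differentiable (by simp) (x + t • (y - x))).hasFDerivAt
    have h2 : HasDerivAt (fun t : ℝ => x + t • (y - x)) (y - x) t := by
      simpa using ((hasDerivAt_id t).smul_const (y - x)).const_add x
    exact h1.comp_hasDerivAt t h2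
  have h := intervalIntegral.integral_eq_sub_of_hasDerivAt (fun t _ => hd t)
    (hc.intervalIntegrable 0 1)
  simp only [one_smul, add_sub_cancel, zero_smul, add_zero] at h
  rw [← h, intervalIntegral.integral_of_le zero_le_one]
  refine (enorm_integral_le_lintegral_enorm _).trans ?_
  rw [← lintegral_const_mul' _ _ enorm_ne_top]
  refine lintegral_mono fun t => ?_
  rw [← ofReal_norm, ← ofReal_norm, ← ofReal_norm, ← ENNReal.ofReal_mul (norm_nonneg _)]
  apply ENNReal.ofReal_le_ofReal
  rw [mul_comm ‖y - x‖]
  exact norm_fderiv_apply_le_jacobian _ _ _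

section Poincare

variable {n : ℕ}

/-- Averages of a function over the dilates of `B` with centre `x` and ratio `t`. -/
lemma lintegral_dilate_le {B : Set (EuclideanSpace ℝ (Fin n))} (hB : Convex ℝ B)
    (hBm : MeasurableSet B) (k : EuclideanSpace ℝ (Fin n) → ℝ≥0∞)
    {x : EuclideanSpace ℝ (Fin n)} (hx : x ∈ B) {t : ℝ} (ht : 0 < t) (ht1 : t ≤ 1) :
    ∫⁻ y in B, k (x + t • (y - x)) ≤ ENNReal.ofReal (t⁻¹ ^ n) * ∫⁻ y in B, k y := by
  rw [← lintegral_indicator hBm, ← lintegral_indicator hBm, ← lintegral_comp_add_smul _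
    ((1 - t) • x) ht]
  refine lintegral_mono fun y => ?_
  by_cases hy : y ∈ B
  · have e : (1 - t) • x + t • y = x + t • (y - x) := by module
    have h1 : (1 - t) • x + t • y ∈ B := hB hx hy (by linarith) ht.le (by ring)
    simp only [indicator_of_mem hy, indicator_of_mem h1]
    rw [e]
  · simp [hy]

/-- The double average over dilates is bounded uniformly in `t`: for `t ≤ 1 / 2` the roles of `x`
and `y` are exchanged, which turns the ratio `t` into `1 - t`. -/
lemma lintegral_lintegral_dilate_le {B : Set (EuclideanSpace ℝ (Fin n))} (hB : Convex ℝ B)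
    (hBm : MeasurableSet B) {k : EuclideanSpace ℝ (Fin n) → ℝ≥0∞} (hk : Measurable k)
    {t : ℝ} (ht : 0 < t) (ht1 : t ≤ 1) :
    ∫⁻ x in B, ∫⁻ y in B, k (x + t • (y - x)) ≤
      2 ^ n * volume B * ∫⁻ y in B, k y := by
  have hpow : ∀ s : ℝ, 1 / 2 ≤ s → ENNReal.ofReal (s⁻¹ ^ n) ≤ 2 ^ n := by
    intro s hs
    have h0 : 0 < s := by linarith
    rw [ENNReal.ofReal_pow (by positivity)]
    gcongr
    rw [← ENNReal.ofReal_ofNat 2]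
    apply ENNReal.ofReal_le_ofReal
    rw [inv_le_comm₀ h0 (by norm_num)]
    linarith
  have hmain : ∀ s : ℝ, 1 / 2 ≤ s → s ≤ 1 →
      ∫⁻ x in B, ∫⁻ y in B, k (x + s • (y - x)) ≤ 2 ^ n * volume B * ∫⁻ y in B, k y := by
    intro s hs hs1
    calc _ ≤ ∫⁻ x in B, 2 ^ n * ∫⁻ y in B, k y := by
          refine setLIntegral_mono' hBm fun x hx => ?_
          refine (lintegral_dilate_le hB hBm k hx (by linarith) hs1).trans ?_
          gcongr
          exact hpow s hs
      _ = _ := by rw [setLIntegral_const]; ring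
  rcases le_total (1 / 2) t with h | h
  · exact hmain t h ht1
  · rw [lintegral_lintegral_swap]
    · have e : ∀ x y : EuclideanSpace ℝ (Fin n), x + t • (y - x) = y + (1 - t) • (x - y) := by
        intro x y; module
      simp only [e]
      exact hmain (1 - t) (by linarith) (by linarith)
    · refine Measurable.aemeasurable ?_
      exact hk.comp (by fun_prop)

/-- For `q ≤ s` with `n (s / q - 1) < 1`, the oscillation of a smooth map on a ball is controlled
in `L^s` by its derivative in `L^q`. The gain comes from bounding a fraction `s / q - 1` of the
averages of `‖Dv‖^q` over dilates of ratio `t` by `t⁻ⁿ`, which remains integrable in `t`. -/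
lemma exists_poincare_gain (m n : ℕ) {q s : ℝ} (hq : 1 ≤ q) (hqs : q ≤ s)
    (hn : n * (s / q - 1) < 1) :
    ∃ C : ℝ≥0, ∀ v : EuclideanSpace ℝ (Fin n) → EuclideanSpace ℝ (Fin m), ContDiff ℝ ∞ v →
      ∃ c, ∫⁻ x in Metric.closedBall 0 2, ‖v x - c‖ₑ ^ s ≤
        C * (∫⁻ x in Metric.closedBall 0 2, ‖jacobian v x‖ₑ ^ q) ^ (s / q) := by
  set B : Set (EuclideanSpace ℝ (Fin n)) := Metric.closedBall 0 2 with hB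
  have hBc : Convex ℝ B := convex_closedBall 0 2
  have hBm : MeasurableSet B := Metric.isClosed_closedBall.measurableSet
  have hB0 : volume B ≠ 0 := (Metric.measure_closedBall_pos volume _ (by norm_num)).ne'
  have hBt : volume B ≠ ⊤ := measure_closedBall_lt_top.ne
  have hq0 : 0 < q := by linarith
  set θ : ℝ := s / q - 1 with hθ
  have hθ0 : 0 ≤ θ := by rw [hθ, sub_nonneg, one_le_div hq0]; exact hqs
  have hsq : s / q = θ + 1 := by rw [hθ]; ring
  set T : ℝ≥0∞ := ∫⁻ t in Ioc (0 : ℝ) 1, ENNReal.ofReal (t⁻¹ ^ n) ^ θ with hT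
  have hTt : T ≠ ⊤ := by
    have h1 : IntegrableOn (fun t : ℝ => t ^ (-(n * θ))) (Ioc 0 1) :=
      (intervalIntegrable_iff_integrableOn_Ioc_of_le zero_le_one).1
        (intervalIntegral.intervalIntegrable_rpow' (by linarith))
    have h2 := h1.lintegral_lt_top
    rw [hT]
    refine ne_of_lt (lt_of_le_of_lt (le_of_eq ?_) h2)
    refine setLIntegral_congr_fun measurableSet_Ioc fun t ht => ?_
    rw [ENNReal.ofReal_rpow_of_nonneg (by have := ht.1; positivity) hθ0, ← Real.rpow_natCast,
      ← Real.rpow_mul (by have := ht.1; positivity), Real.inv_rpow ht.1.le,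
      Real.rpow_neg ht.1.le]
  have hC : (4 : ℝ≥0∞) ^ s * (T * ((volume B)⁻¹ ^ θ * 2 ^ n)) ≠ ⊤ := by
    refine ENNReal.mul_ne_top (ENNReal.rpow_ne_top_of_nonneg (by linarith) (by simp))
      (ENNReal.mul_ne_top hTt (ENNReal.mul_ne_top (ENNReal.rpow_ne_top_of_nonneg hθ0 ?_) ?_))
    · simpa using hB0
    · finiteness
  refine ⟨((4 : ℝ≥0∞) ^ s * (T * ((volume B)⁻¹ ^ θ * 2 ^ n))).toNNReal, fun v hv => ?_⟩
  rw [ENNReal.coe_toNNReal hC]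
  set ν : Measure (EuclideanSpace ℝ (Fin n)) := (volume B)⁻¹ • volume.restrict B with hν
  have hνp : IsProbabilityMeasure ν := ⟨by
    rw [hν, Measure.smul_apply, Measure.restrict_apply_univ, smul_eq_mul,
      ENNReal.inv_mul_cancel hB0 hBt]⟩
  have hτp : IsProbabilityMeasure ((volume : Measure ℝ).restrict (Ioc 0 1)) := ⟨by simp⟩
  have hvc : Continuous v := hv.continuous
  have hJc : Continuous (jacobian v) := continuous_jacobian hv
  set g : EuclideanSpace ℝ (Fin n) → ℝ≥0∞ := fun x => ‖jacobian v x‖ₑ with hg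
  have hgm : Measurable g := hJc.enorm.measurable
  have hgq : Measurable fun x => g x ^ q := hgm.pow_const q
  set I : ℝ≥0∞ := ∫⁻ x in B, g x ^ q with hI
  have hvi : Integrable v ν :=
    (hvc.continuousOn.integrableOn_compact (isCompact_closedBall 0 2)).smul_measure (by simpa)
  refine ⟨∫ y, v y ∂ν, ?_⟩
  set J : EuclideanSpace ℝ (Fin n) → ℝ → ℝ≥0∞ :=
    fun x t => ∫⁻ y, g (x + t • (y - x)) ^ q ∂ν with hJ
  have hJm : Measurable fun z : EuclideanSpace ℝ (Fin n) × ℝ => J z.1 z.2 := by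
    refine Measurable.lintegral_prod_right'
      (f := fun w : (EuclideanSpace ℝ (Fin n) × ℝ) × EuclideanSpace ℝ (Fin n) =>
        g (w.1.1 + w.1.2 • (w.2 - w.1.1)) ^ q) ?_
    exact hgq.comp (by fun_prop)
  have hpt : ∀ x ∈ B, ‖v x - ∫ y, v y ∂ν‖ₑ ^ s ≤
      4 ^ s * ∫⁻ t in Ioc (0 : ℝ) 1, J x t ^ (s / q) := by
    intro x hx
    have hcomp : Measurable fun z : EuclideanSpace ℝ (Fin n) × ℝ => g (x + z.2 • (z.1 - x)) :=
      hgm.comp (by fun_prop)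
    have e1 : v x - ∫ y, v y ∂ν = ∫ y, (v x - v y) ∂ν := by
      rw [integral_sub (integrable_const _) hvi]; simp
    have e2 : ‖v x - ∫ y, v y ∂ν‖ₑ ≤
        4 * ∫⁻ t in Ioc (0 : ℝ) 1, ∫⁻ y, g (x + t • (y - x)) ∂ν := by
      rw [e1]
      refine (enorm_integral_le_lintegral_enorm _).trans ?_
      rw [lintegral_lintegral_swap (by
        exact (hgm.comp (by fun_prop : Measurable fun z : ℝ × EuclideanSpace ℝ (Fin n) =>
          x + z.1 • (z.2 - x))).aemeasurable), ← lintegral_const_mul' _ _ (by simp)]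
      refine lintegral_mono_ae ?_
      rw [hν]
      refine Measure.ae_smul_measure ((ae_restrict_iff' hBm).2 (.of_forall fun y hy => ?_)) _
      rw [← enorm_neg, neg_sub]
      refine (enorm_sub_le_lintegral_jacobian hv x y).trans ?_
      gcongr
      rw [← ofReal_norm, ← ENNReal.ofReal_ofNat 4]
      apply ENNReal.ofReal_le_ofReal
      rw [hB, mem_closedBall_zero_iff] at hx hy
      linarith [norm_sub_le y x]
    have hs1 : 1 ≤ s := hq.trans hqs
    calc _ ≤ (4 * ∫⁻ t in Ioc (0 : ℝ) 1, ∫⁻ y, g (x + t • (y - x)) ∂ν) ^ s := by gcongr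
      _ = 4 ^ s * (∫⁻ t in Ioc (0 : ℝ) 1, ∫⁻ y, g (x + t • (y - x)) ∂ν) ^ s :=
        ENNReal.mul_rpow_of_nonneg _ _ (by linarith)
      _ ≤ 4 ^ s * ∫⁻ t in Ioc (0 : ℝ) 1, (∫⁻ y, g (x + t • (y - x)) ∂ν) ^ s := by
        gcongr
        refine lintegral_rpow_le_of_isProbabilityMeasure ?_ hs1
        refine Measurable.aemeasurable (Measurable.lintegral_prod_right'
          (f := fun z : ℝ × EuclideanSpace ℝ (Fin n) => g (x + z.1 • (z.2 - x))) ?_)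
        exact hgm.comp (by fun_prop)
      _ ≤ _ := by
        gcongr with t
        have : s = q * (s / q) := by field_simp
        conv_lhs => rw [this, ENNReal.rpow_mul]
        gcongr
        exact lintegral_rpow_le_of_isProbabilityMeasure
          (hgm.comp (by fun_prop)).aemeasurable hq
  have hJle : ∀ x ∈ B, ∀ t ∈ Ioc (0 : ℝ) 1,
      J x t ≤ (volume B)⁻¹ * (ENNReal.ofReal (t⁻¹ ^ n) * I) := by
    intro x hx t ht
    simp only [hJ, hν, lintegral_smul_measure, smul_eq_mul]
    gcongr
    exact lintegral_dilate_le hBc hBm (fun z => g z ^ q) hx ht.1 ht.2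
  have hJint : ∀ t ∈ Ioc (0 : ℝ) 1, ∫⁻ x in B, J x t ≤ 2 ^ n * I := by
    intro t ht
    simp only [hJ, hν, lintegral_smul_measure, smul_eq_mul]
    rw [lintegral_const_mul' _ _ (by simpa)]
    refine (mul_le_mul_right (lintegral_lintegral_dilate_le hBc hBm hgq ht.1 ht.2) _).trans
      (le_of_eq ?_)
    calc _ = ((volume B)⁻¹ * volume B) * (2 ^ n * I) := by ring
      _ = _ := by rw [ENNReal.inv_mul_cancel hB0 hBt, one_mul]
  clear_value J I T
  have hinner : ∀ t ∈ Ioc (0 : ℝ) 1, ∫⁻ x in B, J x t ^ (s / q) ≤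
      ENNReal.ofReal (t⁻¹ ^ n) ^ θ * (((volume B)⁻¹ ^ θ * 2 ^ n) * I ^ (s / q)) := by
    intro t ht
    have h1 : ∫⁻ x in B, J x t ^ (s / q) ≤
        ∫⁻ x in B, ((volume B)⁻¹ * (ENNReal.ofReal (t⁻¹ ^ n) * I)) ^ θ * J x t := by
      refine setLIntegral_mono' hBm fun x hx => ?_
      rw [hsq, ENNReal.rpow_add_of_nonneg _ _ hθ0 zero_le_one, ENNReal.rpow_one]
      gcongr
      exact hJle x hx t ht
    refine h1.trans ?_
    have hJt : Measurable fun x => J x t :=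
      hJm.comp (by fun_prop : Measurable fun x : EuclideanSpace ℝ (Fin n) => (x, t))
    rw [lintegral_const_mul _ hJt]
    refine (mul_le_mul_right (hJint t ht) _).trans (le_of_eq ?_)
    rw [ENNReal.mul_rpow_of_nonneg _ _ hθ0, ENNReal.mul_rpow_of_nonneg _ _ hθ0, hsq,
      ENNReal.rpow_add_of_nonneg _ _ hθ0 zero_le_one, ENNReal.rpow_one]
    generalize (volume B)⁻¹ ^ θ = a, ENNReal.ofReal (t⁻¹ ^ n) ^ θ = b, I ^ θ = c
    ring
  have h4 : (4 : ℝ≥0∞) ^ s ≠ ⊤ := ENNReal.rpow_ne_top_of_nonneg (by linarith) (by simp)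
  have hm : Measurable fun t : ℝ => ENNReal.ofReal (t⁻¹ ^ n) ^ θ := by fun_prop
  refine (setLIntegral_mono' hBm hpt).trans ?_
  rw [lintegral_const_mul' _ _ h4, lintegral_lintegral_swap (hJm.pow_const _).aemeasurable,
    mul_assoc]
  gcongr
  refine (setLIntegral_mono' measurableSet_Ioc hinner).trans (le_of_eq ?_)
  rw [lintegral_mul_const _ hm, ← mul_assoc, ← hT]

end Poincare

/-! ### The Caccioppoli inequality for smooth maps -/

lemma norm_matrix_of_clm {m n : ℕ}
    (T : EuclideanSpace ℝ (Fin n) →L[ℝ] EuclideanSpace ℝ (Fin m)) :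
    ‖(Matrix.of fun i j => T (EuclideanSpace.single j 1) i : Matrix (Fin m) (Fin n) ℝ)‖ = ‖T‖ := by
  rw [Matrix.l2_opNorm_def]
  congr 1
  ext w i
  have hw : w = ∑ j, w j • EuclideanSpace.single j (1 : ℝ) := by
    ext k; simp [Pi.single_apply]
  conv_rhs => rw [hw]
  simp [Matrix.toLpLin_apply, Matrix.mulVec, dotProduct, mul_comm]

lemma jacobian_smul_sub {m n : ℕ} {v : EuclideanSpace ℝ (Fin n) → EuclideanSpace ℝ (Fin m)}
    (hv : ContDiff ℝ ∞ v) {η : EuclideanSpace ℝ (Fin n) → ℝ} (hη : ContDiff ℝ ∞ η)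
    (c : EuclideanSpace ℝ (Fin m)) (x : EuclideanSpace ℝ (Fin n)) :
    jacobian (fun x => η x • (v x - c)) x = η x • jacobian v x +
      Matrix.of fun i j => (fderiv ℝ η x).smulRight (v x - c) (EuclideanSpace.single j 1) i := by
  have h1 := (hη.differentiable (by simp) x).hasFDerivAt
  have h2 := (hv.differentiable (by simp) x).hasFDerivAt
  have h3 : fderiv ℝ (fun x => η x • (v x - c)) x = _ := (h1.smul (h2.sub_const c)).fderiv
  ext i j
  simp [jacobian, h3]

section Caccioppoli

variable {m n : ℕ} {p q L : ℝ} {F : Matrix (Fin m) (Fin n) ℝ → ℝ}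

/-- The exponent conjugate to `q / (p - 1)` is `q / (q - p + 1)`: the exponent in which `u - b` has
to be estimated by the Poincaré inequality when `|Du| ^ (p - 1)` is estimated in terms of
`|Du| ^ q`. -/
lemma holderConjugate_of_gap (hp : 1 < p) (hpq : p < q + 1) :
    (q / (p - 1)).HolderConjugate (q / (q - p + 1)) := by
  have h1 : 0 < q - p + 1 := by linarith
  have h2 : 0 < p - 1 := by linarith
  have h3 : 0 < q := by linarith
  rw [Real.holderConjugate_iff]
  refine ⟨by rw [one_lt_div h2]; linarith, ?_⟩
  rw [inv_div, inv_div, ← add_div]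
  rw [show p - 1 + (q - p + 1) = q by ring, div_self h3.ne']

/-- The two lower order terms of the Caccioppoli inequality, estimated by Hölder's inequality once
the Poincaré inequality with exponent `s = q / (q - p + 1)` is available. -/
lemma lintegral_lower_order_le {α : Type*} [MeasurableSpace α] {μ : Measure α} [IsFiniteMeasure μ]
    (hp : 1 < p) (hqp : q < p) (hpq : p < q + 1)
    {g w : α → ℝ≥0∞} (hg : AEMeasurable g μ) (hw : AEMeasurable w μ) {C : ℝ≥0∞}
    (h : ∫⁻ x, w x ^ (q / (q - p + 1)) ∂μ ≤
      C * (∫⁻ x, g x ^ q ∂μ) ^ (q / (q - p + 1) / q)) :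
    ∫⁻ x, (g x ^ (p - 1) * w x + w x ^ p) ∂μ ≤
      (C ^ ((q - p + 1) / q) +
        C ^ (p * ((q - p + 1) / q)) * μ univ ^ (1 - p * ((q - p + 1) / q))) *
        (∫⁻ x, g x ^ q ∂μ) ^ (p / q) := by
  have h1 : 0 < q - p + 1 := by linarith
  have h2 : 0 < p - 1 := by linarith
  have h3 : 0 < q := by linarith
  set s := q / (q - p + 1) with hs
  have hs0 : 0 < s := by positivity
  have hs1 : (q - p + 1) / q = 1 / s := by rw [hs, one_div_div]
  set I := ∫⁻ x, g x ^ q ∂μ with hI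
  have hgw : AEMeasurable (fun x => g x ^ (p - 1) * w x) μ := (hg.pow_const _).mul hw
  rw [hs1, lintegral_add_left' hgw, add_mul]
  refine add_le_add ?_ ?_
  · have hH := ENNReal.lintegral_mul_le_Lp_mul_Lq μ (holderConjugate_of_gap hp hpq)
      (hg.pow_const (p - 1)) hw
    have e1 : ∀ x, (g x ^ (p - 1)) ^ (q / (p - 1)) = g x ^ q := fun x => by
      rw [← ENNReal.rpow_mul]; congr 1; field_simp
    simp only [e1, Pi.mul_apply, one_div_div, hs1] at hH
    rw [← hs, ← hI] at hH
    refine hH.trans ?_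
    calc _ ≤ I ^ ((p - 1) / q) * (C * I ^ (s / q)) ^ (1 / s) := by
          gcongr
      _ = C ^ (1 / s) * (I ^ ((p - 1) / q) * I ^ (1 / q)) := by
          rw [ENNReal.mul_rpow_of_nonneg _ _ (by positivity), ← ENNReal.rpow_mul,
            show s / q * (1 / s) = 1 / q by field_simp]
          ac_rfl
      _ = C ^ (1 / s) * I ^ (p / q) := by
          rw [← ENNReal.rpow_add_of_nonneg _ _ (by positivity) (by positivity)]
          congr 2; field_simp; ring
  · have hps : p ≤ s := by
      rw [hs, le_div_iff₀ h1]; nlinarith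
    have hH := eLpNorm'_le_eLpNorm'_mul_rpow_measure_univ (μ := μ) (by linarith : 0 < p) hps
      hw.aestronglyMeasurable
    simp only [eLpNorm', enorm_eq_self] at hH
    have hp0 : 0 < p := by linarith
    calc ∫⁻ x, w x ^ p ∂μ = ((∫⁻ x, w x ^ p ∂μ) ^ (1 / p)) ^ p := by
          rw [← ENNReal.rpow_mul, one_div_mul_cancel hp0.ne', ENNReal.rpow_one]
      _ ≤ ((∫⁻ x, w x ^ s ∂μ) ^ (1 / s) * μ univ ^ (1 / p - 1 / s)) ^ p := by gcongr
      _ ≤ ((C * I ^ (s / q)) ^ (1 / s) * μ univ ^ (1 / p - 1 / s)) ^ p := by gcongr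
      _ = _ := by
          rw [ENNReal.mul_rpow_of_nonneg _ _ hp0.le, ENNReal.mul_rpow_of_nonneg _ _ (by positivity),
            ENNReal.mul_rpow_of_nonneg _ _ hp0.le, ← ENNReal.rpow_mul, ← ENNReal.rpow_mul,
            ← ENNReal.rpow_mul, ← ENNReal.rpow_mul, show 1 / s * p = p * (1 / s) by ring,
            show s / q * (p * (1 / s)) = p / q by field_simp,
            show (1 / p - 1 / s) * p = 1 - p * (1 / s) by field_simp]
          ac_rfl

/-- The fixed cutoff function: `1` on the unit ball and supported in the ball of radius `2`. -/
noncomputable def cutoff (n : ℕ) : ContDiffBump (0 : EuclideanSpace ℝ (Fin n)) :=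
  ⟨1, 2, one_pos, one_lt_two⟩

lemma continuous_cutoff_rpow_mul (hFc : Continuous F) (hp : 1 < p)
    {G : EuclideanSpace ℝ (Fin n) → Matrix (Fin m) (Fin n) ℝ} (hG : Continuous G) :
    Continuous fun x => cutoff n x ^ p * F (G x) :=
  ((cutoff n).continuous.rpow_const fun _ => Or.inr (by linarith)).mul (hFc.comp hG)

lemma integrable_cutoff_rpow_mul (hFc : Continuous F) (hp : 1 < p)
    {G : EuclideanSpace ℝ (Fin n) → Matrix (Fin m) (Fin n) ℝ} (hG : Continuous G) :
    Integrable fun x => cutoff n x ^ p * F (G x) := by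
  refine (continuous_cutoff_rpow_mul hFc hp hG).integrable_of_hasCompactSupport ?_
  exact HasCompactSupport.mul_right ((cutoff n).hasCompactSupport.comp_left (g := fun t => t ^ p)
    (Real.zero_rpow (by linarith)))

/-- Caccioppoli's inequality on the unit scale: `cutoff n • (v - c)` is an admissible test map, and
the Lipschitz bound of `F` controls the effect of moving the cutoff out of `F`. -/
lemma exists_caccioppoli_unit (hp : 1 < p) (hF : IsQuasiconcave F)
    (hhom : IsHomogeneousOfDegree p F) (hL : GrowthBound p L F)
    (hq : 1 ≤ q) (hqp : q < p) (hpq : p < q + 1) (hn : n * (q / (q - p + 1) / q - 1) < 1) :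
    ∃ C : ℝ≥0, ∀ v : EuclideanSpace ℝ (Fin n) → EuclideanSpace ℝ (Fin m), ContDiff ℝ ∞ v →
      ENNReal.ofReal (∫ x, cutoff n x ^ p * F (jacobian v x)) ≤
        C * (∫⁻ x in Metric.closedBall 0 2, ‖jacobian v x‖ₑ ^ q) ^ (p / q) := by
  have hgap : 0 < q - p + 1 := by linarith
  obtain ⟨C₁, hC₁⟩ := exists_poincare_gain m n hq
    (by rw [le_div_iff₀ hgap]; nlinarith : q ≤ q / (q - p + 1)) hn
  have hηs : ContDiff ℝ ∞ (cutoff n) := (cutoff n).contDiff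
  have hηc : HasCompactSupport (cutoff n) := (cutoff n).hasCompactSupport
  obtain ⟨M₀, hM₀⟩ := (hηc.fderiv ℝ).exists_bound_of_continuous
    (hηs.continuous_fderiv (by simp))
  set M := max M₀ 1 with hM
  have hM1 : 1 ≤ M := le_max_right _ _
  have hMb : ∀ x, ‖fderiv ℝ (cutoff n) x‖ ≤ M := fun x => (hM₀ x).trans (le_max_left _ _)
  set B : Set (EuclideanSpace ℝ (Fin n)) := Metric.closedBall 0 2 with hB
  have hBm : MeasurableSet B := Metric.isClosed_closedBall.measurableSet
  have hBt : volume B ≠ ⊤ := measure_closedBall_lt_top.ne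
  have hBf : IsFiniteMeasure ((volume : Measure (EuclideanSpace ℝ (Fin n))).restrict B) :=
    ⟨by rw [Measure.restrict_apply_univ]; exact hBt.lt_top⟩
  set K : ℝ := L * 3 ^ (p - 1) * M ^ p with hK
  have hK0 : 0 ≤ K := by have := hL.nonneg; positivity
  have hps : 0 ≤ 1 - p * ((q - p + 1) / q) := by
    have : p * ((q - p + 1) / q) ≤ 1 := by
      rw [← mul_div_assoc, div_le_one (by linarith)]; nlinarith
    linarith
  set D : ℝ≥0∞ := ENNReal.ofReal K * ((C₁ : ℝ≥0∞) ^ ((q - p + 1) / q) +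
    (C₁ : ℝ≥0∞) ^ (p * ((q - p + 1) / q)) * volume B ^ (1 - p * ((q - p + 1) / q))) with hD
  have hDt : D ≠ ⊤ := by
    refine ENNReal.mul_ne_top ENNReal.ofReal_ne_top (ENNReal.add_ne_top.2 ⟨?_, ?_⟩)
    · exact ENNReal.rpow_ne_top_of_nonneg (by positivity) ENNReal.coe_ne_top
    · exact ENNReal.mul_ne_top (ENNReal.rpow_ne_top_of_nonneg (by positivity) ENNReal.coe_ne_top)
        (ENNReal.rpow_ne_top_of_nonneg hps hBt)
  refine ⟨D.toNNReal, fun v hv => ?_⟩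
  rw [ENNReal.coe_toNNReal hDt]
  obtain ⟨c, hc⟩ := hC₁ v hv
  have hFc := hL.continuous hp
  have hJc := continuous_jacobian hv
  set ψ : EuclideanSpace ℝ (Fin n) → EuclideanSpace ℝ (Fin m) :=
    fun x => cutoff n x • (v x - c) with hψ
  have hψs : ContDiff ℝ ∞ ψ := hηs.smul (hv.sub contDiff_const)
  have hψc : HasCompactSupport ψ := hηc.smul_right
  have hψJc := continuous_jacobian hψs
  have hint1 := integrable_cutoff_rpow_mul hFc hp hJc
  have hint2 : Integrable fun x => F (jacobian ψ x) :=
    (hFc.comp hψJc).integrable_of_hasCompactSupport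
      ((hasCompactSupport_jacobian hψc).comp_left hL.zero)
  have hneg := integral_comp_jacobian_nonpos hF hhom hL.zero hψs hψc
  have hηF : ∀ x, cutoff n x ^ p * F (jacobian v x) = F (cutoff n x • jacobian v x) := by
    intro x
    rcases ((cutoff n).nonneg (x := x)).eq_or_lt with h0 | h0
    · rw [← h0, zero_smul, hL.zero, Real.zero_rpow (by linarith), zero_mul]
    · rw [hhom _ _ h0]
  -- the error made by commuting `F` with the cutoff
  have herr : ∀ x, ‖F (jacobian ψ x) - cutoff n x ^ p * F (jacobian v x)‖ₑ ≤
      B.indicator (fun x => ENNReal.ofReal K *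
        (‖jacobian v x‖ₑ ^ (p - 1) * ‖v x - c‖ₑ + ‖v x - c‖ₑ ^ p)) x := by
    intro x
    rw [hηF, hψ, jacobian_smul_sub hv hηs]
    set E : Matrix (Fin m) (Fin n) ℝ :=
      Matrix.of fun i j => (fderiv ℝ (cutoff n) x).smulRight (v x - c)
        (EuclideanSpace.single j 1) i with hE
    have hEn : ‖E‖ ≤ M * ‖v x - c‖ := by
      rw [hE, norm_matrix_of_clm, ContinuousLinearMap.norm_smulRight_apply]
      gcongr
      exact hMb x
    by_cases hx : x ∈ B
    · rw [indicator_of_mem hx]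
      have h1 := hL.abs_add_sub_le hp (cutoff n x • jacobian v x) E
      have hη1 : ‖cutoff n x • jacobian v x‖ ≤ ‖jacobian v x‖ := by
        rw [norm_smul, Real.norm_of_nonneg (cutoff n).nonneg]
        exact mul_le_of_le_one_left (norm_nonneg _) (cutoff n).le_one
      have hLn := hL.nonneg
      have hMp : M ≤ M ^ p := by
        simpa using Real.rpow_le_rpow_of_exponent_le hM1 hp.le
      have h2 : |F (cutoff n x • jacobian v x + E) - F (cutoff n x • jacobian v x)| ≤
          K * (‖jacobian v x‖ ^ (p - 1) * ‖v x - c‖ + ‖v x - c‖ ^ p) := by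
        refine h1.trans ?_
        calc _ ≤ L * 3 ^ (p - 1) * (‖jacobian v x‖ ^ (p - 1) * (M * ‖v x - c‖) +
              (M * ‖v x - c‖) ^ p) := by gcongr
          _ = L * 3 ^ (p - 1) * (M * (‖jacobian v x‖ ^ (p - 1) * ‖v x - c‖) +
              M ^ p * ‖v x - c‖ ^ p) := by
            rw [Real.mul_rpow (by positivity) (norm_nonneg _)]; ring
          _ ≤ L * 3 ^ (p - 1) * (M ^ p * (‖jacobian v x‖ ^ (p - 1) * ‖v x - c‖) +
              M ^ p * ‖v x - c‖ ^ p) := by gcongr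
          _ = _ := by rw [hK]; ring
      rw [← ofReal_norm, ← ofReal_norm, ← ofReal_norm,
        ENNReal.ofReal_rpow_of_nonneg (norm_nonneg _) (by linarith),
        ENNReal.ofReal_rpow_of_nonneg (norm_nonneg _) (by linarith),
        ← ENNReal.ofReal_mul (by positivity), ← ENNReal.ofReal_add (by positivity) (by positivity),
        ← ENNReal.ofReal_mul hK0]
      exact ENNReal.ofReal_le_ofReal h2
    · rw [indicator_of_notMem hx]
      have hts : x ∉ tsupport (cutoff n) := by rw [(cutoff n).tsupport_eq]; exact hx
      have hη0 : cutoff n x = 0 := image_eq_zero_of_notMem_tsupport hts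
      have hd0 : fderiv ℝ (cutoff n) x = 0 := by
        by_contra h
        exact hts (support_fderiv_subset ℝ h)
      have hE0 : E = 0 := by rw [hE, hd0]; ext; simp
      simp [hη0, hE0]
  have hle : ∫ x, cutoff n x ^ p * F (jacobian v x) ≤
      ‖∫ x, (F (jacobian ψ x) - cutoff n x ^ p * F (jacobian v x))‖ := by
    rw [integral_sub hint2 hint1]
    refine le_trans ?_ (neg_le_abs _)
    linarith
  calc _ ≤ ‖∫ x, (F (jacobian ψ x) - cutoff n x ^ p * F (jacobian v x))‖ₑ := by
        rw [← ofReal_norm]; exact ENNReal.ofReal_le_ofReal hle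
    _ ≤ ∫⁻ x, ‖F (jacobian ψ x) - cutoff n x ^ p * F (jacobian v x)‖ₑ :=
        enorm_integral_le_lintegral_enorm _
    _ ≤ ∫⁻ x in B, ENNReal.ofReal K *
        (‖jacobian v x‖ₑ ^ (p - 1) * ‖v x - c‖ₑ + ‖v x - c‖ₑ ^ p) := by
        rw [← lintegral_indicator hBm]
        exact lintegral_mono herr
    _ = ENNReal.ofReal K * ∫⁻ x in B,
        (‖jacobian v x‖ₑ ^ (p - 1) * ‖v x - c‖ₑ + ‖v x - c‖ₑ ^ p) :=
        lintegral_const_mul' _ _ ENNReal.ofReal_ne_top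
    _ ≤ _ := by
        rw [hD, mul_assoc]
        gcongr
        have := lintegral_lower_order_le (μ := volume.restrict B) hp hqp hpq
          hJc.enorm.measurable.aemeasurable
          (hv.continuous.sub continuous_const).enorm.measurable.aemeasurable hc
        rwa [Measure.restrict_apply_univ] at this

/-- Caccioppoli's inequality on a ball of radius `r`, with the cutoff rescaled accordingly. -/
lemma exists_caccioppoli (hp : 1 < p) (hF : IsQuasiconcave F)
    (hhom : IsHomogeneousOfDegree p F) (hL : GrowthBound p L F)
    (hq : 1 ≤ q) (hqp : q < p) (hpq : p < q + 1) (hn : n * (q / (q - p + 1) / q - 1) < 1) :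
    ∃ C : ℝ≥0, ∀ (x₀ : EuclideanSpace ℝ (Fin n)) (r : ℝ), 0 < r →
      ∀ u : EuclideanSpace ℝ (Fin n) → EuclideanSpace ℝ (Fin m), ContDiff ℝ ∞ u →
      ENNReal.ofReal (∫ x, cutoff n (r⁻¹ • (x - x₀)) ^ p * F (jacobian u x)) ≤
        C * ENNReal.ofReal (r ^ n) * (ENNReal.ofReal (r⁻¹ ^ n) *
          ∫⁻ x in Metric.closedBall x₀ (2 * r), ‖jacobian u x‖ₑ ^ q) ^ (p / q) := by
  obtain ⟨C, hC⟩ := exists_caccioppoli_unit hp hF hhom hL hq hqp hpq hn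
  refine ⟨C, fun x₀ r hr u hu => ?_⟩
  have hq0 : 0 < q := by linarith
  have e0 : (fun y => u (x₀ + r • y)) = fun y => u (r • (y - (-(r⁻¹ • x₀)))) := by
    ext1 y; rw [sub_neg_eq_add, smul_add, smul_smul, mul_inv_cancel₀ hr.ne', one_smul, add_comm]
  have hv : ContDiff ℝ ∞ fun y => r⁻¹ • u (x₀ + r • y) := by fun_prop
  have hJ : ∀ y, jacobian (fun y => r⁻¹ • u (x₀ + r • y)) y = jacobian u (x₀ + r • y) := by
    intro y
    have h1 : HasFDerivAt (fun y : EuclideanSpace ℝ (Fin n) => x₀ + r • y)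
      (r • ContinuousLinearMap.id ℝ _) y := ((hasFDerivAt_id y).const_smul r).const_add x₀
    have h2 := ((hu.differentiable (by simp) (x₀ + r • y)).hasFDerivAt.comp y h1).const_smul r⁻¹
    have h3 : fderiv ℝ (fun y => r⁻¹ • u (x₀ + r • y)) y = _ := h2.fderiv
    ext i j
    simp [jacobian, h3, hr.ne']
  have h := hC _ hv
  simp only [hJ] at h
  have hl : ∫ y, cutoff n y ^ p * F (jacobian u (x₀ + r • y)) =
      r⁻¹ ^ n * ∫ x, cutoff n (r⁻¹ • (x - x₀)) ^ p * F (jacobian u x) := by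
    rw [← integral_add_left_eq_self
      (fun x => cutoff n (r⁻¹ • (x - x₀)) ^ p * F (jacobian u x)) x₀]
    have := Measure.integral_comp_smul volume (fun y : EuclideanSpace ℝ (Fin n) =>
      cutoff n (r⁻¹ • (x₀ + y - x₀)) ^ p * F (jacobian u (x₀ + y))) r
    rw [smul_eq_mul, finrank_euclideanSpace_fin, abs_of_pos (by positivity), ← inv_pow] at this
    rw [← this]
    congr 1
    ext y
    rw [add_sub_cancel_left, smul_smul, inv_mul_cancel₀ hr.ne', one_smul]
  have hr' : ∫⁻ y in Metric.closedBall 0 2, ‖jacobian u (x₀ + r • y)‖ₑ ^ q =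
      ENNReal.ofReal (r⁻¹ ^ n) *
        ∫⁻ x in Metric.closedBall x₀ (2 * r), ‖jacobian u x‖ₑ ^ q := by
    rw [← lintegral_indicator Metric.isClosed_closedBall.measurableSet,
      ← lintegral_indicator Metric.isClosed_closedBall.measurableSet,
      ← lintegral_comp_add_smul _ x₀ hr]
    refine lintegral_congr fun y => ?_
    have : x₀ + r • y ∈ Metric.closedBall x₀ (2 * r) ↔
        y ∈ Metric.closedBall (0 : EuclideanSpace ℝ (Fin n)) 2 := by
      rw [mem_closedBall_iff_norm, add_sub_cancel_left, mem_closedBall_zero_iff, norm_smul,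
        Real.norm_of_nonneg hr.le, mul_comm, mul_le_mul_iff_left₀ hr]
    by_cases hy : y ∈ Metric.closedBall (0 : EuclideanSpace ℝ (Fin n)) 2
    · rw [indicator_of_mem hy, indicator_of_mem (this.2 hy)]
    · rw [indicator_of_notMem hy, indicator_of_notMem (mt this.1 hy)]
  rw [hl, hr', ENNReal.ofReal_mul (by positivity)] at h
  have hrr : ENNReal.ofReal (r ^ n) * ENNReal.ofReal (r⁻¹ ^ n) = 1 := by
    rw [← ENNReal.ofReal_mul (by positivity), ← mul_pow, mul_inv_cancel₀ hr.ne', one_pow,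
      ENNReal.ofReal_one]
  calc _ = ENNReal.ofReal (r ^ n) * (ENNReal.ofReal (r⁻¹ ^ n) *
      ENNReal.ofReal (∫ x, cutoff n (r⁻¹ • (x - x₀)) ^ p * F (jacobian u x))) := by
        rw [← mul_assoc, hrr, one_mul]
    _ ≤ ENNReal.ofReal (r ^ n) * _ := mul_le_mul_right h _
    _ = _ := by ac_rfl

end Caccioppoli

/-! ### Mollification -/

section Mollify

variable {n : ℕ} {E : Type*} [NormedAddCommGroup E] [NormedSpace ℝ E]

/-- Convolution of `f` with the normalized bump function `φ`. -/
noncomputable def mollify (φ : ContDiffBump (0 : EuclideanSpace ℝ (Fin n)))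
    (f : EuclideanSpace ℝ (Fin n) → E) : EuclideanSpace ℝ (Fin n) → E :=
  convolution (φ.normed volume) f (ContinuousLinearMap.lsmul ℝ ℝ) volume

lemma mollify_apply (φ : ContDiffBump (0 : EuclideanSpace ℝ (Fin n)))
    (f : EuclideanSpace ℝ (Fin n) → E) (x : EuclideanSpace ℝ (Fin n)) :
    mollify φ f x = ∫ t, φ.normed volume t • f (x - t) := rfl

lemma contDiff_mollify [CompleteSpace E] (φ : ContDiffBump (0 : EuclideanSpace ℝ (Fin n)))
    {f : EuclideanSpace ℝ (Fin n) → E} (hf : LocallyIntegrable f volume) :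
    ContDiff ℝ ∞ (mollify φ f) :=
  φ.hasCompactSupport_normed.contDiff_convolution_left _ φ.contDiff_normed hf

lemma mollify_add (φ : ContDiffBump (0 : EuclideanSpace ℝ (Fin n)))
    {f g : EuclideanSpace ℝ (Fin n) → E} (hf : LocallyIntegrable f volume)
    (hg : LocallyIntegrable g volume) : mollify φ (f + g) = mollify φ f + mollify φ g :=
  (φ.hasCompactSupport_normed.convolutionExists_left _ φ.continuous_normed hf).distrib_add
    (φ.hasCompactSupport_normed.convolutionExists_left _ φ.continuous_normed hg)

/-- Young's inequality for a mollifier: Jensen's inequality for the probability measure with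
density `φ`, then translation invariance. -/
lemma lintegral_mollify_rpow_le (φ : ContDiffBump (0 : EuclideanSpace ℝ (Fin n)))
    {f : EuclideanSpace ℝ (Fin n) → E} (hf : StronglyMeasurable f) {p : ℝ} (hp : 1 ≤ p) :
    ∫⁻ x, ‖mollify φ f x‖ₑ ^ p ≤ ∫⁻ x, ‖f x‖ₑ ^ p := by
  set π : Measure (EuclideanSpace ℝ (Fin n)) :=
    volume.withDensity fun t => ENNReal.ofReal (φ.normed volume t) with hπ
  have hm : Measurable fun t => ENNReal.ofReal (φ.normed volume t) :=
    (ENNReal.continuous_ofReal.comp φ.continuous_normed).measurable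
  have hprob : IsProbabilityMeasure π := ⟨by
    rw [hπ, withDensity_apply _ MeasurableSet.univ, Measure.restrict_univ,
      ← ofReal_integral_eq_lintegral_ofReal φ.integrable_normed
        (.of_forall φ.nonneg_normed), φ.integral_normed, ENNReal.ofReal_one]⟩
  have hfm : Measurable fun x => ‖f x‖ₑ := hf.enorm
  have h1 : ∀ x, ‖mollify φ f x‖ₑ ≤ ∫⁻ t, ‖f (x - t)‖ₑ ∂π := by
    intro x
    rw [mollify_apply, hπ, lintegral_withDensity_eq_lintegral_mul _ hm
      (by exact hfm.comp (by fun_prop : Measurable fun t => x - t))]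
    refine (enorm_integral_le_lintegral_enorm _).trans (le_of_eq (lintegral_congr fun t => ?_))
    rw [Pi.mul_apply, enorm_smul, Real.enorm_eq_ofReal (φ.nonneg_normed t)]
  have h2 : ∀ x, ‖mollify φ f x‖ₑ ^ p ≤ ∫⁻ t, ‖f (x - t)‖ₑ ^ p ∂π := fun x =>
    (ENNReal.rpow_le_rpow (h1 x) (by linarith)).trans
      (lintegral_rpow_le_of_isProbabilityMeasure
        (hfm.comp (measurable_const.sub measurable_id)).aemeasurable hp)
  calc _ ≤ ∫⁻ x, ∫⁻ t, ‖f (x - t)‖ₑ ^ p ∂π := lintegral_mono h2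
    _ = ∫⁻ t, (∫⁻ x, ‖f (x - t)‖ₑ ^ p) ∂π := by
        refine lintegral_lintegral_swap (Measurable.aemeasurable ?_)
        exact (hfm.comp (measurable_fst.sub measurable_snd)).pow_const p
    _ = ∫⁻ t, (∫⁻ x, ‖f x‖ₑ ^ p) ∂π := by
        refine lintegral_congr fun t => ?_
        exact lintegral_sub_right_eq_self (fun x => ‖f x‖ₑ ^ p) t
    _ = _ := by simp

lemma mollify_congr_ae (φ : ContDiffBump (0 : EuclideanSpace ℝ (Fin n)))
    {f g : EuclideanSpace ℝ (Fin n) → E} (h : f =ᵐ[volume] g) : mollify φ f = mollify φ g := by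
  ext x
  rw [mollify_apply, mollify_apply]
  refine integral_congr_ae ?_
  filter_upwards [(quasiMeasurePreserving_sub_left volume x).ae_eq_comp h] with t ht
  simp only [Function.comp] at ht
  rw [ht]

lemma eLpNorm_mollify_le (φ : ContDiffBump (0 : EuclideanSpace ℝ (Fin n)))
    {f : EuclideanSpace ℝ (Fin n) → E} (hf : AEStronglyMeasurable f volume) {p : ℝ}
    (hp : 1 ≤ p) :
    eLpNorm (mollify φ f) (ENNReal.ofReal p) volume ≤ eLpNorm f (ENNReal.ofReal p) volume := by
  have hp0 : 0 < p := by linarith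
  rw [mollify_congr_ae φ hf.ae_eq_mk, eLpNorm_congr_ae hf.ae_eq_mk,
    eLpNorm_eq_lintegral_rpow_enorm_toReal (by simpa) (by simp),
    eLpNorm_eq_lintegral_rpow_enorm_toReal (by simpa) (by simp), ENNReal.toReal_ofReal hp0.le]
  exact ENNReal.rpow_le_rpow (lintegral_mollify_rpow_le φ hf.stronglyMeasurable_mk hp)
    (by positivity)

/-- Mollifications converge in `L^p` on sets of finite measure. -/
lemma tendsto_eLpNorm_mollify_sub [CompleteSpace E]
    {φ : ℕ → ContDiffBump (0 : EuclideanSpace ℝ (Fin n))}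
    (hφ : Filter.Tendsto (fun k => (φ k).rOut) Filter.atTop (nhds 0))
    {f : EuclideanSpace ℝ (Fin n) → E} {p : ℝ} (hp : 1 ≤ p)
    (hf : MemLp f (ENNReal.ofReal p) volume) {K : Set (EuclideanSpace ℝ (Fin n))}
    (hK : volume K ≠ ⊤) :
    Filter.Tendsto (fun k => eLpNorm (mollify (φ k) f - f) (ENNReal.ofReal p)
      (volume.restrict K)) Filter.atTop (nhds 0) := by
  set P := ENNReal.ofReal p with hP
  have hP1 : 1 ≤ P := by rw [hP]; exact ENNReal.one_le_ofReal.2 hp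
  rw [ENNReal.tendsto_nhds_zero]
  intro ε hε
  have hε3 : ε / 3 ≠ 0 := by simpa using hε.ne'
  obtain ⟨g, hgc, hfg, hgcont, hgL⟩ := hf.exists_hasCompactSupport_eLpNorm_sub_le
    ENNReal.ofReal_ne_top hε3
  set M := volume K ^ P.toReal⁻¹ with hM
  have hMt : M ≠ ⊤ := ENNReal.rpow_ne_top_of_nonneg (by positivity) hK
  -- a modulus small enough for the uniformly close part
  obtain ⟨θ, hθ0, hθ⟩ : ∃ θ : ℝ, 0 < θ ∧ M * ENNReal.ofReal θ ≤ ε / 3 := by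
    have h1 : Filter.Tendsto (fun θ : ℝ => M * ENNReal.ofReal θ) (nhdsWithin 0 (Ioi 0))
        (nhds (M * ENNReal.ofReal 0)) :=
      (ENNReal.Tendsto.const_mul (ENNReal.continuous_ofReal.tendsto 0)
        (Or.inr hMt)).mono_left nhdsWithin_le_nhds
    rw [ENNReal.ofReal_zero, mul_zero] at h1
    have h2 := (ENNReal.tendsto_nhds_zero.1 h1 (ε / 3) (pos_iff_ne_zero.2 hε3)).and
      self_mem_nhdsWithin
    obtain ⟨θ, h3, h4⟩ := h2.exists
    exact ⟨θ, h4, h3⟩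
  have huc := hgc.uniformContinuous_of_continuous hgcont
  obtain ⟨δ, hδ, hgδ⟩ := Metric.uniformContinuous_iff.1 huc θ hθ0
  filter_upwards [hφ.eventually (gt_mem_nhds hδ)] with k hk
  have hfl : LocallyIntegrable f volume := hf.locallyIntegrable hP1
  have hgl : LocallyIntegrable g volume := hgcont.locallyIntegrable
  have hfgl : LocallyIntegrable (f - g) volume := hfl.sub hgl
  have e : mollify (φ k) f - f = mollify (φ k) (f - g) + (mollify (φ k) g - g) + (g - f) := by
    have : f = (f - g) + g := by abel
    conv_lhs => rw [this, mollify_add _ hfgl hgl]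
    abel
  have hm1 : AEStronglyMeasurable (mollify (φ k) (f - g)) (volume.restrict K) :=
    (contDiff_mollify _ hfgl).continuous.aestronglyMeasurable
  have hm2 : AEStronglyMeasurable (mollify (φ k) g - g) (volume.restrict K) :=
    ((contDiff_mollify _ hgl).continuous.sub hgcont).aestronglyMeasurable
  have hm3 : AEStronglyMeasurable (g - f) (volume.restrict K) :=
    (hgcont.aestronglyMeasurable.sub hf.1).restrict
  have b1 : eLpNorm (mollify (φ k) (f - g)) P (volume.restrict K) ≤ ε / 3 :=
    (eLpNorm_mono_measure _ Measure.restrict_le_self).trans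
      ((eLpNorm_mollify_le _ (hf.1.sub hgcont.aestronglyMeasurable) hp).trans hfg)
  have b2 : eLpNorm (mollify (φ k) g - g) P (volume.restrict K) ≤ ε / 3 := by
    refine (eLpNorm_le_of_ae_bound (C := θ) (.of_forall fun x => ?_)).trans ?_
    · rw [Pi.sub_apply, ← dist_eq_norm]
      refine (φ k).dist_normed_convolution_le hgcont.aestronglyMeasurable fun y hy => ?_
      exact (hgδ ((Metric.mem_ball.1 hy).trans hk)).le
    · rw [Measure.restrict_apply_univ]; exact hθ
  have b3 : eLpNorm (g - f) P (volume.restrict K) ≤ ε / 3 := by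
    rw [← eLpNorm_neg, neg_sub]
    exact (eLpNorm_mono_measure _ Measure.restrict_le_self).trans hfg
  rw [e]
  calc _ ≤ eLpNorm (mollify (φ k) (f - g)) P (volume.restrict K) +
        eLpNorm (mollify (φ k) g - g) P (volume.restrict K) +
        eLpNorm (g - f) P (volume.restrict K) :=
      (eLpNorm_add_le (hm1.add hm2) hm3 hP1).trans
        (add_le_add_left (eLpNorm_add_le hm1 hm2 hP1) _)
    _ ≤ ε / 3 + ε / 3 + ε / 3 := by gcongr
    _ = ε := ENNReal.add_thirds ε

end Mollify

section WeakGradient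

variable {m n : ℕ} {Ω K : Set (EuclideanSpace ℝ (Fin n))}
  {u : EuclideanSpace ℝ (Fin n) → EuclideanSpace ℝ (Fin m)}
  {G : EuclideanSpace ℝ (Fin n) → Matrix (Fin m) (Fin n) ℝ}

/-- The Jacobian of a mollified Sobolev map is the mollified weak gradient, at points whose
`rOut`-neighbourhood lies in the set `K` outside of which the map is cut off. -/
lemma jacobian_mollify (hΩ : IsOpen Ω) (hu : HasWeakGradient Ω u G) (hK : IsCompact K) (hKΩ : K ⊆ Ω)
    (φ : ContDiffBump (0 : EuclideanSpace ℝ (Fin n))) {x : EuclideanSpace ℝ (Fin n)}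
    (hx : Metric.closedBall x φ.rOut ⊆ K) :
    jacobian (mollify φ (K.indicator u)) x = mollify φ (K.indicator G) x := by
  have hKm : MeasurableSet K := hK.measurableSet
  have hui : Integrable (K.indicator u) volume := by
    rw [integrable_indicator_iff hKm]
    exact hu.locallyIntegrable.integrableOn_compact_subset hKΩ hK
  have hGi : Integrable (K.indicator G) volume := by
    rw [integrable_indicator_iff hKm]
    exact hu.locallyIntegrable_grad.integrableOn_compact_subset hKΩ hK
  set ρ := φ.normed (volume : Measure (EuclideanSpace ℝ (Fin n))) with hρ
  have hρs : ContDiff ℝ ∞ ρ := φ.contDiff_normed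
  ext i j
  -- the test function
  set ζ : EuclideanSpace ℝ (Fin n) → ℝ := fun y => ρ (x - y) with hζ
  have hζs : ContDiff ℝ ∞ ζ := hρs.comp (contDiff_const.sub contDiff_id)
  have hζsupp : tsupport ζ ⊆ K := by
    refine (closure_minimal (fun y hy => ?_) Metric.isClosed_closedBall).trans hx
    have h1 : x - y ∈ Function.support ρ := hy
    rw [hρ, φ.support_normed_eq, mem_ball_zero_iff] at h1
    rw [Metric.mem_closedBall, dist_comm, dist_eq_norm]
    exact h1.le
  have hζc : HasCompactSupport ζ := hK.of_isClosed_subset (isClosed_tsupport _) hζsupp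
  have hζd : ∀ y, fderiv ℝ ζ y (EuclideanSpace.single j 1) =
      - fderiv ℝ ρ (x - y) (EuclideanSpace.single j 1) := by
    intro y
    have h1 := (hρs.differentiable (by simp) (x - y)).hasFDerivAt.comp y
      ((hasFDerivAt_id y).const_sub x)
    have h2 : fderiv ℝ ζ y = _ := h1.fderiv
    rw [h2]; simp
  have hw := hu.integral_eq ζ hζs hζc (hζsupp.trans hKΩ) i j
  have hζ0 : ∀ y ∉ K, ζ y = 0 := fun y hy => image_eq_zero_of_notMem_tsupport fun h => hy (hζsupp h)
  have hζd0 : ∀ y ∉ K, fderiv ℝ ζ y = 0 := fun y hy => by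
    by_contra h
    exact hy (hζsupp (support_fderiv_subset ℝ h))
  have hrestr : ∀ f f' : EuclideanSpace ℝ (Fin n) → ℝ, (∀ y ∈ K, f y = f' y) →
      (∀ y ∉ K, f y = 0) → (∀ y ∉ K, f' y = 0) → ∫ y in Ω, f y = ∫ y, f' y := by
    intro f f' h1 h2 h3
    rw [setIntegral_eq_of_subset_of_forall_sdiff_eq_zero hΩ.measurableSet hKΩ
      fun y hy => h2 y hy.2, setIntegral_congr_fun hKm h1,
      setIntegral_eq_integral_of_forall_compl_eq_zero h3]
  rw [hrestr _ (fun y => K.indicator u y i * fderiv ℝ ζ y (EuclideanSpace.single j 1))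
      (fun y hy => by rw [indicator_of_mem hy]) (fun y hy => by rw [hζd0 y hy]; simp)
      (fun y hy => by rw [hζd0 y hy]; simp),
    hrestr _ (fun y => K.indicator G y i j * ζ y)
      (fun y hy => by rw [indicator_of_mem hy]) (fun y hy => by rw [hζ0 y hy, mul_zero])
      (fun y hy => by rw [hζ0 y hy, mul_zero])] at hw
  have hcx := φ.hasCompactSupport_normed (μ := (volume : Measure (EuclideanSpace ℝ (Fin n))))
  -- the left-hand side
  have hl : jacobian (mollify φ (K.indicator u)) x i j =
      -∫ y, K.indicator u y i * fderiv ℝ ζ y (EuclideanSpace.single j 1) := by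
    have h1 := hcx.hasFDerivAt_convolution_right
      (ContinuousLinearMap.lsmul ℝ ℝ :
        ℝ →L[ℝ] EuclideanSpace ℝ (Fin m) →L[ℝ] EuclideanSpace ℝ (Fin m)).flip
      hui.locallyIntegrable (hρs.of_le (by simp)) x
    rw [convolution_flip] at h1
    change HasFDerivAt (mollify φ (K.indicator u)) _ x at h1
    have h2 : fderiv ℝ (mollify φ (K.indicator u)) x (EuclideanSpace.single j 1) =
        ∫ y, fderiv ℝ ρ (x - y) (EuclideanSpace.single j 1) • K.indicator u y := by
      rw [h1.fderiv, convolution_precompR_apply _ hui.locallyIntegrable (hcx.fderiv ℝ)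
        (hρs.continuous_fderiv (by simp))]
      rfl
    have h3 : Integrable (fun y => fderiv ℝ ρ (x - y) (EuclideanSpace.single j 1) •
        K.indicator u y) := by
      obtain ⟨M, hM⟩ := (hcx.fderiv ℝ).exists_bound_of_continuous
        (hρs.continuous_fderiv (by simp))
      refine Integrable.bdd_smul
        (φ := fun y => fderiv ℝ ρ (x - y) (EuclideanSpace.single j 1)) hui M ?_
        (.of_forall fun y => ?_)
      · have h1 : Continuous (fderiv ℝ ρ) := hρs.continuous_fderiv (by simp)
        exact (by fun_prop : Continuous fun y =>
          fderiv ℝ ρ (x - y) (EuclideanSpace.single j 1)).aestronglyMeasurable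
      · refine ((fderiv ℝ ρ (x - y)).le_opNorm _).trans ?_
        simpa using hM (x - y)
    have h4 : jacobian (mollify φ (K.indicator u)) x i j =
        (EuclideanSpace.proj i : EuclideanSpace ℝ (Fin m) →L[ℝ] ℝ)
          (fderiv ℝ (mollify φ (K.indicator u)) x (EuclideanSpace.single j 1)) := rfl
    rw [h4, h2, ← ContinuousLinearMap.integral_comp_comm _ h3, ← integral_neg]
    refine integral_congr_ae (.of_forall fun y => ?_)
    simp only [hζd]
    simp [mul_comm]
  have hr : mollify φ (K.indicator G) x i j = ∫ y, K.indicator G y i j * ζ y := by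
    have h1 : mollify φ (K.indicator G) x = ∫ y, ρ (x - y) • K.indicator G y := by
      rw [mollify, convolution_lsmul_swap]
    have h3 : Integrable (fun y => ρ (x - y) • K.indicator G y) := by
      obtain ⟨M, hM⟩ := hcx.exists_bound_of_continuous hρs.continuous
      exact Integrable.bdd_smul (φ := fun y => ρ (x - y)) hGi M
        (hρs.continuous.comp (by fun_prop)).aestronglyMeasurable
        (.of_forall fun y => hM (x - y))
    rw [h1]
    change matrixEntry i j (∫ y, ρ (x - y) • K.indicator G y) = _
    rw [← ContinuousLinearMap.integral_comp_comm _ h3]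
    refine integral_congr_ae (.of_forall fun y => ?_)
    simp [hζ, mul_comm]
  rw [hl, hr, hw, neg_neg]

/-- Meyers–Serrin approximation on a compact set. -/
lemma exists_smooth_approx (hΩ : IsOpen Ω) (hu : HasWeakGradient Ω u G) {p : ℝ} (hp : 1 ≤ p)
    (hG : MemLpLoc G p Ω) (hK : IsCompact K) (hKΩ : K ⊆ Ω) :
    ∃ v : ℕ → EuclideanSpace ℝ (Fin n) → EuclideanSpace ℝ (Fin m), (∀ k, ContDiff ℝ ∞ (v k)) ∧
      Filter.Tendsto (fun k => eLpNorm (jacobian (v k) - G) (ENNReal.ofReal p)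
        (volume.restrict K)) Filter.atTop (nhds 0) := by
  obtain ⟨ε, hε, hεΩ⟩ := hK.exists_cthickening_subset_open hΩ hKΩ
  set K' := Metric.cthickening ε K with hK'
  have hK'c : IsCompact K' := hK.cthickening
  have hK'm : MeasurableSet K' := hK'c.measurableSet
  have hui : Integrable (K'.indicator u) volume := by
    rw [integrable_indicator_iff hK'm]
    exact hu.locallyIntegrable.integrableOn_compact_subset hεΩ hK'c
  have hGL : MemLp (K'.indicator G) (ENNReal.ofReal p) volume := by
    rw [memLp_indicator_iff_restrict hK'm]
    exact hG K' hK'c hεΩ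
  set φ : ℕ → ContDiffBump (0 : EuclideanSpace ℝ (Fin n)) := fun k =>
    ⟨ε / (k + 1) / 2, ε / (k + 1), by positivity, half_lt_self (by positivity)⟩ with hφ
  have hφ0 : Filter.Tendsto (fun k => (φ k).rOut) Filter.atTop (nhds 0) := by
    have h1 := (tendsto_one_div_add_atTop_nhds_zero_nat (𝕜 := ℝ)).const_mul ε
    simpa [hφ, div_eq_mul_inv] using h1
  refine ⟨fun k => mollify (φ k) (K'.indicator u),
    fun k => contDiff_mollify _ hui.locallyIntegrable, ?_⟩
  refine (tendsto_eLpNorm_mollify_sub hφ0 hp hGL hK.measure_lt_top.ne).congr fun k => ?_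
  refine eLpNorm_congr_ae ((ae_restrict_iff' hK.measurableSet).2 (.of_forall fun x hx => ?_))
  have hball : Metric.closedBall x (φ k).rOut ⊆ K' := by
    refine (Metric.closedBall_subset_cthickening hx _).trans (Metric.cthickening_mono ?_ _)
    simp only [hφ]
    exact div_le_self hε.le (by linarith [(Nat.cast_nonneg k : (0 : ℝ) ≤ k)])
  rw [Pi.sub_apply, Pi.sub_apply, jacobian_mollify hΩ hu hK'c hεΩ _ hball,
    indicator_of_mem (Metric.self_subset_cthickening _ hx)]

end WeakGradient

/-! ### The reverse Hölder inequality -/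

section ReverseHolder

variable {m n : ℕ} {p q L : ℝ} {F : Matrix (Fin m) (Fin n) ℝ → ℝ}

/-- Continuity in `L^p` of `G ↦ F(G)` as a map into `L^1`. -/
lemma GrowthBound.lintegral_sub_le (hL : GrowthBound p L F) (hp : 1 < p)
    {α : Type*} [MeasurableSpace α] {μ : Measure α} {a b : α → Matrix (Fin m) (Fin n) ℝ}
    (ha : AEStronglyMeasurable a μ) (hb : AEStronglyMeasurable b μ) :
    ∫⁻ x, ‖F (a x) - F (b x)‖ₑ ∂μ ≤ ENNReal.ofReal L *
      ((eLpNorm (a - b) (ENNReal.ofReal p) μ + 2 * eLpNorm b (ENNReal.ofReal p) μ) ^ (p - 1) *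
        eLpNorm (a - b) (ENNReal.ofReal p) μ) := by
  have hp0 : 0 < p := by linarith
  have hp1 : 0 < p - 1 := by linarith
  rw [eLpNorm_eq_lintegral_rpow_enorm_toReal (by simpa) (by simp),
    eLpNorm_eq_lintegral_rpow_enorm_toReal (by simpa) (by simp), ENNReal.toReal_ofReal hp0.le]
  have hd : AEMeasurable (fun x => ‖(a - b) x‖ₑ) μ := (ha.sub hb).enorm
  have hb' : AEMeasurable (fun x => 2 * ‖b x‖ₑ) μ := hb.enorm.const_mul 2
  have hpt : ∀ x, ‖F (a x) - F (b x)‖ₑ ≤ ENNReal.ofReal L *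
      ((‖(a - b) x‖ₑ + 2 * ‖b x‖ₑ) ^ (p - 1) * ‖(a - b) x‖ₑ) := by
    intro x
    have h1 := hL.lip (a x) (b x)
    have h2 : ‖a x‖ + ‖b x‖ ≤ ‖a x - b x‖ + 2 * ‖b x‖ := by
      have := norm_le_norm_sub_add (a x) (b x)
      linarith
    have h3 := hL.nonneg
    have h4 : |F (a x) - F (b x)| ≤
        L * ((‖a x - b x‖ + 2 * ‖b x‖) ^ (p - 1) * ‖a x - b x‖) := by
      refine h1.trans ?_
      rw [mul_assoc]
      gcongr
    rw [Pi.sub_apply, ← ofReal_norm, ← ofReal_norm, ← ofReal_norm, ← ENNReal.ofReal_ofNat 2,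
      ← ENNReal.ofReal_mul (by norm_num), ← ENNReal.ofReal_add (norm_nonneg _) (by positivity),
      ENNReal.ofReal_rpow_of_nonneg (by positivity) hp1.le, ← ENNReal.ofReal_mul (by positivity),
      ← ENNReal.ofReal_mul h3]
    exact ENNReal.ofReal_le_ofReal h4
  refine (lintegral_mono hpt).trans ?_
  rw [lintegral_const_mul' _ _ ENNReal.ofReal_ne_top]
  gcongr
  have hconj : (p / (p - 1)).HolderConjugate p := by
    rw [Real.holderConjugate_iff]
    exact ⟨by rw [one_lt_div hp1]; linarith, by field_simp; ring⟩
  have hH := ENNReal.lintegral_mul_le_Lp_mul_Lq μ hconj ((hd.add hb').pow_const (p - 1)) hd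
  have e1 : ∀ x, ((‖(a - b) x‖ₑ + 2 * ‖b x‖ₑ) ^ (p - 1)) ^ (p / (p - 1)) =
      (‖(a - b) x‖ₑ + 2 * ‖b x‖ₑ) ^ p := fun x => by
    rw [← ENNReal.rpow_mul]; congr 1; field_simp
  have hM := ENNReal.lintegral_Lp_add_le hd hb' hp.le
  have e2 : (∫⁻ x, (2 * ‖b x‖ₑ) ^ p ∂μ) ^ (1 / p) = 2 * (∫⁻ x, ‖b x‖ₑ ^ p ∂μ) ^ (1 / p) := by
    simp_rw [ENNReal.mul_rpow_of_nonneg _ _ hp0.le]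
    rw [lintegral_const_mul' _ _ (by finiteness), ENNReal.mul_rpow_of_nonneg _ _ (by positivity),
      ← ENNReal.rpow_mul, mul_one_div_cancel hp0.ne', ENNReal.rpow_one]
  rw [e2] at hM
  simp only [Pi.mul_apply, Pi.add_apply, e1, one_div_div] at hH hM
  refine hH.trans ?_
  gcongr
  calc _ = ((∫⁻ x, (‖(a - b) x‖ₑ + 2 * ‖b x‖ₑ) ^ p ∂μ) ^ (1 / p)) ^ (p - 1) := by
        rw [← ENNReal.rpow_mul]; congr 1; field_simp
    _ ≤ _ := by gcongr

lemma cutoff_eq_one {x₀ x : EuclideanSpace ℝ (Fin n)} {r : ℝ} (hr : 0 < r)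
    (hx : x ∈ Metric.closedBall x₀ r) : cutoff n (r⁻¹ • (x - x₀)) = 1 := by
  apply (cutoff n).one_of_mem_closedBall
  rw [mem_closedBall_zero_iff, norm_smul, Real.norm_of_nonneg (by positivity),
    inv_mul_le_iff₀ hr]
  simpa [cutoff, ← dist_eq_norm] using hx

lemma cutoff_eq_zero {x₀ x : EuclideanSpace ℝ (Fin n)} {r : ℝ} (hr : 0 < r)
    (hx : x ∉ Metric.closedBall x₀ (2 * r)) : cutoff n (r⁻¹ • (x - x₀)) = 0 := by
  apply (cutoff n).zero_of_le_dist
  rw [dist_zero_right, norm_smul, Real.norm_of_nonneg (by positivity), inv_mul_eq_div,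
    le_div_iff₀ hr, ← dist_eq_norm]
  rw [Metric.mem_closedBall, not_le] at hx
  exact hx.le

/-- The reverse Hölder inequality: the average of `F(Du)` on a ball is controlled by the average of
`‖Du‖^q`, `q < p`, on the ball of twice the radius. -/
lemma exists_reverse_holder (hp : 1 < p) (hF : IsQuasiconcave F)
    (hhom : IsHomogeneousOfDegree p F) (hL : GrowthBound p L F)
    (hq : 1 ≤ q) (hqp : q < p) (hpq : p < q + 1) (hn : n * (q / (q - p + 1) / q - 1) < 1) :
    ∃ C : ℝ≥0, ∀ (Ω : Set (EuclideanSpace ℝ (Fin n))), IsOpen Ω →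
      ∀ (u : EuclideanSpace ℝ (Fin n) → EuclideanSpace ℝ (Fin m))
        (G : EuclideanSpace ℝ (Fin n) → Matrix (Fin m) (Fin n) ℝ), HasWeakGradient Ω u G →
      MemLpLoc G p Ω → (∀ᵐ x ∂volume.restrict Ω, 0 ≤ F (G x)) →
      ∀ (x₀ : EuclideanSpace ℝ (Fin n)) (r : ℝ), 0 < r → Metric.closedBall x₀ (2 * r) ⊆ Ω →
      ∫⁻ x in Metric.closedBall x₀ r, ENNReal.ofReal (F (G x)) ≤
        C * ENNReal.ofReal (r ^ n) * (ENNReal.ofReal (r⁻¹ ^ n) *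
          ∫⁻ x in Metric.closedBall x₀ (2 * r), ‖G x‖ₑ ^ q) ^ (p / q) := by
  obtain ⟨C, hC⟩ := exists_caccioppoli hp hF hhom hL hq hqp hpq hn
  refine ⟨C, fun Ω hΩ u G hu hG hpos x₀ r hr hball => ?_⟩
  have hp0 : 0 < p := by linarith
  have hq0 : 0 < q := by linarith
  have hFc := hL.continuous hp
  set B := Metric.closedBall x₀ (2 * r) with hB
  have hBc : IsCompact B := isCompact_closedBall _ _
  have hBm : MeasurableSet B := hBc.measurableSet
  have hBf : IsFiniteMeasure ((volume : Measure (EuclideanSpace ℝ (Fin n))).restrict B) :=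
    ⟨by rw [Measure.restrict_apply_univ]; exact hBc.measure_lt_top⟩
  obtain ⟨v, hvs, hv⟩ := exists_smooth_approx hΩ hu hp.le hG hBc hball
  set P := ENNReal.ofReal p with hP
  have hGL : MemLp G P (volume.restrict B) := hG B hBc hball
  set N : ℕ → ℝ≥0∞ := fun k => eLpNorm (jacobian (v k) - G) P (volume.restrict B) with hN
  set κ : ℝ≥0∞ := volume B ^ (1 / q - 1 / p) with hκ
  have hκt : κ ≠ ⊤ := by
    refine ENNReal.rpow_ne_top_of_nonneg ?_ hBc.measure_lt_top.ne
    rw [sub_nonneg]; exact one_div_le_one_div_of_le hq0 hqp.le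
  set Q := ENNReal.ofReal q with hQ
  have hQ1 : 1 ≤ Q := by rw [hQ]; exact ENNReal.one_le_ofReal.2 hq
  have hJm : ∀ k, AEStronglyMeasurable (jacobian (v k)) (volume.restrict B) := fun k =>
    (continuous_jacobian (hvs k)).aestronglyMeasurable
  have hQrep : ∀ f : EuclideanSpace ℝ (Fin n) → Matrix (Fin m) (Fin n) ℝ,
      ∫⁻ x in B, ‖f x‖ₑ ^ q = eLpNorm f Q (volume.restrict B) ^ q := by
    intro f
    rw [eLpNorm_eq_lintegral_rpow_enorm_toReal (by simpa [hQ]) (by simp [hQ]),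
      ENNReal.toReal_ofReal hq0.le, ← ENNReal.rpow_mul, one_div_mul_cancel hq0.ne',
      ENNReal.rpow_one]
  have hQP : ∀ k, eLpNorm (jacobian (v k)) Q (volume.restrict B) ≤
      eLpNorm G Q (volume.restrict B) + κ * N k := by
    intro k
    have h1 := eLpNorm_add_le (hGL.1) ((hJm k).sub hGL.1) hQ1
    rw [add_sub_cancel] at h1
    refine h1.trans (add_le_add_right ?_ _)
    have h2 := eLpNorm_le_eLpNorm_mul_rpow_measure_univ (p := Q) (q := P)
      (ENNReal.ofReal_le_ofReal hqp.le) ((hJm k).sub hGL.1)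
    rw [Measure.restrict_apply_univ, ENNReal.toReal_ofReal hq0.le,
      ENNReal.toReal_ofReal hp0.le, mul_comm] at h2
    exact h2
  -- the cutoff function of the ball
  set η : EuclideanSpace ℝ (Fin n) → ℝ := fun x => cutoff n (r⁻¹ • (x - x₀)) with hη
  have hηc : Continuous η := (cutoff n).continuous.comp (by fun_prop)
  have hηm : Measurable fun x => η x ^ p :=
    (hηc.rpow_const fun _ => Or.inr hp0.le).measurable
  have hη01 : ∀ x, 0 ≤ η x ^ p ∧ η x ^ p ≤ 1 := fun x =>
    ⟨Real.rpow_nonneg (cutoff n).nonneg _,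
      Real.rpow_le_one (cutoff n).nonneg (cutoff n).le_one hp0.le⟩
  have hbdd : ∀ f : EuclideanSpace ℝ (Fin n) → ℝ, IntegrableOn f B →
      IntegrableOn (fun x => η x ^ p * f x) B := fun f hf =>
    hf.bdd_mul (c := 1) hηm.aestronglyMeasurable (.of_forall fun x => by
      rw [Real.norm_of_nonneg (hη01 x).1]; exact (hη01 x).2)
  have hFG : IntegrableOn (fun x => F (G x)) B := by
    have h1 : Integrable (fun x => ‖G x‖ ^ p) (volume.restrict B) := by
      have := hGL.integrable_norm_rpow (by simpa [hP]) (by simp [hP])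
      rwa [ENNReal.toReal_ofReal hp0.le] at this
    refine (h1.const_mul L).mono' (hFc.comp_aestronglyMeasurable hGL.1) (.of_forall fun x => ?_)
    exact hL.abs_le hp (G x)
  have hFv : ∀ k, IntegrableOn (fun x => F (jacobian (v k) x)) B := fun k =>
    (hFc.comp (continuous_jacobian (hvs k))).continuousOn.integrableOn_compact hBc
  have hposB : ∀ᵐ x ∂volume.restrict B, 0 ≤ F (G x) :=
    ae_mono (Measure.restrict_mono hball le_rfl) hpos
  have hlow : ∫⁻ x in Metric.closedBall x₀ r, ENNReal.ofReal (F (G x)) ≤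
      ENNReal.ofReal (∫ x in B, η x ^ p * F (G x)) := by
    rw [ofReal_integral_eq_lintegral_ofReal (hbdd _ hFG)
      (hposB.mono fun x hx => mul_nonneg (hη01 x).1 hx)]
    calc _ = ∫⁻ x in Metric.closedBall x₀ r, ENNReal.ofReal (η x ^ p * F (G x)) := by
          refine setLIntegral_congr_fun Metric.isClosed_closedBall.measurableSet fun x hx => ?_
          simp only [hη]
          rw [cutoff_eq_one hr hx, Real.one_rpow, one_mul]
      _ ≤ _ := lintegral_mono_set (Metric.closedBall_subset_closedBall (by linarith))
  have herr := fun k => hL.lintegral_sub_le hp (hJm k) hGL.1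
  have hstep : ∀ k, ∫⁻ x in Metric.closedBall x₀ r, ENNReal.ofReal (F (G x)) ≤
      C * ENNReal.ofReal (r ^ n) * (ENNReal.ofReal (r⁻¹ ^ n) *
          (eLpNorm G Q (volume.restrict B) + κ * N k) ^ q) ^ (p / q) +
      ENNReal.ofReal L *
        ((N k + 2 * eLpNorm G P (volume.restrict B)) ^ (p - 1) * N k) := by
    intro k
    refine hlow.trans ?_
    have h1 : ∫ x in B, η x ^ p * F (G x) ≤ (∫ x, η x ^ p * F (jacobian (v k) x)) +
        ‖∫ x in B, η x ^ p * (F (jacobian (v k) x) - F (G x))‖ := by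
      rw [← setIntegral_eq_integral_of_forall_compl_eq_zero (s := B)
        (f := fun x => η x ^ p * F (jacobian (v k) x)) fun x hx => by
          simp only [hη]
          rw [cutoff_eq_zero hr hx, Real.zero_rpow hp0.ne', zero_mul]]
      simp_rw [mul_sub]
      rw [integral_sub (hbdd _ (hFv k)) (hbdd _ hFG)]
      have := neg_le_abs ((∫ x in B, η x ^ p * F (jacobian (v k) x)) -
        ∫ x in B, η x ^ p * F (G x))
      rw [Real.norm_eq_abs]
      linarith
    refine (ENNReal.ofReal_le_ofReal h1).trans (ENNReal.ofReal_add_le.trans (add_le_add ?_ ?_))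
    · refine (hC x₀ r hr (v k) (hvs k)).trans ?_
      rw [hQrep]
      gcongr
      exact hQP k
    · rw [ofReal_norm]
      refine (enorm_integral_le_lintegral_enorm _).trans (le_trans (lintegral_mono fun x => ?_)
        (herr k))
      rw [enorm_mul]
      refine mul_le_of_le_one_left zero_le ?_
      rw [Real.enorm_eq_ofReal (hη01 x).1]
      exact ENNReal.ofReal_le_one.2 (hη01 x).2
  have hconst : C * ENNReal.ofReal (r ^ n) ≠ ⊤ :=
    ENNReal.mul_ne_top ENNReal.coe_ne_top ENNReal.ofReal_ne_top
  have t1 : Filter.Tendsto (fun k => eLpNorm G Q (volume.restrict B) + κ * N k) Filter.atTop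
      (nhds (eLpNorm G Q (volume.restrict B))) := by
    have := (ENNReal.Tendsto.const_mul hv (Or.inr hκt)).const_add
      (eLpNorm G Q (volume.restrict B))
    simpa using this
  have t2 : Filter.Tendsto (fun k => C * ENNReal.ofReal (r ^ n) * (ENNReal.ofReal (r⁻¹ ^ n) *
          (eLpNorm G Q (volume.restrict B) + κ * N k) ^ q) ^ (p / q)) Filter.atTop
      (nhds (C * ENNReal.ofReal (r ^ n) * (ENNReal.ofReal (r⁻¹ ^ n) *
          ∫⁻ x in B, ‖G x‖ₑ ^ q) ^ (p / q))) := by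
    rw [hQrep]
    exact ENNReal.Tendsto.const_mul ((ENNReal.Tendsto.const_mul (t1.ennrpow_const q)
      (Or.inr ENNReal.ofReal_ne_top)).ennrpow_const (p / q)) (Or.inr hconst)
  have t3 : Filter.Tendsto (fun k => ENNReal.ofReal L *
        ((N k + 2 * eLpNorm G P (volume.restrict B)) ^ (p - 1) * N k)) Filter.atTop
      (nhds 0) := by
    have h1 := (hv.add_const (2 * eLpNorm G P (volume.restrict B))).ennrpow_const (p - 1)
    have h2 := ENNReal.Tendsto.mul h1 (Or.inr ENNReal.zero_ne_top) hv (Or.inr (by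
      rw [zero_add]
      exact ENNReal.rpow_ne_top_of_nonneg (by linarith)
        (ENNReal.mul_ne_top (by simp) hGL.2.ne)))
    have h3 := ENNReal.Tendsto.const_mul (a := ENNReal.ofReal L) h2
      (Or.inr ENNReal.ofReal_ne_top)
    simpa using h3
  have t4 := t2.add t3
  rw [add_zero] at t4
  exact ge_of_tendsto' t4 hstep

end ReverseHolder

/-! ### The level set inequality -/

section LevelSet

variable {n : ℕ}

lemma volume_closedBall_mul (x : EuclideanSpace ℝ (Fin n)) {c : ℝ} (hc : 0 < c) (r : ℝ) :
    volume (Metric.closedBall x (c * r)) =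
      ENNReal.ofReal (c ^ n) * volume (Metric.closedBall x r) := by
  rw [Measure.addHaar_closedBall_mul_of_pos _ _ hc, finrank_euclideanSpace_fin,
    Measure.addHaar_closedBall_center volume x r]

lemma le_two_mul_of_le_add_half {x T : ℝ≥0∞} (hx : x ≠ ⊤) (h : x ≤ T + x / 2) : x ≤ 2 * T := by
  have h1 : x / 2 + x / 2 ≤ T + x / 2 := by rwa [ENNReal.add_halves]
  have h2 : x / 2 ≤ T := (ENNReal.add_le_add_iff_right (ENNReal.div_ne_top hx (by simp))).1 h1
  calc x = x / 2 + x / 2 := (ENNReal.add_halves x).symm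
    _ ≤ T + T := add_le_add h2 h2
    _ = 2 * T := (two_mul T).symm

/-- At almost every point of `{h > l}` there is a ball on which the average of `h^q` exceeds `l^q`,
while it does not on the ball ten times as large. -/
lemma ae_exists_stopping_radius {q : ℝ} (hq : 1 ≤ q) {h d : EuclideanSpace ℝ (Fin n) → ℝ}
    (hm : Measurable h) (hd : ∀ x, 0 < h x → 0 < d x)
    (hint : ∫⁻ x, ENNReal.ofReal (h x) ^ q ≠ ⊤) {l : ℝ} (hl : 0 < l)
    (hlarge : ∀ x, 0 < d x → ∫⁻ y in Metric.closedBall x (d x / 2), ENNReal.ofReal (h y) ^ q ≤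
      ENNReal.ofReal l ^ q * volume (Metric.closedBall x (d x / 2))) :
    ∀ᵐ x, l < h x → ∃ r, 0 < r ∧ 20 * r ≤ d x ∧
      ENNReal.ofReal l ^ q * volume (Metric.closedBall x r) ≤
        ∫⁻ y in Metric.closedBall x r, ENNReal.ofReal (h y) ^ q ∧
      ∫⁻ y in Metric.closedBall x (10 * r), ENNReal.ofReal (h y) ^ q ≤
        ENNReal.ofReal l ^ q * volume (Metric.closedBall x (10 * r)) := by
  have hq0 : 0 < q := by linarith
  have ham : Measurable fun x => ENNReal.ofReal (h x) ^ q := hm.ennreal_ofReal.pow_const q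
  filter_upwards [(Besicovitch.vitaliFamily (volume :
    Measure (EuclideanSpace ℝ (Fin n)))).ae_tendsto_lintegral_div ham.aemeasurable hint] with x hx
  intro hlx
  have hdx := hd x (hl.trans hlx)
  have hx' := hx.comp (Besicovitch.tendsto_filterAt volume x)
  set r : ℕ → ℝ := fun k => d x / 2 * (1 / 10) ^ k with hr
  have hr0 : ∀ k, 0 < r k := fun k => by positivity
  have hrlim : Filter.Tendsto r Filter.atTop (nhdsWithin 0 (Ioi 0)) := by
    refine tendsto_nhdsWithin_iff.2 ⟨?_, .of_forall fun k => hr0 k⟩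
    have := (tendsto_pow_atTop_nhds_zero_of_lt_one (r := (1 / 10 : ℝ)) (by norm_num)
      (by norm_num)).const_mul (d x / 2)
    simpa only [mul_zero] using this
  have hlt : ENNReal.ofReal l ^ q < ENNReal.ofReal (h x) ^ q :=
    ENNReal.rpow_lt_rpow ((ENNReal.ofReal_lt_ofReal_iff (hl.trans hlx)).2 hlx) hq0
  have hex : ∃ k, ENNReal.ofReal l ^ q * volume (Metric.closedBall x (r k)) <
      ∫⁻ y in Metric.closedBall x (r k), ENNReal.ofReal (h y) ^ q := by
    obtain ⟨k, hk⟩ := ((hx'.comp hrlim).eventually (lt_mem_nhds hlt)).exists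
    refine ⟨k, ?_⟩
    simp only [Function.comp] at hk
    exact (ENNReal.lt_div_iff_mul_lt
      (Or.inl (Metric.measure_closedBall_pos volume x (hr0 k)).ne')
      (Or.inl measure_closedBall_lt_top.ne)).1 hk
  classical
  obtain ⟨k, hk⟩ : ∃ k, k = Nat.find hex := ⟨_, rfl⟩
  have hk1 := Nat.find_spec hex
  rw [← hk] at hk1
  obtain _ | k := k
  · exfalso
    refine absurd hk1 (not_lt.2 ?_)
    simpa [hr] using hlarge x hdx
  · have hk2 := Nat.find_min hex (m := k) (by omega)
    have e10 : r k = 10 * r (k + 1) := by simp only [hr, pow_succ]; ring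
    refine ⟨r (k + 1), hr0 _, ?_, hk1.le, ?_⟩
    · have : r k ≤ d x / 2 := by
        simp only [hr]
        exact mul_le_of_le_one_right (by positivity) (pow_le_one₀ (by norm_num) (by norm_num))
      linarith
    · rw [← e10]; exact not_lt.1 hk2

/-- The level set inequality. If the averages of `f` on small balls are controlled by those of
`h^q` on twice the ball, then the integral of `f` over `{h > l}` is controlled by `l^(p-q)` times
that of `h^q` over `{h > l/2}`: a Calderón–Zygmund stopping time and Vitali's covering lemma. -/
lemma setLIntegral_superlevel_le {p q : ℝ} (hq : 1 ≤ q)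
    {f : EuclideanSpace ℝ (Fin n) → ℝ≥0∞} {h d : EuclideanSpace ℝ (Fin n) → ℝ}
    (hm : Measurable h) (hd : ∀ x, 0 < h x → 0 < d x) {D : ℝ} (hD : ∀ x, d x ≤ D)
    (hint : ∫⁻ x, ENNReal.ofReal (h x) ^ q ≠ ⊤) {C : ℝ≥0∞}
    {l : ℝ} (hl : 0 < l)
    (hRH : ∀ x r, 0 < r → 4 * r ≤ d x →
      ∫⁻ y in Metric.closedBall x (2 * r), ENNReal.ofReal (h y) ^ q ≤
        ENNReal.ofReal l ^ q * volume (Metric.closedBall x (2 * r)) →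
      ∫⁻ y in Metric.closedBall x r, f y ≤
        C * ENNReal.ofReal l ^ p * volume (Metric.closedBall x r))
    (hlarge : ∀ x, 0 < d x → ∫⁻ y in Metric.closedBall x (d x / 2), ENNReal.ofReal (h y) ^ q ≤
      ENNReal.ofReal l ^ q * volume (Metric.closedBall x (d x / 2))) :
    ∫⁻ x in {x | l < h x}, f x ≤ C * ENNReal.ofReal (5 ^ n) * 2 * ENNReal.ofReal l ^ (p - q) *
      ∫⁻ x in {x | l / 2 < h x}, ENNReal.ofReal (h x) ^ q := by
  have hq0 : 0 < q := by linarith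
  have hl0 : ENNReal.ofReal l ≠ 0 := by simpa using hl
  have hlt : ENNReal.ofReal l ≠ ⊤ := ENNReal.ofReal_ne_top
  have hE'm : MeasurableSet {x | l / 2 < h x} := measurableSet_lt measurable_const hm
  have hst := ae_exists_stopping_radius hq hm hd hint hl hlarge
  set S : Set (EuclideanSpace ℝ (Fin n)) := {x | l < h x ∧ ∃ r, 0 < r ∧ 20 * r ≤ d x ∧
      ENNReal.ofReal l ^ q * volume (Metric.closedBall x r) ≤
        ∫⁻ y in Metric.closedBall x r, ENNReal.ofReal (h y) ^ q ∧
      ∫⁻ y in Metric.closedBall x (10 * r), ENNReal.ofReal (h y) ^ q ≤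
        ENNReal.ofReal l ^ q * volume (Metric.closedBall x (10 * r))} with hS
  have hSe : ∃ R : EuclideanSpace ℝ (Fin n) → ℝ, ∀ x ∈ S, 0 < R x ∧ 20 * R x ≤ d x ∧
      ENNReal.ofReal l ^ q * volume (Metric.closedBall x (R x)) ≤
        ∫⁻ y in Metric.closedBall x (R x), ENNReal.ofReal (h y) ^ q ∧
      ∫⁻ y in Metric.closedBall x (10 * R x), ENNReal.ofReal (h y) ^ q ≤
        ENNReal.ofReal l ^ q * volume (Metric.closedBall x (10 * R x)) := by
    choose! R hR using fun x (hx : x ∈ S) => hx.2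
    exact ⟨R, hR⟩
  obtain ⟨R, hR⟩ := hSe
  obtain ⟨u, huS, hdisj, hcov⟩ := Vitali.exists_disjoint_subfamily_covering_enlargement_closedBall
    S id R (D / 20) (fun a ha => by have := (hR a ha).2.1; have := hD a; linarith) 5 (by norm_num)
  simp only [id] at hdisj hcov
  have hucount : u.Countable := hdisj.countable_of_nonempty_interior fun a ha => by
    refine ⟨a, ?_⟩
    exact Metric.ball_subset_interior_closedBall (x := a) (ε := R a)
      (Metric.mem_ball_self (hR a (huS ha)).1)
  have : Countable u := hucount.to_subtype
  have hball : ∀ b ∈ u, ∫⁻ y in Metric.closedBall b (5 * R b), f y ≤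
      C * ENNReal.ofReal (5 ^ n) * 2 * ENNReal.ofReal l ^ (p - q) *
        ∫⁻ y in Metric.closedBall b (R b) ∩ {x | l / 2 < h x}, ENNReal.ofReal (h y) ^ q := by
    intro b hb
    obtain ⟨hR0, hRd, hR1, hR2⟩ := hR b (huS hb)
    have e10 : 2 * (5 * R b) = 10 * R b := by ring
    have h1 := hRH b (5 * R b) (by positivity) (by linarith) (by rw [e10]; exact hR2)
    rw [volume_closedBall_mul _ (by norm_num)] at h1
    set V := volume (Metric.closedBall b (R b)) with hV
    set T := ∫⁻ y in Metric.closedBall b (R b) ∩ {x | l / 2 < h x}, ENNReal.ofReal (h y) ^ q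
      with hT
    have hVt : V ≠ ⊤ := measure_closedBall_lt_top.ne
    have h2 : ENNReal.ofReal l ^ q * V ≤ 2 * T := by
      refine le_two_mul_of_le_add_half (ENNReal.mul_ne_top
        (ENNReal.rpow_ne_top_of_nonneg hq0.le hlt) hVt) (hR1.trans ?_)
      rw [← lintegral_inter_add_sdiff _ _ hE'm]
      gcongr
      calc _ ≤ ∫⁻ y in Metric.closedBall b (R b) \ {x | l / 2 < h x},
            ENNReal.ofReal (l / 2) ^ q := by
            refine setLIntegral_mono' (Metric.isClosed_closedBall.measurableSet.diff hE'm)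
              fun y hy => ?_
            gcongr
            exact not_lt.1 hy.2
        _ ≤ ENNReal.ofReal (l / 2) ^ q * V := by
            rw [setLIntegral_const]
            gcongr
            exact measure_mono sdiff_subset
        _ ≤ ENNReal.ofReal l ^ q / 2 * V := by
            gcongr
            rw [ENNReal.ofReal_div_of_pos (by norm_num), ENNReal.ofReal_ofNat,
              ENNReal.div_rpow_of_nonneg _ _ hq0.le]
            gcongr
            calc (2 : ℝ≥0∞) = 2 ^ (1 : ℝ) := (ENNReal.rpow_one 2).symm
              _ ≤ 2 ^ q := ENNReal.rpow_le_rpow_of_exponent_le (by norm_num) hq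
        _ = _ := by rw [ENNReal.div_eq_inv_mul, ENNReal.div_eq_inv_mul, mul_assoc]
    calc _ ≤ C * ENNReal.ofReal l ^ p * (ENNReal.ofReal (5 ^ n) * V) := h1
      _ = C * ENNReal.ofReal (5 ^ n) * ENNReal.ofReal l ^ (p - q) *
          (ENNReal.ofReal l ^ q * V) := by
        have : ENNReal.ofReal l ^ p = ENNReal.ofReal l ^ (p - q) * ENNReal.ofReal l ^ q := by
          rw [← ENNReal.rpow_add _ _ hl0 hlt, sub_add_cancel]
        rw [this]; ac_rfl
      _ ≤ C * ENNReal.ofReal (5 ^ n) * ENNReal.ofReal l ^ (p - q) * (2 * T) := by gcongr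
      _ = _ := by ac_rfl
  have hsub : ({x | l < h x} : Set _) ≤ᵐ[volume]
      ⋃ b : u, Metric.closedBall (b : EuclideanSpace ℝ (Fin n)) (5 * R b) := by
    filter_upwards [hst] with x hx hlx
    have hxS : x ∈ S := ⟨hlx, hx hlx⟩
    obtain ⟨b, hb, hbsub⟩ := hcov x hxS
    exact mem_iUnion.2 ⟨⟨b, hb⟩, hbsub (Metric.mem_closedBall_self (hR x hxS).1.le)⟩
  have hdisj' : Pairwise (Function.onFun Disjoint fun b : u =>
      Metric.closedBall (b : EuclideanSpace ℝ (Fin n)) (R b) ∩ {x | l / 2 < h x}) := by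
    intro a b hab
    exact (hdisj a.2 b.2 (fun h => hab (Subtype.ext h))).mono inter_subset_left inter_subset_left
  calc _ ≤ ∫⁻ x in ⋃ b : u, Metric.closedBall (b : EuclideanSpace ℝ (Fin n)) (5 * R b), f x :=
        lintegral_mono' (Measure.restrict_mono_ae hsub) le_rfl
    _ ≤ ∑' b : u, ∫⁻ x in Metric.closedBall (b : EuclideanSpace ℝ (Fin n)) (5 * R b), f x :=
        lintegral_iUnion_le _ _
    _ ≤ ∑' b : u, C * ENNReal.ofReal (5 ^ n) * 2 * ENNReal.ofReal l ^ (p - q) *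
        ∫⁻ y in Metric.closedBall (b : EuclideanSpace ℝ (Fin n)) (R b) ∩ {x | l / 2 < h x},
          ENNReal.ofReal (h y) ^ q := ENNReal.tsum_le_tsum fun b => hball b b.2
    _ = C * ENNReal.ofReal (5 ^ n) * 2 * ENNReal.ofReal l ^ (p - q) *
        ∫⁻ y in ⋃ b : u, Metric.closedBall (b : EuclideanSpace ℝ (Fin n)) (R b) ∩
          {x | l / 2 < h x}, ENNReal.ofReal (h y) ^ q := by
        rw [ENNReal.tsum_mul_left, lintegral_iUnion (fun b =>
          Metric.isClosed_closedBall.measurableSet.inter hE'm) hdisj']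
    _ ≤ _ := by
        gcongr
        exact iUnion_subset fun b => inter_subset_right

end LevelSet

/-! ### Integrating the level set inequality -/

section LayerCake

variable {α : Type*} [MeasurableSpace α] {μ : Measure α} {p q : ℝ} {f : α → ℝ≥0∞} {h : α → ℝ}

/-- The level set inequality multiplied by a weight and integrated over the levels. -/
lemma lintegral_weight_le [SigmaFinite μ] (hf : Measurable f) (hm : Measurable h)
    (hh : ∀ x, 0 ≤ h x) {C : ℝ≥0} {l₀ : ℝ} (hl₀ : 0 < l₀)
    (hLS : ∀ l, l₀ ≤ l → ∫⁻ x in {x | l < h x}, f x ∂μ ≤ C * ENNReal.ofReal l ^ (p - q) *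
      ∫⁻ x in {x | l / 2 < h x}, ENNReal.ofReal (h x) ^ q ∂μ)
    {w : ℝ → ℝ} (hw : ∀ t, 0 ≤ w t) (hw0 : ∀ t, t ≤ l₀ → w t = 0)
    (hw1 : ∀ t > 0, IntervalIntegrable w volume 0 t)
    (hw2 : ∀ t > 0, IntervalIntegrable (fun t => t ^ (p - q) * w t) volume 0 t) :
    ∫⁻ x, f x * ENNReal.ofReal (∫ t in (0 : ℝ)..h x, w t) ∂μ ≤
      C * ∫⁻ x, ENNReal.ofReal (h x) ^ q *
        ENNReal.ofReal (∫ t in (0 : ℝ)..2 * h x, t ^ (p - q) * w t) ∂μ := by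
  have hqm : Measurable fun x => ENNReal.ofReal (h x) ^ q := hm.ennreal_ofReal.pow_const q
  have hm2 : Measurable fun x => 2 * h x := hm.const_mul 2
  have L1 := lintegral_comp_eq_lintegral_meas_lt_mul (μ.withDensity f) (f := h)
    (.of_forall hh) hm.aemeasurable hw1 (.of_forall hw)
  have L2 := lintegral_comp_eq_lintegral_meas_lt_mul
    (μ.withDensity fun x => ENNReal.ofReal (h x) ^ q) (f := fun x => 2 * h x)
    (.of_forall fun x => mul_nonneg zero_le_two (hh x)) hm2.aemeasurable hw2
    ((ae_restrict_iff' measurableSet_Ioi).2 (.of_forall fun t ht =>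
      mul_nonneg (Real.rpow_nonneg (le_of_lt ht) _) (hw t)))
  have hmono : ∀ g : ℝ → ℝ, (∀ t > 0, IntervalIntegrable g volume 0 t) → (∀ t > 0, 0 ≤ g t) →
      Measurable fun s : ℝ => ENNReal.ofReal (∫ t in (0 : ℝ)..max s 0, g t) := by
    intro g hg hg0
    refine Monotone.measurable fun a b hab => ENNReal.ofReal_le_ofReal ?_
    have hmm : max a 0 ≤ max b 0 := max_le_max_right 0 hab
    rcases (le_max_right b 0).eq_or_lt with h0 | h0
    · have : max a 0 = max b 0 := le_antisymm hmm (by rw [← h0]; exact le_max_right _ _)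
      rw [this]
    · refine intervalIntegral.integral_mono_interval le_rfl (le_max_right _ _) hmm ?_ (hg _ h0)
      exact (ae_restrict_iff' measurableSet_Ioc).2 (.of_forall fun t ht => hg0 t ht.1)
  have m1 : Measurable fun x => ENNReal.ofReal (∫ t in (0 : ℝ)..h x, w t) := by
    simpa only [Function.comp_def, max_eq_left (hh _)] using
      (hmono w hw1 fun t _ => hw t).comp hm
  have m2 : Measurable fun x => ENNReal.ofReal (∫ t in (0 : ℝ)..2 * h x, t ^ (p - q) * w t) := by
    simpa only [Function.comp_def, max_eq_left (mul_nonneg zero_le_two (hh _))] using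
      (hmono _ hw2 fun t ht => mul_nonneg (Real.rpow_nonneg (le_of_lt ht) _) (hw t)).comp hm2
  rw [lintegral_withDensity_eq_lintegral_mul _ hf m1] at L1
  rw [lintegral_withDensity_eq_lintegral_mul _ hqm m2] at L2
  simp only [Pi.mul_apply] at L1 L2
  rw [L1, L2, ← lintegral_const_mul' _ _ ENNReal.coe_ne_top]
  refine setLIntegral_mono' measurableSet_Ioi fun t ht => ?_
  rcases le_or_gt t l₀ with htl | htl
  · simp [hw0 t htl]
  · have ht0 : 0 < t := hl₀.trans htl
    have h1 := hLS t htl.le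
    have e2 : {x | t < 2 * h x} = {x | t / 2 < h x} := by
      ext x; simp only [mem_ofPred_eq]; constructor <;> intro h <;> linarith
    rw [withDensity_apply _ (measurableSet_lt measurable_const hm),
      withDensity_apply _ (measurableSet_lt measurable_const hm2), e2,
      ENNReal.ofReal_mul (Real.rpow_nonneg ht0.le _), ← ENNReal.ofReal_rpow_of_pos ht0]
    calc _ ≤ (C * ENNReal.ofReal t ^ (p - q) *
          ∫⁻ x in {x | t / 2 < h x}, ENNReal.ofReal (h x) ^ q ∂μ) * ENNReal.ofReal (w t) := by
          gcongr
      _ = _ := by ac_rfl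

lemma intervalIntegrable_of_indicator {g : ℝ → ℝ} {a b : ℝ}
    {s : Set ℝ} (hs : MeasurableSet s) (hg : IntegrableOn g (s ∩ Ioc a b)) (hab : a ≤ b) :
    IntervalIntegrable (s.indicator g) volume a b := by
  rw [intervalIntegrable_iff_integrableOn_Ioc_of_le hab, IntegrableOn,
    integrable_indicator_iff hs, IntegrableOn, Measure.restrict_restrict hs]
  exact hg

lemma integrableOn_rpow_Ioc {a b : ℝ} (ha : 0 < a) (r : ℝ) :
    IntegrableOn (fun t : ℝ => t ^ r) (Ioc a b) := by
  refine (ContinuousOn.integrableOn_Icc fun t ht => ?_).mono_set Ioc_subset_Icc_self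
  exact (Real.continuousAt_rpow_const t r (Or.inl (ha.trans_le ht.1).ne')).continuousWithinAt

/-- The level set inequality integrated against `dl / l`: a logarithmic gain. Since `ENNReal.ofReal`
is `0` on negative numbers, the left-hand side only sees `{h > l₀}`. -/
lemma lintegral_mul_log_le [SigmaFinite μ] (hqp : q < p) (hf : Measurable f) (hm : Measurable h)
    (hh : ∀ x, 0 ≤ h x) {C : ℝ≥0} {l₀ : ℝ} (hl₀ : 0 < l₀) (hq0 : 0 < q)
    (hLS : ∀ l, l₀ ≤ l → ∫⁻ x in {x | l < h x}, f x ∂μ ≤ C * ENNReal.ofReal l ^ (p - q) *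
      ∫⁻ x in {x | l / 2 < h x}, ENNReal.ofReal (h x) ^ q ∂μ) :
    ∫⁻ x, f x * ENNReal.ofReal (Real.log (h x / l₀)) ∂μ ≤
      C * ENNReal.ofReal (2 ^ (p - q) / (p - q)) * ∫⁻ x, ENNReal.ofReal (h x) ^ p ∂μ := by
  have hpq : 0 < p - q := by linarith
  set w : ℝ → ℝ := (Ioi l₀).indicator fun t => t ^ (-1 : ℝ) with hwdef
  have hw : ∀ t, 0 ≤ w t := fun t =>
    indicator_nonneg (fun t ht => Real.rpow_nonneg (hl₀.trans ht).le _) t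
  have hw1 : ∀ t > 0, IntervalIntegrable w volume 0 t := fun t ht =>
    intervalIntegrable_of_indicator measurableSet_Ioi
      ((integrableOn_rpow_Ioc (b := t) hl₀ _).mono_set fun s hs => ⟨hs.1, hs.2.2⟩) ht.le
  have e2 : (fun t => t ^ (p - q) * w t) =
      (Ioi l₀).indicator fun t => t ^ (p - q - 1) := by
    ext t
    by_cases ht : t ∈ Ioi l₀
    · simp only [hwdef, indicator_of_mem ht]
      rw [← Real.rpow_add (hl₀.trans ht)]; rfl
    · simp only [hwdef, indicator_of_notMem ht, mul_zero]
  have hw2 : ∀ t > 0, IntervalIntegrable (fun t => t ^ (p - q) * w t) volume 0 t := fun t ht => by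
    rw [e2]
    exact intervalIntegrable_of_indicator measurableSet_Ioi
      ((integrableOn_rpow_Ioc (b := t) hl₀ _).mono_set fun s hs => ⟨hs.1, hs.2.2⟩) ht.le
  have main := lintegral_weight_le hf hm hh hl₀ hLS hw
    (fun t ht => indicator_of_notMem (by simpa using ht) _) hw1 hw2
  have hI1 : ∀ x, ENNReal.ofReal (Real.log (h x / l₀)) ≤
      ENNReal.ofReal (∫ t in (0 : ℝ)..h x, w t) := by
    intro x
    rcases le_or_gt (h x) l₀ with hx | hx
    · rw [ENNReal.ofReal_of_nonpos (Real.log_nonpos (div_nonneg (hh x) hl₀.le)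
        ((div_le_one hl₀).2 hx))]
      exact zero_le
    · apply ENNReal.ofReal_le_ofReal
      have hx0 : 0 < h x := hl₀.trans hx
      rw [intervalIntegral.integral_of_le hx0.le, hwdef, setIntegral_indicator measurableSet_Ioi]
      have : Ioc 0 (h x) ∩ Ioi l₀ = Ioc l₀ (h x) := by
        ext t; simp only [mem_inter_iff, mem_Ioc, mem_Ioi]
        exact ⟨fun ht => ⟨ht.2, ht.1.2⟩, fun ht => ⟨⟨hl₀.trans ht.1, ht.2⟩, ht.1⟩⟩
      rw [this, ← intervalIntegral.integral_of_le hx.le]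
      simp only [Real.rpow_neg_one]
      rw [integral_inv_of_pos hl₀ hx0]
  have hI2 : ∀ x, ENNReal.ofReal (h x) ^ q *
      ENNReal.ofReal (∫ t in (0 : ℝ)..2 * h x, t ^ (p - q) * w t) ≤
      ENNReal.ofReal (2 ^ (p - q) / (p - q)) * ENNReal.ofReal (h x) ^ p := by
    intro x
    rcases (hh x).eq_or_lt with hx | hx
    · rw [← hx]; simp [hq0]
    · have h1 : ∫ t in (0 : ℝ)..2 * h x, t ^ (p - q) * w t ≤
          2 ^ (p - q) / (p - q) * h x ^ (p - q) := by
        have h2 : ∫ t in (0 : ℝ)..2 * h x, t ^ (p - q - 1) =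
            2 ^ (p - q) / (p - q) * h x ^ (p - q) := by
          rw [integral_rpow (Or.inl (by linarith)), sub_add_cancel, Real.zero_rpow hpq.ne',
            Real.mul_rpow zero_le_two hx.le]
          ring
        rw [← h2]
        refine intervalIntegral.integral_mono_on (by positivity) (hw2 _ (by positivity))
          (intervalIntegral.intervalIntegrable_rpow' (by linarith)) fun t ht => ?_
        rw [show t ^ (p - q) * w t = _ from congrFun e2 t]
        exact indicator_le_self' (fun _ _ => Real.rpow_nonneg ht.1 _) t
      calc _ ≤ ENNReal.ofReal (h x) ^ q *
            ENNReal.ofReal (2 ^ (p - q) / (p - q) * h x ^ (p - q)) := by gcongr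
        _ = _ := by
          rw [ENNReal.ofReal_mul (by positivity), ← ENNReal.ofReal_rpow_of_pos hx]
          have : ENNReal.ofReal (h x) ^ p =
              ENNReal.ofReal (h x) ^ q * ENNReal.ofReal (h x) ^ (p - q) := by
            rw [← ENNReal.rpow_add _ _ (by simpa using hx) ENNReal.ofReal_ne_top,
              add_sub_cancel]
          rw [this]; ac_rfl
  calc _ ≤ ∫⁻ x, f x * ENNReal.ofReal (∫ t in (0 : ℝ)..h x, w t) ∂μ :=
        lintegral_mono fun x => mul_le_mul_right (hI1 x) _
    _ ≤ _ := main
    _ ≤ C * ∫⁻ x, ENNReal.ofReal (2 ^ (p - q) / (p - q)) * ENNReal.ofReal (h x) ^ p ∂μ := by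
        exact mul_le_mul_right (lintegral_mono hI2) _
    _ = _ := by rw [lintegral_const_mul' _ _ ENNReal.ofReal_ne_top, mul_assoc]

/-- The level set inequality integrated against `l ^ (ε - 1) dl` over `l ≤ k`. -/
lemma lintegral_mul_truncated_rpow_le [SigmaFinite μ] (hqp : q < p) (hf : Measurable f)
    (hm : Measurable h)
    (hh : ∀ x, 0 ≤ h x) {C : ℝ≥0} {l₀ : ℝ} (hl₀ : 0 < l₀) (hq0 : 0 < q)
    (hLS : ∀ l, l₀ ≤ l → ∫⁻ x in {x | l < h x}, f x ∂μ ≤ C * ENNReal.ofReal l ^ (p - q) *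
      ∫⁻ x in {x | l / 2 < h x}, ENNReal.ofReal (h x) ^ q ∂μ)
    {ε : ℝ} (hε : 0 < ε) (hε1 : ε ≤ 1) {k : ℝ} (hk : 0 < k) :
    ∫⁻ x, f x * ENNReal.ofReal ((min (h x) k ^ ε - l₀ ^ ε) / ε) ∂μ ≤
      C * ENNReal.ofReal (2 ^ (p - q + 1) / (p - q)) *
        ∫⁻ x, ENNReal.ofReal (h x) ^ p * ENNReal.ofReal (min (h x) k ^ ε) ∂μ := by
  have hpq : 0 < p - q := by linarith
  set w : ℝ → ℝ := (Ioc l₀ k).indicator fun t => t ^ (ε - 1) with hwdef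
  have hw : ∀ t, 0 ≤ w t := fun t =>
    indicator_nonneg (fun t ht => Real.rpow_nonneg (hl₀.trans ht.1).le _) t
  have hw1 : ∀ t > 0, IntervalIntegrable w volume 0 t := fun t ht =>
    intervalIntegrable_of_indicator measurableSet_Ioc
      ((integrableOn_rpow_Ioc (b := t) hl₀ _).mono_set fun s hs => ⟨hs.1.1, hs.2.2⟩) ht.le
  have e2 : (fun t => t ^ (p - q) * w t) =
      (Ioc l₀ k).indicator fun t => t ^ (p - q + ε - 1) := by
    ext t
    by_cases ht : t ∈ Ioc l₀ k
    · simp only [hwdef, indicator_of_mem ht]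
      rw [← Real.rpow_add (hl₀.trans ht.1)]
      congr 1; ring
    · simp only [hwdef, indicator_of_notMem ht, mul_zero]
  have hw2 : ∀ t > 0, IntervalIntegrable (fun t => t ^ (p - q) * w t) volume 0 t := fun t ht => by
    rw [e2]
    exact intervalIntegrable_of_indicator measurableSet_Ioc
      ((integrableOn_rpow_Ioc (b := t) hl₀ _).mono_set fun s hs => ⟨hs.1.1, hs.2.2⟩) ht.le
  have main := lintegral_weight_le hf hm hh hl₀ hLS hw
    (fun t ht => indicator_of_notMem (fun h => absurd h.1 (not_lt.2 ht)) _) hw1 hw2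
  have hI1 : ∀ x, ENNReal.ofReal ((min (h x) k ^ ε - l₀ ^ ε) / ε) ≤
      ENNReal.ofReal (∫ t in (0 : ℝ)..h x, w t) := by
    intro x
    have hmin0 : 0 ≤ min (h x) k := le_min (hh x) hk.le
    rcases le_or_gt (min (h x) k) l₀ with hx | hx
    · rw [ENNReal.ofReal_of_nonpos]
      · exact zero_le
      · refine div_nonpos_of_nonpos_of_nonneg ?_ hε.le
        rw [sub_nonpos]
        exact Real.rpow_le_rpow hmin0 hx hε.le
    · apply ENNReal.ofReal_le_ofReal
      have hx0 : 0 < h x := hl₀.trans (lt_min_iff.1 hx).1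
      rw [intervalIntegral.integral_of_le hx0.le, hwdef, setIntegral_indicator measurableSet_Ioc]
      have : Ioc 0 (h x) ∩ Ioc l₀ k = Ioc l₀ (min (h x) k) := by
        ext t; simp only [mem_inter_iff, mem_Ioc, le_min_iff]
        exact ⟨fun ht => ⟨ht.2.1, ht.1.2, ht.2.2⟩,
          fun ht => ⟨⟨hl₀.trans ht.1, ht.2.1⟩, ht.1, ht.2.2⟩⟩
      rw [this, ← intervalIntegral.integral_of_le hx.le, integral_rpow (Or.inl (by linarith)),
        sub_add_cancel]
  have hI2 : ∀ x, ENNReal.ofReal (h x) ^ q *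
      ENNReal.ofReal (∫ t in (0 : ℝ)..2 * h x, t ^ (p - q) * w t) ≤
      ENNReal.ofReal (2 ^ (p - q + 1) / (p - q)) *
        (ENNReal.ofReal (h x) ^ p * ENNReal.ofReal (min (h x) k ^ ε)) := by
    intro x
    rcases (hh x).eq_or_lt with hx | hx
    · rw [← hx]; simp [hq0]
    · have hmk : 0 < min (h x) k := lt_min hx hk
      have h1 : ∫ t in (0 : ℝ)..2 * h x, t ^ (p - q) * w t ≤
          2 ^ (p - q + 1) / (p - q) * (h x ^ (p - q) * min (h x) k ^ ε) := by
        have h2 : ∫ t in (0 : ℝ)..2 * h x, t ^ (p - q) * w t ≤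
            ∫ t in (0 : ℝ)..2 * h x, t ^ (p - q - 1) * (2 * min (h x) k) ^ ε := by
          refine intervalIntegral.integral_mono_on (by positivity) (hw2 _ (by positivity))
            ((intervalIntegral.intervalIntegrable_rpow' (by linarith)).mul_const _)
            fun t ht => ?_
          rw [show t ^ (p - q) * w t = _ from congrFun e2 t]
          by_cases htk : t ∈ Ioc l₀ k
          · rw [indicator_of_mem htk]
            have ht0 : 0 < t := hl₀.trans htk.1
            rw [show p - q + ε - 1 = p - q - 1 + ε by ring, Real.rpow_add ht0]
            gcongr
            rw [mul_min_of_nonneg _ _ zero_le_two]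
            exact le_min ht.2 (by linarith [htk.2])
          · rw [indicator_of_notMem htk]
            have := ht.1
            positivity
        refine h2.trans ?_
        rw [intervalIntegral.integral_mul_const, integral_rpow (Or.inl (by linarith)),
          sub_add_cancel, Real.zero_rpow hpq.ne', Real.mul_rpow zero_le_two hx.le,
          Real.mul_rpow zero_le_two hmk.le, sub_zero]
        have h3 : (2 : ℝ) ^ ε ≤ 2 := by
          calc (2 : ℝ) ^ ε ≤ 2 ^ (1 : ℝ) := Real.rpow_le_rpow_of_exponent_le one_le_two hε1
            _ = 2 := Real.rpow_one 2
        rw [Real.rpow_add zero_lt_two, Real.rpow_one]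
        calc _ = 2 ^ (p - q) * h x ^ (p - q) / (p - q) * min (h x) k ^ ε * 2 ^ ε := by ring
          _ ≤ 2 ^ (p - q) * h x ^ (p - q) / (p - q) * min (h x) k ^ ε * 2 := by gcongr
          _ = _ := by ring
      calc _ ≤ ENNReal.ofReal (h x) ^ q *
            ENNReal.ofReal (2 ^ (p - q + 1) / (p - q) * (h x ^ (p - q) * min (h x) k ^ ε)) := by
            gcongr
        _ = _ := by
          rw [ENNReal.ofReal_mul (by positivity), ENNReal.ofReal_mul (by positivity),
            ← ENNReal.ofReal_rpow_of_pos hx]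
          have : ENNReal.ofReal (h x) ^ p =
              ENNReal.ofReal (h x) ^ q * ENNReal.ofReal (h x) ^ (p - q) := by
            rw [← ENNReal.rpow_add _ _ (by simpa using hx) ENNReal.ofReal_ne_top,
              add_sub_cancel]
          rw [this]; ac_rfl
  calc _ ≤ ∫⁻ x, f x * ENNReal.ofReal (∫ t in (0 : ℝ)..h x, w t) ∂μ :=
        lintegral_mono fun x => mul_le_mul_right (hI1 x) _
    _ ≤ _ := main
    _ ≤ C * ∫⁻ x, ENNReal.ofReal (2 ^ (p - q + 1) / (p - q)) *
          (ENNReal.ofReal (h x) ^ p * ENNReal.ofReal (min (h x) k ^ ε)) ∂μ := by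
        exact mul_le_mul_right (lintegral_mono hI2) _
    _ = _ := by rw [lintegral_const_mul' _ _ ENNReal.ofReal_ne_top, mul_assoc]

/-- Gehring's lemma: if moreover `f` dominates `h ^ p`, the right-hand side of the integrated
inequality can be absorbed for small `ε`. The truncation at level `k` keeps the absorbed term
finite. -/
lemma lintegral_rpow_add_le [SigmaFinite μ] (hp0 : 0 < p) (hqp : q < p)
    (hf : Measurable f) (hm : Measurable h)
    (hh : ∀ x, 0 ≤ h x) {C : ℝ≥0} {l₀ : ℝ} (hl₀ : 0 < l₀) (hq0 : 0 < q)
    (hLS : ∀ l, l₀ ≤ l → ∫⁻ x in {x | l < h x}, f x ∂μ ≤ C * ENNReal.ofReal l ^ (p - q) *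
      ∫⁻ x in {x | l / 2 < h x}, ENNReal.ofReal (h x) ^ q ∂μ)
    {c : ℝ} (hc : 0 < c) (hfh : ∀ᵐ x ∂μ, ENNReal.ofReal c * ENNReal.ofReal (h x) ^ p ≤ f x)
    (hint : ∫⁻ x, ENNReal.ofReal (h x) ^ p ∂μ ≠ ⊤)
    {ε : ℝ} (hε : 0 < ε) (hε1 : ε ≤ 1) (hεC : ε * (C * (2 ^ (p - q + 1) / (p - q)) / c) ≤ 1 / 2) :
    ∫⁻ x, ENNReal.ofReal (h x) ^ (p + ε) ∂μ ≤
      2 * (ENNReal.ofReal (l₀ ^ ε) * ∫⁻ x, ENNReal.ofReal (h x) ^ p ∂μ) := by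
  have hpq : 0 < p - q := by linarith
  set B := ∫⁻ x, ENNReal.ofReal (h x) ^ p ∂μ with hB
  have hpm : Measurable fun x => ENNReal.ofReal (h x) ^ p := hm.ennreal_ofReal.pow_const p
  have hmk : ∀ k : ℝ, Measurable fun x => ENNReal.ofReal (min (h x) k ^ ε) := fun k =>
    ((hm.min measurable_const).pow_const ε).ennreal_ofReal
  have htrunc : ∀ k : ℝ, 0 < k →
      ∫⁻ x, ENNReal.ofReal (h x) ^ p * ENNReal.ofReal (min (h x) k ^ ε) ∂μ ≤
        2 * (ENNReal.ofReal (l₀ ^ ε) * B) := by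
    intro k hk
    set A := ∫⁻ x, ENNReal.ofReal (h x) ^ p * ENNReal.ofReal (min (h x) k ^ ε) ∂μ with hA
    have hAt : A ≠ ⊤ := by
      refine ne_of_lt (lt_of_le_of_lt (b := ∫⁻ x, ENNReal.ofReal (h x) ^ p *
        ENNReal.ofReal (k ^ ε) ∂μ) ?_ ?_)
      · refine lintegral_mono fun x => ?_
        have : 0 ≤ min (h x) k := le_min (hh x) hk.le
        gcongr
        exact min_le_right _ _
      · rw [lintegral_mul_const _ hpm]
        exact ENNReal.mul_lt_top hint.lt_top ENNReal.ofReal_lt_top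
    refine le_two_mul_of_le_add_half hAt ?_
    have key := lintegral_mul_truncated_rpow_le hqp hf hm hh hl₀ hq0 hLS hε hε1 hk
    have h1 : ∫⁻ x, ENNReal.ofReal (h x) ^ p * ENNReal.ofReal (min (h x) k ^ ε - l₀ ^ ε) ∂μ ≤
        A / 2 := by
      have h2 : ∫⁻ x, ENNReal.ofReal (h x) ^ p * ENNReal.ofReal (min (h x) k ^ ε - l₀ ^ ε) ∂μ ≤
          ENNReal.ofReal (ε / c) *
            ∫⁻ x, f x * ENNReal.ofReal ((min (h x) k ^ ε - l₀ ^ ε) / ε) ∂μ := by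
        rw [← lintegral_const_mul' _ _ ENNReal.ofReal_ne_top]
        refine lintegral_mono_ae ?_
        filter_upwards [hfh] with x hx
        have e : ENNReal.ofReal (ε / c) * ENNReal.ofReal c = ENNReal.ofReal ε := by
          rw [← ENNReal.ofReal_mul (by positivity), div_mul_cancel₀ _ hc.ne']
        calc _ = ENNReal.ofReal (h x) ^ p *
              (ENNReal.ofReal ε * ENNReal.ofReal ((min (h x) k ^ ε - l₀ ^ ε) / ε)) := by
              rw [← ENNReal.ofReal_mul hε.le, mul_div_cancel₀ _ hε.ne']
          _ = ENNReal.ofReal (ε / c) * ((ENNReal.ofReal c * ENNReal.ofReal (h x) ^ p) *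
              ENNReal.ofReal ((min (h x) k ^ ε - l₀ ^ ε) / ε)) := by
              rw [← e]; ac_rfl
          _ ≤ _ := by gcongr
      refine h2.trans ?_
      calc _ ≤ ENNReal.ofReal (ε / c) *
            (C * ENNReal.ofReal (2 ^ (p - q + 1) / (p - q)) * A) := by gcongr
        _ = ENNReal.ofReal (ε * (C * (2 ^ (p - q + 1) / (p - q)) / c)) * A := by
            rw [show ε * (C * (2 ^ (p - q + 1) / (p - q)) / c) =
              (ε / c) * (C * (2 ^ (p - q + 1) / (p - q))) by ring,
              ENNReal.ofReal_mul (by positivity), ENNReal.ofReal_mul C.coe_nonneg,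
              ENNReal.ofReal_coe_nnreal]
            ac_rfl
        _ ≤ ENNReal.ofReal (1 / 2) * A := by gcongr
        _ = A / 2 := by
            rw [one_div, ENNReal.ofReal_inv_of_pos two_pos, ENNReal.ofReal_ofNat,
              ENNReal.div_eq_inv_mul]
    calc A ≤ ∫⁻ x, (ENNReal.ofReal (h x) ^ p * ENNReal.ofReal (l₀ ^ ε) +
          ENNReal.ofReal (h x) ^ p * ENNReal.ofReal (min (h x) k ^ ε - l₀ ^ ε)) ∂μ := by
          refine lintegral_mono fun x => ?_
          rw [← mul_add]
          gcongr
          calc ENNReal.ofReal (min (h x) k ^ ε)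
              = ENNReal.ofReal (l₀ ^ ε + (min (h x) k ^ ε - l₀ ^ ε)) := by rw [add_sub_cancel]
            _ ≤ _ := ENNReal.ofReal_add_le
      _ = ENNReal.ofReal (l₀ ^ ε) * B +
          ∫⁻ x, ENNReal.ofReal (h x) ^ p * ENNReal.ofReal (min (h x) k ^ ε - l₀ ^ ε) ∂μ := by
          rw [lintegral_add_left (hpm.mul_const _), lintegral_mul_const _ hpm, mul_comm]
      _ ≤ _ := by gcongr
  have hlim := lintegral_tendsto_of_tendsto_of_monotone (μ := μ)
    (f := fun (k : ℕ) x => ENNReal.ofReal (h x) ^ p * ENNReal.ofReal (min (h x) (k + 1) ^ ε))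
    (F := fun x => ENNReal.ofReal (h x) ^ (p + ε))
    (fun k => (hpm.mul (hmk _)).aemeasurable) (.of_forall fun x k k' hkk => by
      have : 0 ≤ min (h x) ((k : ℝ) + 1) := le_min (hh x) (by positivity)
      have : (k : ℝ) ≤ k' := by exact_mod_cast hkk
      dsimp only
      gcongr) (.of_forall fun x => by
      obtain ⟨N, hN⟩ := exists_nat_ge (h x)
      refine tendsto_const_nhds.congr' ?_
      filter_upwards [Filter.eventually_ge_atTop N] with k hk
      have : (N : ℝ) ≤ k := by exact_mod_cast hk
      rw [min_eq_left (by linarith), ENNReal.rpow_add_of_nonneg _ _ hp0.le hε.le,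
        ENNReal.ofReal_rpow_of_nonneg (hh x) hε.le])
  exact le_of_tendsto' hlim fun k => htrunc _ (by positivity)

end LayerCake

/-! ### Cutting off the estimates -/

section Weighted

variable {m n : ℕ} {p q L : ℝ} {F : Matrix (Fin m) (Fin n) ℝ → ℝ}

lemma volume_closedBall_eq (x : EuclideanSpace ℝ (Fin n)) {r : ℝ} (hr : 0 < r) :
    volume (Metric.closedBall x r) =
      ENNReal.ofReal (r ^ n) * volume (Metric.closedBall (0 : EuclideanSpace ℝ (Fin n)) 1) := by
  rw [← Measure.addHaar_closedBall_center volume x 1, ← volume_closedBall_mul x hr, mul_one]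

/-- The reverse Hölder inequality makes the stopping argument applicable to `h = w |Du|`, for the
weight `w = d ^ (n / q)`, where `d` is a Lipschitz function vanishing outside the domain. The weight
is comparable to a constant on balls of radius less than `d / 2`, and the power `n / q` makes
the averages of `h ^ q` over the balls of radius `d / 2` bounded. The constant `C` does not
depend on `d`. -/
lemma exists_level_set_inequality (hp : 1 < p)
    (hF : IsQuasiconcave F) (hhom : IsHomogeneousOfDegree p F) (hL : GrowthBound p L F)
    (hq : 1 ≤ q) (hqp : q < p) (hpq : p < q + 1) (hn : n * (q / (q - p + 1) / q - 1) < 1) :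
    ∃ C : ℝ≥0, ∀ Ω : Set (EuclideanSpace ℝ (Fin n)), IsOpen Ω →
      ∀ (u : EuclideanSpace ℝ (Fin n) → EuclideanSpace ℝ (Fin m))
        (G H : EuclideanSpace ℝ (Fin n) → Matrix (Fin m) (Fin n) ℝ)
        (d : EuclideanSpace ℝ (Fin n) → ℝ) (l₀ : ℝ),
      HasWeakGradient Ω u G → MemLpLoc G p Ω →
      (∀ᵐ x ∂volume.restrict Ω, 0 ≤ F (G x)) →
      LipschitzWith 1 d → (∀ x, 0 ≤ d x) → (∀ x, d x ≤ 1) → {x | 0 < d x} ⊆ Ω →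
      StronglyMeasurable H → H =ᵐ[volume.restrict {x | 0 < d x}] G → (∀ x, d x = 0 → H x = 0) →
      ∫⁻ x, ‖H x‖ₑ ^ q ≠ ⊤ → 0 < l₀ →
      ENNReal.ofReal (3 ^ n) * ∫⁻ x, ‖H x‖ₑ ^ q ≤ ENNReal.ofReal l₀ ^ q *
        volume (Metric.closedBall (0 : EuclideanSpace ℝ (Fin n)) 1) →
      ∀ l, l₀ ≤ l →
        ∫⁻ x in {x | l < d x ^ (n / q) * ‖H x‖},
            ENNReal.ofReal ((d x ^ (n / q)) ^ p * F (H x)) ≤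
          C * ENNReal.ofReal l ^ (p - q) *
            ∫⁻ x in {x | l / 2 < d x ^ (n / q) * ‖H x‖},
              ENNReal.ofReal (d x ^ (n / q) * ‖H x‖) ^ q := by
  have hq0 : 0 < q := by linarith
  have hp0 : 0 < p := by linarith
  obtain ⟨C, hC⟩ := exists_reverse_holder hp hF hhom hL hq hqp hpq hn
  set β := volume (Metric.closedBall (0 : EuclideanSpace ℝ (Fin n)) 1) with hβ
  have hβ0 : β ≠ 0 := (Metric.measure_closedBall_pos volume _ one_pos).ne'
  have hβt : β ≠ ⊤ := measure_closedBall_lt_top.ne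
  have hvol : ∀ (x : EuclideanSpace ℝ (Fin n)) {r : ℝ}, 0 < r →
    volume (Metric.closedBall x r) = ENNReal.ofReal (r ^ n) * β := fun x r hr =>
      volume_closedBall_eq x hr
  clear_value β
  set C₁ : ℝ≥0∞ := C * ENNReal.ofReal (3 ^ (n / q)) ^ p * (ENNReal.ofReal (2 ^ n) * β) ^ (p / q) *
    β⁻¹ with hC₁
  have hC₁t : C₁ ≠ ⊤ := by
    refine ENNReal.mul_ne_top (ENNReal.mul_ne_top (ENNReal.mul_ne_top ENNReal.coe_ne_top
      (ENNReal.rpow_ne_top_of_nonneg hp0.le ENNReal.ofReal_ne_top))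
      (ENNReal.rpow_ne_top_of_nonneg (by positivity)
        (ENNReal.mul_ne_top ENNReal.ofReal_ne_top hβt))) (ENNReal.inv_ne_top.2 hβ0)
  refine ⟨C₁.toNNReal * Real.toNNReal (5 ^ n) * 2, ?_⟩
  intro Ω hΩ u G H d l₀ hu hG hFG hdL hd0 hd1 hdΩ hHm hHG hH0 hHint hl₀ hHl l hl
  have hlpos : 0 < l := hl₀.trans_le hl
  have hdc : Continuous d := hdL.continuous
  have hdist : ∀ x y ρ, y ∈ Metric.closedBall x ρ → |d y - d x| ≤ ρ := fun x y ρ hy => by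
    have := hdL.dist_le_mul y x
    rw [Real.dist_eq, NNReal.coe_one, one_mul] at this
    exact this.trans hy
  set h : EuclideanSpace ℝ (Fin n) → ℝ := fun x => d x ^ (n / q) * ‖H x‖ with hh
  have hnq : 0 ≤ (n : ℝ) / q := by positivity
  have hm : Measurable h :=
    (hdc.measurable.pow_const _).mul hHm.norm.measurable
  have hd : ∀ x, 0 < h x → 0 < d x := by
    intro x hx
    refine (hd0 x).lt_of_ne fun h0 => ?_
    simp [hh, hH0 x h0.symm] at hx
  have hhH : ∀ x, ENNReal.ofReal (h x) ≤ ‖H x‖ₑ := by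
    intro x
    rw [← ofReal_norm]
    refine ENNReal.ofReal_le_ofReal ?_
    exact mul_le_of_le_one_left (norm_nonneg _) (Real.rpow_le_one (hd0 x) (hd1 x) hnq)
  have hint : ∫⁻ x, ENNReal.ofReal (h x) ^ q ≠ ⊤ :=
    ne_top_of_le_ne_top hHint (lintegral_mono fun x => by gcongr; exact hhH x)
  have hae : ∀ s : Set (EuclideanSpace ℝ (Fin n)), s ⊆ {x | 0 < d x} →
      H =ᵐ[volume.restrict s] G := fun s hs => ae_restrict_of_ae_restrict_of_subset hs hHG
  have hRH : ∀ x r, 0 < r → 4 * r ≤ d x →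
      ∫⁻ y in Metric.closedBall x (2 * r), ENNReal.ofReal (h y) ^ q ≤
        ENNReal.ofReal l ^ q * volume (Metric.closedBall x (2 * r)) →
      ∫⁻ y in Metric.closedBall x r, ENNReal.ofReal ((d y ^ (n / q)) ^ p * F (H y)) ≤
        C₁.toNNReal * ENNReal.ofReal l ^ p * volume (Metric.closedBall x r) := by
    intro x r hr hrd hav
    have hdx : 0 < d x := by linarith
    have hsub : Metric.closedBall x (2 * r) ⊆ {x | 0 < d x} := fun y hy => by
      have := abs_le.1 (hdist x y _ hy)
      simp only [mem_ofPred_eq]; linarith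
    have hsub1 : Metric.closedBall x r ⊆ Metric.closedBall x (2 * r) :=
      Metric.closedBall_subset_closedBall (by linarith)
    have hR := hC Ω hΩ u G hu hG hFG x r hr (hsub.trans hdΩ)
    -- bounds for the weight on the ball of radius `2 * r`, where `d` varies by at most `d x / 2`
    set a : ℝ := (3 / 2 * d x) ^ (n / q) with ha
    set b : ℝ := (1 / 2 * d x) ^ (n / q) with hb
    have hb0 : 0 < b := by positivity
    have hab : a * b⁻¹ = 3 ^ (n / q) := by
      rw [ha, hb, ← Real.inv_rpow (by positivity), ← Real.mul_rpow (by positivity) (by positivity)]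
      congr 1
      field_simp
    have hf : ∫⁻ y in Metric.closedBall x r, ENNReal.ofReal ((d y ^ (n / q)) ^ p * F (H y)) ≤
        ENNReal.ofReal a ^ p * ∫⁻ y in Metric.closedBall x r, ENNReal.ofReal (F (G y)) := by
      rw [← lintegral_const_mul' _ _ (ENNReal.rpow_ne_top_of_nonneg hp0.le ENNReal.ofReal_ne_top)]
      refine lintegral_mono_ae ?_
      filter_upwards [hae _ (hsub1.trans hsub),
        ae_restrict_mem Metric.isClosed_closedBall.measurableSet] with y hy hyB
      rw [hy, ENNReal.ofReal_mul (by have := hd0 y; positivity),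
        ← ENNReal.ofReal_rpow_of_nonneg (by have := hd0 y; positivity) hp0.le]
      have := abs_le.1 (hdist x y _ hyB)
      have := hd0 y
      have hda : d y ^ (n / q) ≤ a := by
        rw [ha]; gcongr; linarith
      gcongr
    have hg : ∫⁻ y in Metric.closedBall x (2 * r), ‖G y‖ₑ ^ q ≤
        ENNReal.ofReal b⁻¹ ^ q * (ENNReal.ofReal l ^ q * (ENNReal.ofReal ((2 * r) ^ n) * β)) := by
      rw [← hvol x (by positivity)]
      refine le_trans ?_ (mul_le_mul_right hav _)
      rw [← lintegral_const_mul' _ _ (ENNReal.rpow_ne_top_of_nonneg hq0.le ENNReal.ofReal_ne_top)]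
      refine lintegral_mono_ae ?_
      filter_upwards [hae _ hsub, ae_restrict_mem Metric.isClosed_closedBall.measurableSet]
        with y hy hyB
      rw [← hy, ← ENNReal.mul_rpow_of_nonneg _ _ hq0.le, ← ENNReal.ofReal_mul (by positivity),
        ← ofReal_norm]
      gcongr
      have := abs_le.1 (hdist x y _ hyB)
      have hbd : b ≤ d y ^ (n / q) := by
        rw [hb]; gcongr; linarith
      calc ‖H y‖ = b⁻¹ * (b * ‖H y‖) := by field_simp
        _ ≤ _ := by simp only [hh]; gcongr
    have e1 : ENNReal.ofReal (r⁻¹ ^ n) * ENNReal.ofReal ((2 * r) ^ n) = ENNReal.ofReal (2 ^ n) := by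
      rw [← ENNReal.ofReal_mul (by positivity), ← mul_pow]
      congr 2; field_simp
    have e2 : (ENNReal.ofReal (r⁻¹ ^ n) * (ENNReal.ofReal b⁻¹ ^ q * (ENNReal.ofReal l ^ q *
        (ENNReal.ofReal ((2 * r) ^ n) * β)))) ^ (p / q) =
        ENNReal.ofReal b⁻¹ ^ p *
          (ENNReal.ofReal l ^ p * (ENNReal.ofReal (2 ^ n) * β) ^ (p / q)) := by
      have hpq0 : 0 ≤ p / q := by positivity
      rw [← e1]
      rw [show ENNReal.ofReal (r⁻¹ ^ n) * (ENNReal.ofReal b⁻¹ ^ q * (ENNReal.ofReal l ^ q *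
        (ENNReal.ofReal ((2 * r) ^ n) * β))) = ENNReal.ofReal b⁻¹ ^ q * (ENNReal.ofReal l ^ q *
          (ENNReal.ofReal (r⁻¹ ^ n) * ENNReal.ofReal ((2 * r) ^ n) * β)) by ac_rfl]
      rw [ENNReal.mul_rpow_of_nonneg _ _ hpq0, ENNReal.mul_rpow_of_nonneg _ _ hpq0,
        ← ENNReal.rpow_mul, ← ENNReal.rpow_mul, mul_div_cancel₀ _ hq0.ne']
    have e3 : ENNReal.ofReal a ^ p * ENNReal.ofReal b⁻¹ ^ p = ENNReal.ofReal (3 ^ (n / q)) ^ p := by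
      rw [← ENNReal.mul_rpow_of_nonneg _ _ hp0.le, ← ENNReal.ofReal_mul (by positivity), hab]
    calc _ ≤ ENNReal.ofReal a ^ p * (C * ENNReal.ofReal (r ^ n) *
          (ENNReal.ofReal (r⁻¹ ^ n) * (ENNReal.ofReal b⁻¹ ^ q * (ENNReal.ofReal l ^ q *
            (ENNReal.ofReal ((2 * r) ^ n) * β)))) ^ (p / q)) := by
          refine hf.trans (mul_le_mul_right (hR.trans ?_) _)
          gcongr
      _ = C * (ENNReal.ofReal a ^ p * ENNReal.ofReal b⁻¹ ^ p) *
          (ENNReal.ofReal (2 ^ n) * β) ^ (p / q) * ENNReal.ofReal l ^ p *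
          ENNReal.ofReal (r ^ n) := by
          rw [e2]; ac_rfl
      _ = C₁ * ENNReal.ofReal l ^ p * (ENNReal.ofReal (r ^ n) * β) := by
          have : ENNReal.ofReal (r ^ n) = β⁻¹ * (ENNReal.ofReal (r ^ n) * β) := by
            rw [mul_comm _ β, ← mul_assoc, ENNReal.inv_mul_cancel hβ0 hβt, one_mul]
          rw [e3, hC₁]
          conv_lhs => rw [this]
          ac_rfl
      _ = _ := by rw [ENNReal.coe_toNNReal hC₁t, hvol x hr]
  have hlarge : ∀ x, 0 < d x → ∫⁻ y in Metric.closedBall x (d x / 2), ENNReal.ofReal (h y) ^ q ≤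
      ENNReal.ofReal l ^ q * volume (Metric.closedBall x (d x / 2)) := by
    intro x hx
    have h1 : ∫⁻ y in Metric.closedBall x (d x / 2), ENNReal.ofReal (h y) ^ q ≤
        ENNReal.ofReal ((3 / 2 * d x) ^ n) * ∫⁻ y, ‖H y‖ₑ ^ q := by
      rw [← lintegral_const_mul' _ _ ENNReal.ofReal_ne_top]
      refine le_trans ?_ (setLIntegral_le_lintegral (Metric.closedBall x (d x / 2)) _)
      refine setLIntegral_mono' Metric.isClosed_closedBall.measurableSet fun y hy => ?_
      have := abs_le.1 (hdist x y _ hy)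
      have h0 := hd0 y
      rw [← ofReal_norm, hh, ENNReal.ofReal_mul (by positivity),
        ENNReal.mul_rpow_of_nonneg _ _ hq0.le, ENNReal.ofReal_rpow_of_nonneg (by positivity) hq0.le,
        ← Real.rpow_mul h0, div_mul_cancel₀ _ hq0.ne', Real.rpow_natCast]
      gcongr
      linarith
    have e : (3 / 2 * d x) ^ n = (d x / 2) ^ n * 3 ^ n := by rw [← mul_pow]; congr 1; ring
    rw [hvol x (by positivity)]
    calc _ ≤ _ := h1
      _ = ENNReal.ofReal ((d x / 2) ^ n) * (ENNReal.ofReal (3 ^ n) * ∫⁻ y, ‖H y‖ₑ ^ q) := by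
          rw [e, ENNReal.ofReal_mul (by positivity), mul_assoc]
      _ ≤ ENNReal.ofReal ((d x / 2) ^ n) * (ENNReal.ofReal l ^ q * β) := by
          refine mul_le_mul_right (hHl.trans ?_) _
          gcongr
      _ = _ := by ac_rfl
  have := setLIntegral_superlevel_le hq hm hd hd1 hint hlpos hRH hlarge
  refine this.trans (le_of_eq ?_)
  push_cast
  rfl

end Weighted

/-! ### The local estimates -/

section Local

variable {m n : ℕ} {p q L : ℝ} {F : Matrix (Fin m) (Fin n) ℝ → ℝ}

/-- An exponent `q < p` so close to `p` that the Poincaré inequality gains enough integrability to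
reach `q / (q - p + 1)`. -/
lemma exists_lower_exponent (n : ℕ) (hp : 1 < p) :
    ∃ q : ℝ, 1 ≤ q ∧ q < p ∧ p < q + 1 ∧ n * (q / (q - p + 1) / q - 1) < 1 := by
  set s : ℝ := min (p - 1) (1 / (n + 2)) / 2 with hs
  have hs0 : 0 < s := by
    have : 0 < p - 1 := by linarith
    positivity
  have h1 : s ≤ (p - 1) / 2 := by
    have := min_le_left (p - 1) (1 / ((n : ℝ) + 2)); rw [hs]; linarith
  have h2 : s * (n + 2) ≤ 1 / 2 := by
    have h3 := min_le_right (p - 1) (1 / ((n : ℝ) + 2))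
    have h4 : s ≤ 1 / ((n : ℝ) + 2) / 2 := by rw [hs]; linarith
    calc s * (n + 2) ≤ 1 / ((n : ℝ) + 2) / 2 * (n + 2) := by gcongr
      _ = 1 / 2 := by field_simp
  have hn0 : (0 : ℝ) ≤ n := Nat.cast_nonneg n
  have h3 : 0 < 1 - s := by nlinarith
  refine ⟨p - s, by linarith, by linarith, by nlinarith, ?_⟩
  have hq0 : 0 < p - s := by linarith
  have e : (p - s) / (p - s - p + 1) / (p - s) - 1 = s / (1 - s) := by
    rw [show p - s - p + 1 = 1 - s by ring]
    field_simp
    ring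
  rw [e, ← mul_div_assoc, div_lt_one h3]
  nlinarith

/-- A Lipschitz function supported in `V` and bounded below on the compact set `K`. -/
lemma exists_lipschitz_cutoff {K V : Set (EuclideanSpace ℝ (Fin n))} (hK : IsCompact K)
    (hV : IsOpen V) (hKV : K ⊆ V) :
    ∃ (d : EuclideanSpace ℝ (Fin n) → ℝ) (δ : ℝ), 0 < δ ∧ δ ≤ 1 ∧ LipschitzWith 1 d ∧
      (∀ x, 0 ≤ d x) ∧ (∀ x, d x ≤ 1) ∧ {x | 0 < d x} ⊆ V ∧ ∀ x ∈ K, δ ≤ d x := by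
  rcases K.eq_empty_or_nonempty with rfl | hne
  · exact ⟨fun _ => 0, 1, one_pos, le_rfl, LipschitzWith.const' 0, fun _ => le_rfl,
      fun _ => zero_le_one, by simp, by simp⟩
  obtain ⟨δ, hδ, hsub⟩ := hK.exists_thickening_subset_open hV hKV
  have hLip : LipschitzWith 1 fun x => min 1 δ - Metric.infDist x K := by
    refine LipschitzWith.of_dist_le_mul fun x y => ?_
    rw [Real.dist_eq, sub_sub_sub_cancel_left, abs_sub_comm, ← Real.dist_eq]
    exact (Metric.lipschitz_infDist_pt K).dist_le_mul x y
  refine ⟨fun x => max (min 1 δ - Metric.infDist x K) 0, min 1 δ, lt_min one_pos hδ,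
    min_le_left _ _, hLip.max_const 0, fun x => le_max_right _ _, fun x => ?_, fun x hx => ?_,
    fun x hx => ?_⟩
  · refine max_le ?_ zero_le_one
    have := Metric.infDist_nonneg (x := x) (s := K)
    linarith [min_le_left 1 δ]
  · refine hsub ((Metric.mem_thickening_iff_infDist_lt hne).2 ?_)
    simp only [mem_ofPred_eq, lt_max_iff, lt_self_iff_false, or_false, sub_pos] at hx
    exact hx.trans_le (min_le_right _ _)
  · dsimp only
    rw [Metric.infDist_zero_of_mem hx, sub_zero]
    exact le_max_left _ _

/-- The starting level `l₀ = κ (‖Du‖_p + 1)` of the stopping argument. -/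
lemma exists_threshold {V : Set (EuclideanSpace ℝ (Fin n))} (hVt : volume V ≠ ⊤) (hq : 1 ≤ q)
    (hqp : q < p) :
    ∃ κ : ℝ, 1 ≤ κ ∧ ∀ G : EuclideanSpace ℝ (Fin n) → Matrix (Fin m) (Fin n) ℝ,
      MemLp G (ENNReal.ofReal p) (volume.restrict V) →
      ENNReal.ofReal (3 ^ n) * ∫⁻ x in V, ‖G x‖ₑ ^ q ≤
        ENNReal.ofReal (κ * ((eLpNorm G (ENNReal.ofReal p) (volume.restrict V)).toNNReal + 1)) ^ q *
          volume (Metric.closedBall (0 : EuclideanSpace ℝ (Fin n)) 1) := by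
  have hq0 : 0 < q := by linarith
  have hp0 : 0 < p := by linarith
  set β := volume (Metric.closedBall (0 : EuclideanSpace ℝ (Fin n)) 1) with hβ
  have hβ0 : β ≠ 0 := (Metric.measure_closedBall_pos volume _ one_pos).ne'
  have hβt : β ≠ ⊤ := measure_closedBall_lt_top.ne
  clear_value β
  have he : 0 ≤ 1 / q - 1 / p := sub_nonneg.2 (one_div_le_one_div_of_le hq0 hqp.le)
  set a : ℝ≥0∞ := (ENNReal.ofReal (3 ^ n) * β⁻¹) ^ (1 / q) * volume V ^ (1 / q - 1 / p) with ha
  have hat : a ≠ ⊤ := ENNReal.mul_ne_top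
    (ENNReal.rpow_ne_top_of_nonneg (by positivity)
      (ENNReal.mul_ne_top ENNReal.ofReal_ne_top (ENNReal.inv_ne_top.2 hβ0)))
    (ENNReal.rpow_ne_top_of_nonneg he hVt)
  refine ⟨a.toReal + 1, by linarith [ENNReal.toReal_nonneg (a := a)], fun G hG => ?_⟩
  set N := eLpNorm G (ENNReal.ofReal p) (volume.restrict V) with hN
  have hNt : N ≠ ⊤ := hG.2.ne
  have h1 := eLpNorm_le_eLpNorm_mul_rpow_measure_univ (p := ENNReal.ofReal q)
    (q := ENNReal.ofReal p) (ENNReal.ofReal_le_ofReal hqp.le) hG.1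
  rw [Measure.restrict_apply_univ, ENNReal.toReal_ofReal hq0.le, ENNReal.toReal_ofReal hp0.le,
    ← hN] at h1
  have h2 : ∫⁻ x in V, ‖G x‖ₑ ^ q =
      eLpNorm G (ENNReal.ofReal q) (volume.restrict V) ^ q := by
    rw [eLpNorm_eq_lintegral_rpow_enorm_toReal (by simpa) (by simp), ENNReal.toReal_ofReal hq0.le,
      ← ENNReal.rpow_mul, one_div_mul_cancel hq0.ne', ENNReal.rpow_one]
  have h3 : ENNReal.ofReal (3 ^ n) = (ENNReal.ofReal (3 ^ n) * β⁻¹) ^ (1 / q * q) * β := by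
    rw [one_div_mul_cancel hq0.ne', ENNReal.rpow_one, mul_assoc, ENNReal.inv_mul_cancel hβ0 hβt,
      mul_one]
  calc _ ≤ (ENNReal.ofReal (3 ^ n) * β⁻¹) ^ (1 / q * q) * β *
        (N * volume V ^ (1 / q - 1 / p)) ^ q := by
        rw [h2]; conv_lhs => rw [h3]
        gcongr
    _ = (a * N) ^ q * β := by
        rw [ENNReal.rpow_mul, ha, mul_right_comm, ← ENNReal.mul_rpow_of_nonneg _ _ hq0.le]
        congr 2; ac_rfl
    _ ≤ _ := by
        gcongr
        rw [ENNReal.ofReal_mul (by positivity)]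
        gcongr
        · rw [← ENNReal.ofReal_toReal hat]
          refine ENNReal.ofReal_le_ofReal ?_
          rw [ENNReal.toReal_ofReal ENNReal.toReal_nonneg]; linarith
        · conv_lhs => rw [← ENNReal.coe_toNNReal hNt, ← ENNReal.ofReal_coe_nnreal]
          exact ENNReal.ofReal_le_ofReal (by linarith)

/-- The level set inequality for functions `h` and `f` which on `K` are comparable to `|Du|` and
`F(Du)`. -/
lemma exists_local_level_set_inequality (hp : 1 < p)
    (hF : IsQuasiconcave F) (hhom : IsHomogeneousOfDegree p F) (hL : GrowthBound p L F)
    (hq : 1 ≤ q) (hqp : q < p) (hpq : p < q + 1) (hn : n * (q / (q - p + 1) / q - 1) < 1) :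
    ∃ C : ℝ≥0, ∀ K V : Set (EuclideanSpace ℝ (Fin n)), IsCompact K → IsOpen V → K ⊆ V →
      volume V ≠ ⊤ → ∃ a κ : ℝ, 0 < a ∧ a ≤ 1 ∧ 1 ≤ κ ∧
      ∀ Ω : Set (EuclideanSpace ℝ (Fin n)), IsOpen Ω → V ⊆ Ω →
      ∀ (u : EuclideanSpace ℝ (Fin n) → EuclideanSpace ℝ (Fin m))
        (G : EuclideanSpace ℝ (Fin n) → Matrix (Fin m) (Fin n) ℝ),
      HasWeakGradient Ω u G → MemLpLoc G p Ω →
      MemLp G (ENNReal.ofReal p) (volume.restrict V) →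
      (∀ᵐ x ∂volume.restrict Ω, 0 ≤ F (G x)) →
      ∃ (f : EuclideanSpace ℝ (Fin n) → ℝ≥0∞) (h : EuclideanSpace ℝ (Fin n) → ℝ),
        Measurable f ∧ Measurable h ∧ (∀ x, 0 ≤ h x) ∧
        (∀ l, κ * ((eLpNorm G (ENNReal.ofReal p) (volume.restrict V)).toNNReal + 1) ≤ l →
          ∫⁻ x in {x | l < h x}, f x ≤ C * ENNReal.ofReal l ^ (p - q) *
            ∫⁻ x in {x | l / 2 < h x}, ENNReal.ofReal (h x) ^ q) ∧
        ∫⁻ x, ENNReal.ofReal (h x) ^ p ≤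
          (eLpNorm G (ENNReal.ofReal p) (volume.restrict V)) ^ p ∧
        (∀ᵐ x ∂volume.restrict K, a * ‖G x‖ ≤ h x) ∧
        (∀ᵐ x ∂volume.restrict K, ENNReal.ofReal (a ^ p * F (G x)) ≤ f x) ∧
        ∀ c : ℝ, 0 ≤ c → (∀ᵐ x ∂volume.restrict Ω, c * ‖G x‖ ^ p ≤ F (G x)) →
          ∀ᵐ x, ENNReal.ofReal c * ENNReal.ofReal (h x) ^ p ≤ f x := by
  have hq0 : 0 < q := by linarith
  have hp0 : 0 < p := by linarith
  have hnq : 0 ≤ (n : ℝ) / q := by positivity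
  obtain ⟨C, hC⟩ := exists_level_set_inequality hp hF hhom hL hq hqp hpq hn
  refine ⟨C, fun K V hK hV hKV hVt => ?_⟩
  obtain ⟨d, δ, hδ, hδ1, hdL, hd0, hd1, hdV, hdK⟩ := exists_lipschitz_cutoff hK hV hKV
  obtain ⟨κ, hκ, hκG⟩ := exists_threshold (m := m) hVt hq hqp
  refine ⟨δ ^ (n / q), κ, by positivity, Real.rpow_le_one hδ.le hδ1 hnq, hκ, ?_⟩
  intro Ω hΩ hVΩ u G hu hGloc hG hpos
  have hdc : Continuous d := hdL.continuous
  have hW : MeasurableSet {x | 0 < d x} := (isOpen_lt continuous_const hdc).measurableSet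
  obtain ⟨g, hgm, hGg⟩ := hG.aestronglyMeasurable
  set H := {x | 0 < d x}.indicator g with hHdef
  have hHm : StronglyMeasurable H := hgm.indicator hW
  have hHG : H =ᵐ[volume.restrict {x | 0 < d x}] G := by
    filter_upwards [ae_restrict_of_ae_restrict_of_subset hdV hGg, ae_restrict_mem hW]
      with x hx hxW
    rw [hx]
    exact indicator_of_mem (s := {x | 0 < d x}) hxW g
  have hH0 : ∀ x, d x = 0 → H x = 0 := fun x hx =>
    indicator_of_notMem (by simp [hx]) _
  have hHr : ∀ r : ℝ, 0 < r → ∫⁻ x, ‖H x‖ₑ ^ r ≤ ∫⁻ x in V, ‖G x‖ₑ ^ r := by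
    intro r hr
    calc ∫⁻ x, ‖H x‖ₑ ^ r = ∫⁻ x, {x | 0 < d x}.indicator (fun x => ‖H x‖ₑ ^ r) x := by
          refine lintegral_congr fun x => ?_
          by_cases hx : x ∈ {x | 0 < d x}
          · rw [indicator_of_mem hx]
          · rw [indicator_of_notMem hx, hHdef, indicator_of_notMem hx]; simp [hr]
      _ = ∫⁻ x in {x | 0 < d x}, ‖G x‖ₑ ^ r := by
          rw [lintegral_indicator hW]
          exact lintegral_congr_ae (hHG.mono fun x hx => by simp only [hx])
      _ ≤ _ := lintegral_mono_set hdV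
  have hGp : ∫⁻ x in V, ‖G x‖ₑ ^ p =
      eLpNorm G (ENNReal.ofReal p) (volume.restrict V) ^ p := by
    rw [eLpNorm_eq_lintegral_rpow_enorm_toReal (by simpa) (by simp), ENNReal.toReal_ofReal hp0.le,
      ← ENNReal.rpow_mul, one_div_mul_cancel hp0.ne', ENNReal.rpow_one]
  have hthr := hκG G hG
  set N : ℝ := ((eLpNorm G (ENNReal.ofReal p) (volume.restrict V)).toNNReal : ℝ) with hN
  have hN0 : 0 ≤ N := NNReal.coe_nonneg _
  have hl₀ : 0 < κ * (N + 1) := by positivity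
  have hthr' := (mul_le_mul_right (hHr q hq0) (ENNReal.ofReal (3 ^ n))).trans hthr
  have hHint : ∫⁻ x, ‖H x‖ₑ ^ q ≠ ⊤ := by
    intro htop
    rw [htop, ENNReal.mul_top (by simp), top_le_iff] at hthr'
    exact ENNReal.mul_ne_top (ENNReal.rpow_ne_top_of_nonneg hq0.le ENNReal.ofReal_ne_top)
      measure_closedBall_lt_top.ne hthr'
  have hLS := hC Ω hΩ u G H d (κ * (N + 1)) hu hGloc hpos hdL hd0 hd1 (hdV.trans hVΩ) hHm hHG hH0
    hHint hl₀ hthr'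
  have hKW : K ⊆ {x | 0 < d x} := fun x hx => hδ.trans_le (hdK x hx)
  have hHK : ∀ᵐ x ∂volume.restrict K, H x = G x := ae_restrict_of_ae_restrict_of_subset hKW hHG
  have hwm : Measurable fun x => d x ^ (n / q) := hdc.measurable.pow_const _
  have hposK : ∀ᵐ x ∂volume.restrict K, 0 ≤ F (G x) :=
    ae_restrict_of_ae_restrict_of_subset (hKV.trans hVΩ) hpos
  refine ⟨fun x => ENNReal.ofReal ((d x ^ (n / q)) ^ p * F (H x)),
    fun x => d x ^ (n / q) * ‖H x‖,
    ((hwm.pow_const p).mul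
      ((hL.continuous hp).comp_stronglyMeasurable hHm).measurable).ennreal_ofReal,
    hwm.mul hHm.norm.measurable, fun x => by have := hd0 x; positivity, hLS, ?_, ?_, ?_, ?_⟩
  · rw [← hGp]
    refine le_trans (lintegral_mono fun x => ?_) (hHr p hp0)
    gcongr
    rw [← ofReal_norm]
    exact ENNReal.ofReal_le_ofReal
      (mul_le_of_le_one_left (norm_nonneg _) (Real.rpow_le_one (hd0 x) (hd1 x) hnq))
  · filter_upwards [hHK, ae_restrict_mem hK.measurableSet] with x hx hxK
    rw [hx]
    have := hdK x hxK
    gcongr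
  · filter_upwards [hHK, ae_restrict_mem hK.measurableSet, hposK] with x hx hxK hx0
    rw [hx]
    have := hdK x hxK
    gcongr
  · intro c hc hcF
    have hcW : ∀ᵐ x ∂volume.restrict {x | 0 < d x}, c * ‖H x‖ ^ p ≤ F (H x) := by
      filter_upwards [hHG, ae_restrict_of_ae_restrict_of_subset (hdV.trans hVΩ) hcF] with x hx h1
      rwa [hx]
    filter_upwards [(ae_restrict_iff' hW).1 hcW] with x hx
    have hdx := hd0 x
    have hw0 : 0 ≤ d x ^ (n / q) := by positivity
    rcases hdx.eq_or_lt with h0 | h0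
    · simp [hH0 x h0.symm, hp0]
    · rw [ENNReal.ofReal_rpow_of_nonneg (by positivity) hp0.le, ← ENNReal.ofReal_mul hc,
        Real.mul_rpow hw0 (norm_nonneg _)]
      refine ENNReal.ofReal_le_ofReal ?_
      calc _ = (d x ^ (n / q)) ^ p * (c * ‖H x‖ ^ p) := by ring
        _ ≤ _ := by gcongr; exact hx h0

end Local

section Estimates

variable {m n : ℕ} {p : ℝ} {F : Matrix (Fin m) (Fin n) ℝ → ℝ}

lemma llogNorm_mono_measure {α : Type*} [MeasurableSpace α] (f : α → ℝ) {μ ν : Measure α}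
    (hμν : μ ≤ ν) : llogNorm f μ ≤ llogNorm f ν :=
  le_iInf₂ fun t ht => iInf₂_le t ⟨ht.1, (lintegral_mono' hμν le_rfl).trans ht.2⟩

/-- If `v ≤ g ^ p`, then `log (e + v) ≤ 2 + p log⁺ g`. -/
lemma log_exp_one_add_le {p v g : ℝ} (hp : 0 < p) (hv : 0 ≤ v) (hg : 0 ≤ g) (hvg : v ≤ g ^ p) :
    ENNReal.ofReal (Real.log (Real.exp 1 + v)) ≤
      2 + ENNReal.ofReal p * ENNReal.ofReal (Real.log g) := by
  have he : Real.exp 1 + 1 ≤ Real.exp 2 := by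
    have h1 : Real.exp 2 = Real.exp 1 * Real.exp 1 := by rw [← Real.exp_add]; norm_num
    have h2 := Real.add_one_le_exp 1
    nlinarith
  have hM1 : 1 ≤ max g 1 := le_max_right _ _
  have hMp : 1 ≤ max g 1 ^ p := Real.one_le_rpow hM1 hp.le
  have hvM : v ≤ max g 1 ^ p := hvg.trans (Real.rpow_le_rpow hg (le_max_left _ _) hp.le)
  have h1 : Real.exp 1 + v ≤ Real.exp 2 * max g 1 ^ p := by
    have := Real.exp_pos 1
    nlinarith
  have h2 : Real.log (Real.exp 1 + v) ≤ 2 + p * Real.log (max g 1) := by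
    calc _ ≤ Real.log (Real.exp 2 * max g 1 ^ p) :=
          Real.log_le_log (by positivity) h1
      _ = _ := by
          rw [Real.log_mul (by positivity) (by positivity), Real.log_exp,
            Real.log_rpow (by positivity)]
  have h3 : ENNReal.ofReal (Real.log (max g 1)) ≤ ENNReal.ofReal (Real.log g) := by
    rcases le_total g 1 with h | h
    · rw [max_eq_right h, Real.log_one, ENNReal.ofReal_zero]; exact zero_le
    · rw [max_eq_left h]
  refine (ENNReal.ofReal_le_ofReal h2).trans (ENNReal.ofReal_add_le.trans ?_)
  rw [ENNReal.ofReal_mul hp.le, ENNReal.ofReal_ofNat]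
  gcongr

lemma ofReal_log_le_ofReal_log {s t : ℝ} (hs : 0 ≤ s) (hst : s ≤ t) :
    ENNReal.ofReal (Real.log s) ≤ ENNReal.ofReal (Real.log t) := by
  rcases hs.eq_or_lt with h | h
  · rw [← h, Real.log_zero, ENNReal.ofReal_zero]; exact zero_le
  · exact ENNReal.ofReal_le_ofReal (Real.log_le_log h hst)

/-- The `L log L` estimate on compact sets. -/
lemma exists_llogNorm_le (hp : 1 < p) (hF : IsQuasiconcave F) (hhom : IsHomogeneousOfDegree p F)
    {K V : Set (EuclideanSpace ℝ (Fin n))} (hK : IsCompact K) (hV : IsOpen V) (hKV : K ⊆ V)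
    (hVt : volume V ≠ ⊤) :
    ∃ C : ℝ≥0 → ℝ≥0, Monotone C ∧ ∀ Ω : Set (EuclideanSpace ℝ (Fin n)), IsOpen Ω → V ⊆ Ω →
      ∀ (u : EuclideanSpace ℝ (Fin n) → EuclideanSpace ℝ (Fin m))
        (G : EuclideanSpace ℝ (Fin n) → Matrix (Fin m) (Fin n) ℝ),
      HasWeakGradient Ω u G → MemLpLoc G p Ω →
      MemLp G (ENNReal.ofReal p) (volume.restrict V) →
      (∀ᵐ x ∂volume.restrict Ω, 0 ≤ F (G x)) →
      llogNorm (fun x => F (G x)) (volume.restrict K) ≤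
        C (eLpNorm G (ENNReal.ofReal p) (volume.restrict V)).toNNReal := by
  have hp0 : 0 < p := by linarith
  obtain ⟨L, hL⟩ := exists_growthBound hp hF hhom
  obtain ⟨q, hq, hqp, hpq, hn⟩ := exists_lower_exponent n hp
  obtain ⟨C, hC⟩ := exists_local_level_set_inequality hp hF hhom hL hq hqp hpq hn
  obtain ⟨a, κ, ha, ha1, hκ, hCK⟩ := hC K V hK hV hKV hVt
  have hL0 := hL.nonneg
  have hpq0 : 0 < p - q := by linarith
  set D : ℝ := 2 ^ (p - q) / (p - q) with hD
  have hD0 : 0 ≤ D := by positivity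
  set S : ℝ := 2 * L + p * ((a ^ p)⁻¹ * (C * D)) with hS
  have hS0 : 0 ≤ S := by positivity
  -- The first summand gives `F(Du) / t ≤ (h / l₀) ^ p` for `t = A (N + 1) ^ p`, so that the
  -- logarithm in the Young function is controlled by `log⁺ (h / l₀)`; the second one makes the final integral
  -- at most `1`.
  set A : ℝ := L * (κ / a) ^ p + S + 1 with hA
  have hκ0 : 0 < κ := by linarith
  have hAκ : L * (κ / a) ^ p ≤ A := by linarith
  have hAS : S ≤ A := by
    have : 0 ≤ L * (κ / a) ^ p := by positivity
    linarith
  have hA0 : 0 < A := by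
    have : 0 ≤ L * (κ / a) ^ p := by positivity
    linarith
  refine ⟨fun N => A.toNNReal * (N + 1) ^ p, fun N N' hNN => ?_, ?_⟩
  · dsimp only; gcongr
  intro Ω hΩ hVΩ u G hu hGloc hG hpos
  obtain ⟨f, h, hf, hm, hh, hLS, hhp, hGh, hFf, -⟩ := hCK Ω hΩ hVΩ u G hu hGloc hG hpos
  have hNt : eLpNorm G (ENNReal.ofReal p) (volume.restrict V) ≠ ⊤ := hG.2.ne
  have hGp : ∫⁻ x in V, ‖G x‖ₑ ^ p =
      eLpNorm G (ENNReal.ofReal p) (volume.restrict V) ^ p := by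
    rw [eLpNorm_eq_lintegral_rpow_enorm_toReal (by simpa) (by simp), ENNReal.toReal_ofReal hp0.le,
      ← ENNReal.rpow_mul, one_div_mul_cancel hp0.ne', ENNReal.rpow_one]
  rw [← ENNReal.coe_toNNReal hNt] at hGp hhp
  set N := (eLpNorm G (ENNReal.ofReal p) (volume.restrict V)).toNNReal with hN
  clear_value N
  have hN0 : (0 : ℝ) ≤ N := NNReal.coe_nonneg _
  set l₀ : ℝ := κ * (N + 1) with hl₀
  have hl₀pos : 0 < l₀ := by positivity
  have hlog := lintegral_mul_log_le (μ := volume) hqp hf hm hh hl₀pos (by linarith) hLS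
  set t : ℝ := A * (N + 1) ^ p with ht
  have ht0 : 0 < t := by positivity
  have htcoe : ((A.toNNReal * (N + 1) ^ p : ℝ≥0) : ℝ) = t := by
    rw [ht]; push_cast; rw [Real.coe_toNNReal _ hA0.le]
  refine iInf₂_le _ ⟨by rw [← NNReal.coe_pos, htcoe]; exact ht0, ?_⟩
  rw [htcoe]
  have hposK : ∀ᵐ x ∂volume.restrict K, 0 ≤ F (G x) :=
    ae_restrict_of_ae_restrict_of_subset (hKV.trans hVΩ) hpos
  have hpt : ∀ᵐ x ∂volume.restrict K, ENNReal.ofReal (llogYoung (|F (G x)| / t)) ≤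
      ENNReal.ofReal t⁻¹ * (ENNReal.ofReal (F (G x)) * 2 + ENNReal.ofReal p *
        (ENNReal.ofReal ((a ^ p)⁻¹) * (f x * ENNReal.ofReal (Real.log (h x / l₀))))) := by
    filter_upwards [hposK, hGh, hFf] with x hx hxh hxf
    have hg0 : 0 ≤ a * ‖G x‖ / l₀ := by positivity
    have hv0 : 0 ≤ F (G x) / t := by positivity
    have hv : F (G x) / t ≤ (a * ‖G x‖ / l₀) ^ p := by
      rw [div_le_iff₀ ht0]
      have e : ‖G x‖ = (a * ‖G x‖ / l₀) * ((κ / a) * (N + 1)) := by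
        rw [hl₀]; field_simp
      calc F (G x) ≤ L * ‖G x‖ ^ p := (le_abs_self _).trans (hL.abs_le hp _)
        _ = (a * ‖G x‖ / l₀) ^ p * ((L * (κ / a) ^ p) * (N + 1) ^ p) := by
            conv_lhs => rw [e, Real.mul_rpow hg0 (by positivity),
              Real.mul_rpow (by positivity) (by positivity)]
            ring
        _ ≤ _ := by rw [ht]; gcongr
    have e1 : ENNReal.ofReal (F (G x)) ≤ ENNReal.ofReal ((a ^ p)⁻¹) * f x := by
      calc _ = ENNReal.ofReal ((a ^ p)⁻¹) * ENNReal.ofReal (a ^ p * F (G x)) := by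
            rw [← ENNReal.ofReal_mul (by positivity)]
            congr 1; field_simp
        _ ≤ _ := by gcongr
    have e2 : ENNReal.ofReal (Real.log (a * ‖G x‖ / l₀)) ≤ ENNReal.ofReal (Real.log (h x / l₀)) :=
      ofReal_log_le_ofReal_log hg0 (by gcongr)
    rw [abs_of_nonneg hx, llogYoung, ENNReal.ofReal_mul hv0, div_eq_inv_mul,
      ENNReal.ofReal_mul (by positivity), mul_assoc, ← div_eq_inv_mul]
    refine mul_le_mul_right ?_ _
    calc _ ≤ ENNReal.ofReal (F (G x)) *
          (2 + ENNReal.ofReal p * ENNReal.ofReal (Real.log (a * ‖G x‖ / l₀))) := by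
          gcongr; exact log_exp_one_add_le hp0 hv0 hg0 hv
      _ = ENNReal.ofReal (F (G x)) * 2 + ENNReal.ofReal p *
          (ENNReal.ofReal (F (G x)) * ENNReal.ofReal (Real.log (a * ‖G x‖ / l₀))) := by
          rw [mul_add]; congr 1; ac_rfl
      _ ≤ _ := by
          rw [← mul_assoc _ (f x)]
          gcongr
  have hFint : ∫⁻ x in K, ENNReal.ofReal (F (G x)) ≤ ENNReal.ofReal L * (N : ℝ≥0∞) ^ p := by
    rw [← hGp, ← lintegral_const_mul' _ _ ENNReal.ofReal_ne_top]
    refine (lintegral_mono_set hKV).trans (lintegral_mono fun x => ?_)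
    dsimp only
    rw [← ofReal_norm, ENNReal.ofReal_rpow_of_nonneg (norm_nonneg _) hp0.le,
      ← ENNReal.ofReal_mul hL0]
    exact ENNReal.ofReal_le_ofReal ((le_abs_self _).trans (hL.abs_le hp _))
  have hFm : AEMeasurable (fun x => ENNReal.ofReal (F (G x)) * 2) (volume.restrict K) :=
    (((hL.continuous hp).comp_aestronglyMeasurable (hG.1.mono_measure
      (Measure.restrict_mono hKV le_rfl))).aemeasurable.ennreal_ofReal).mul_const _
  calc _ ≤ _ := lintegral_mono_ae hpt
    _ = ENNReal.ofReal t⁻¹ * ((∫⁻ x in K, ENNReal.ofReal (F (G x))) * 2 + ENNReal.ofReal p *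
        (ENNReal.ofReal ((a ^ p)⁻¹) *
          ∫⁻ x in K, f x * ENNReal.ofReal (Real.log (h x / l₀)))) := by
        rw [lintegral_const_mul' _ _ ENNReal.ofReal_ne_top, lintegral_add_left' hFm,
          lintegral_mul_const' _ _ (by simp), lintegral_const_mul' _ _ ENNReal.ofReal_ne_top,
          lintegral_const_mul' _ _ ENNReal.ofReal_ne_top]
    _ ≤ ENNReal.ofReal t⁻¹ * ((ENNReal.ofReal L * (N : ℝ≥0∞) ^ p) * 2 + ENNReal.ofReal p *
        (ENNReal.ofReal ((a ^ p)⁻¹) * (C * ENNReal.ofReal D * (N : ℝ≥0∞) ^ p))) := by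
        refine mul_le_mul_right (add_le_add (by gcongr) ?_) _
        refine mul_le_mul_right (mul_le_mul_right ?_ _) _
        refine (setLIntegral_le_lintegral K _).trans (hlog.trans ?_)
        gcongr
    _ = ENNReal.ofReal (t⁻¹ * (S * (N : ℝ) ^ p)) := by
        have eN : (N : ℝ≥0∞) ^ p = ENNReal.ofReal ((N : ℝ) ^ p) := by
          rw [← ENNReal.ofReal_rpow_of_nonneg hN0 hp0.le, ENNReal.ofReal_coe_nnreal]
        have eC : (C : ℝ≥0∞) = ENNReal.ofReal (C : ℝ) := ENNReal.ofReal_coe_nnreal.symm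
        have e2 : (2 : ℝ≥0∞) = ENNReal.ofReal 2 := by simp
        rw [eN, eC, e2, ← ENNReal.ofReal_mul (by positivity), ← ENNReal.ofReal_mul (by positivity),
          ← ENNReal.ofReal_mul (by positivity), ← ENNReal.ofReal_mul (by positivity),
          ← ENNReal.ofReal_mul (by positivity), ← ENNReal.ofReal_mul (by positivity),
          ← ENNReal.ofReal_add (by positivity) (by positivity),
          ← ENNReal.ofReal_mul (by positivity)]
        congr 2
        rw [hS]; ring
    _ ≤ 1 := by
        rw [ENNReal.ofReal_le_one, inv_mul_le_iff₀ ht0, mul_one, ht]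
        gcongr
        linarith

/-- Higher integrability of the gradient on compact sets. The bound `ε₀` does not depend on the
sets, because the constant in the level set inequality does not. -/
lemma exists_eLpNorm_le (hp : 1 < p) (hF : IsQuasiconcave F) (hhom : IsHomogeneousOfDegree p F)
    {c : ℝ} (hc : 0 < c) :
    ∃ ε₀ : ℝ, 0 < ε₀ ∧ ∀ K V : Set (EuclideanSpace ℝ (Fin n)), IsCompact K → IsOpen V → K ⊆ V →
      volume V ≠ ⊤ →
      ∃ C : ℝ≥0 → ℝ≥0, Monotone C ∧ ∀ ε : ℝ, 0 < ε → ε < ε₀ →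
      ∀ Ω : Set (EuclideanSpace ℝ (Fin n)), IsOpen Ω → V ⊆ Ω →
      ∀ (u : EuclideanSpace ℝ (Fin n) → EuclideanSpace ℝ (Fin m))
        (G : EuclideanSpace ℝ (Fin n) → Matrix (Fin m) (Fin n) ℝ),
      HasWeakGradient Ω u G → MemLpLoc G p Ω →
      MemLp G (ENNReal.ofReal p) (volume.restrict V) →
      (∀ᵐ x ∂volume.restrict Ω, c * ‖G x‖ ^ p ≤ F (G x)) →
      eLpNorm G (ENNReal.ofReal (p + ε)) (volume.restrict K) ≤
        C (eLpNorm G (ENNReal.ofReal p) (volume.restrict V)).toNNReal := by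
  have hp0 : 0 < p := by linarith
  obtain ⟨L, hL⟩ := exists_growthBound hp hF hhom
  obtain ⟨q, hq, hqp, hpq, hn⟩ := exists_lower_exponent n hp
  obtain ⟨C, hC⟩ := exists_local_level_set_inequality hp hF hhom hL hq hqp hpq hn
  have hpq0 : 0 < p - q := by linarith
  set D : ℝ := C * (2 ^ (p - q + 1) / (p - q)) / c with hD
  have hD0 : 0 ≤ D := by positivity
  refine ⟨1 / (2 * (D + 1)), by positivity, fun K V hK hV hKV hVt => ?_⟩
  obtain ⟨a, κ, ha, ha1, hκ, hCK⟩ := hC K V hK hV hKV hVt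
  have hκ0 : 0 < κ := by linarith
  set M : ℝ := 2 * (a⁻¹ ^ (p + 1) * κ) with hM
  have ha' : 1 ≤ a⁻¹ := (one_le_inv₀ ha).2 ha1
  have hM1 : 1 ≤ M := by
    have h1 : 1 ≤ a⁻¹ ^ (p + 1) := Real.one_le_rpow ha' (by linarith)
    nlinarith
  refine ⟨fun N => M.toNNReal * (N + 1), fun N N' hNN => ?_, ?_⟩
  · dsimp only; gcongr
  intro ε hε hεlt Ω hΩ hVΩ u G hu hGloc hG hcF
  have hpos : ∀ᵐ x ∂volume.restrict Ω, 0 ≤ F (G x) :=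
    hcF.mono fun x hx => le_trans (by positivity) hx
  obtain ⟨f, h, hf, hm, hh, hLS, hhp, hGh, -, hcf⟩ := hCK Ω hΩ hVΩ u G hu hGloc hG hpos
  have hNt : eLpNorm G (ENNReal.ofReal p) (volume.restrict V) ≠ ⊤ := hG.2.ne
  rw [← ENNReal.coe_toNNReal hNt] at hhp
  set N := (eLpNorm G (ENNReal.ofReal p) (volume.restrict V)).toNNReal with hN
  clear_value N
  have hN0 : (0 : ℝ) ≤ N := NNReal.coe_nonneg _
  set l₀ : ℝ := κ * (N + 1) with hl₀
  have hl₀pos : 0 < l₀ := by positivity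
  have hεD : ε * (2 * (D + 1)) ≤ 1 := ((lt_div_iff₀ (by positivity)).1 hεlt).le
  have hε1 : ε ≤ 1 := by nlinarith
  have hpε : 0 < p + ε := by linarith
  have hint : ∫⁻ x, ENNReal.ofReal (h x) ^ p ≠ ⊤ :=
    ne_top_of_le_ne_top (ENNReal.rpow_ne_top_of_nonneg hp0.le ENNReal.coe_ne_top) hhp
  have key := lintegral_rpow_add_le (μ := volume) hp0 hqp hf hm hh hl₀pos (by linarith) hLS hc
    (hcf c hc.le hcF) hint hε hε1 (by rw [← hD]; nlinarith)
  have hKint : ∫⁻ x in K, ‖G x‖ₑ ^ (p + ε) ≤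
      ENNReal.ofReal (M * (N + 1)) ^ (p + ε) := by
    calc ∫⁻ x in K, ‖G x‖ₑ ^ (p + ε)
        ≤ ∫⁻ x in K, ENNReal.ofReal a⁻¹ ^ (p + ε) * ENNReal.ofReal (h x) ^ (p + ε) := by
          refine lintegral_mono_ae ?_
          filter_upwards [hGh] with x hx
          rw [← ENNReal.mul_rpow_of_nonneg _ _ hpε.le, ← ENNReal.ofReal_mul (by positivity),
            ← ofReal_norm]
          gcongr
          rw [← div_eq_inv_mul, le_div_iff₀ ha, mul_comm]
          exact hx
      _ ≤ ENNReal.ofReal a⁻¹ ^ (p + ε) * (2 * (ENNReal.ofReal (l₀ ^ ε) * (N : ℝ≥0∞) ^ p)) := by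
          rw [lintegral_const_mul' _ _
            (ENNReal.rpow_ne_top_of_nonneg hpε.le ENNReal.ofReal_ne_top)]
          refine mul_le_mul_right ((setLIntegral_le_lintegral K _).trans (key.trans ?_)) _
          gcongr
      _ = ENNReal.ofReal (a⁻¹ ^ (p + ε) * (2 * (l₀ ^ ε * (N : ℝ) ^ p))) := by
          have eN : (N : ℝ≥0∞) ^ p = ENNReal.ofReal ((N : ℝ) ^ p) := by
            rw [← ENNReal.ofReal_rpow_of_nonneg hN0 hp0.le, ENNReal.ofReal_coe_nnreal]
          have e2 : (2 : ℝ≥0∞) = ENNReal.ofReal 2 := by simp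
          rw [eN, e2, ENNReal.ofReal_rpow_of_nonneg (by positivity) hpε.le,
            ← ENNReal.ofReal_mul (by positivity), ← ENNReal.ofReal_mul (by positivity),
            ← ENNReal.ofReal_mul (by positivity)]
      _ ≤ ENNReal.ofReal ((M * (N + 1)) ^ (p + ε)) := by
          refine ENNReal.ofReal_le_ofReal ?_
          have h1 : a⁻¹ ^ (p + ε) ≤ a⁻¹ ^ (p + 1) :=
            Real.rpow_le_rpow_of_exponent_le ha' (by linarith)
          have h2 : l₀ ^ ε ≤ κ * (N + 1) ^ ε := by
            rw [hl₀, Real.mul_rpow hκ0.le (by positivity)]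
            gcongr
            exact (Real.rpow_le_rpow_of_exponent_le hκ hε1).trans_eq (Real.rpow_one κ)
          have h3 : (N : ℝ) ^ p ≤ (N + 1) ^ p := by
            gcongr; linarith
          calc _ ≤ a⁻¹ ^ (p + 1) * (2 * ((κ * (N + 1) ^ ε) * (N + 1) ^ p)) := by gcongr
            _ = M * ((N : ℝ) + 1) ^ (p + ε) := by
                rw [Real.rpow_add (by positivity : (0 : ℝ) < N + 1), hM]; ring
            _ ≤ M ^ (p + ε) * ((N : ℝ) + 1) ^ (p + ε) := by
                gcongr
                calc M = M ^ (1 : ℝ) := (Real.rpow_one M).symm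
                  _ ≤ _ := Real.rpow_le_rpow_of_exponent_le hM1 (by linarith)
            _ = _ := (Real.mul_rpow (by linarith) (by positivity)).symm
      _ = _ := (ENNReal.ofReal_rpow_of_nonneg (by positivity) hpε.le).symm
  rw [eLpNorm_eq_lintegral_rpow_enorm_toReal (by simpa) (by simp), ENNReal.toReal_ofReal hpε.le]
  calc _ ≤ (ENNReal.ofReal (M * (N + 1)) ^ (p + ε)) ^ (1 / (p + ε)) := by gcongr
    _ = ENNReal.ofReal (M * (N + 1)) := by
        rw [← ENNReal.rpow_mul, mul_one_div_cancel hpε.ne', ENNReal.rpow_one]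
    _ = _ := by
        rw [← ENNReal.ofReal_coe_nnreal]
        push_cast
        rw [Real.coe_toNNReal _ (by linarith)]

end Estimates

theorem theorem1 {m n : ℕ} {p : ℝ} (hp : 1 < p) {F : Matrix (Fin m) (Fin n) ℝ → ℝ}
    (hF : IsQuasiconcave F)
    (hhom : IsHomogeneousOfDegree p F) :
    -- `L log L` integrability of `F(Du)`
    (∀ Ω : Set (EuclideanSpace ℝ (Fin n)), IsOpen Ω →
      ∀ (u : EuclideanSpace ℝ (Fin n) → EuclideanSpace ℝ (Fin m))
        (Du : EuclideanSpace ℝ (Fin n) → Matrix (Fin m) (Fin n) ℝ),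
        HasWeakGradient Ω u Du →
        MemLpLoc Du p Ω →
        (∀ᵐ x ∂(volume.restrict Ω), 0 ≤ F (Du x)) →
        MemLLogLLoc (fun x => F (Du x)) Ω) ∧
    -- the local `L log L` estimate
    (∀ U V : Set (EuclideanSpace ℝ (Fin n)), IsOpen U → IsOpen V →
      CompactlyContained U V →
      ∃ C : ℝ≥0 → ℝ≥0, Monotone C ∧
        ∀ Ω : Set (EuclideanSpace ℝ (Fin n)), IsOpen Ω →
        CompactlyContained V Ω →
        ∀ (u : EuclideanSpace ℝ (Fin n) → EuclideanSpace ℝ (Fin m))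
          (Du : EuclideanSpace ℝ (Fin n) → Matrix (Fin m) (Fin n) ℝ),
          HasWeakGradient Ω u Du →
          MemLpLoc Du p Ω →
          (∀ᵐ x ∂(volume.restrict Ω), 0 ≤ F (Du x)) →
          llogNorm (fun x => F (Du x)) (volume.restrict U) ≤
            C (eLpNorm Du (ENNReal.ofReal p) (volume.restrict V)).toNNReal) ∧
    -- higher integrability of `Du`, with its local estimate
    (∀ c : ℝ, 0 < c → ∃ ε₀ : ℝ, 0 < ε₀ ∧
      (∀ ε : ℝ, 0 < ε → ε < ε₀ →
        ∀ Ω : Set (EuclideanSpace ℝ (Fin n)), IsOpen Ω →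
        ∀ (u : EuclideanSpace ℝ (Fin n) → EuclideanSpace ℝ (Fin m))
          (Du : EuclideanSpace ℝ (Fin n) → Matrix (Fin m) (Fin n) ℝ),
          HasWeakGradient Ω u Du →
          MemLpLoc Du p Ω →
          (∀ᵐ x ∂(volume.restrict Ω), c * ‖Du x‖ ^ p ≤ F (Du x)) →
          MemLpLoc Du (p + ε) Ω) ∧
      (∀ U V : Set (EuclideanSpace ℝ (Fin n)), IsOpen U → IsOpen V →
        CompactlyContained U V →
        ∃ C : ℝ≥0 → ℝ≥0, Monotone C ∧
          ∀ ε : ℝ, 0 < ε → ε < ε₀ →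
          ∀ Ω : Set (EuclideanSpace ℝ (Fin n)), IsOpen Ω →
          CompactlyContained V Ω →
          ∀ (u : EuclideanSpace ℝ (Fin n) → EuclideanSpace ℝ (Fin m))
            (Du : EuclideanSpace ℝ (Fin n) → Matrix (Fin m) (Fin n) ℝ),
            HasWeakGradient Ω u Du →
            MemLpLoc Du p Ω →
            (∀ᵐ x ∂(volume.restrict Ω), c * ‖Du x‖ ^ p ≤ F (Du x)) →
            eLpNorm Du (ENNReal.ofReal (p + ε)) (volume.restrict U) ≤
              C (eLpNorm Du (ENNReal.ofReal p) (volume.restrict V)).toNNReal)) := by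
  have hvol : ∀ V : Set (EuclideanSpace ℝ (Fin n)), IsCompact (closure V) → volume V ≠ ⊤ :=
    fun V hV => ne_top_of_le_ne_top hV.measure_lt_top.ne (measure_mono subset_closure)
  have hmem : ∀ (V Ω : Set (EuclideanSpace ℝ (Fin n)))
      (G : EuclideanSpace ℝ (Fin n) → Matrix (Fin m) (Fin n) ℝ), CompactlyContained V Ω →
      MemLpLoc G p Ω → MemLp G (ENNReal.ofReal p) (volume.restrict V) :=
    fun V Ω G hV hG =>
      (hG _ hV.1 hV.2).mono_measure (Measure.restrict_mono subset_closure le_rfl)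
  refine ⟨?_, ?_, ?_⟩
  · intro Ω hΩ u Du hu hDu hpos K hK hKΩ
    obtain ⟨L, hL⟩ := exists_growthBound hp hF hhom
    obtain ⟨V, hV, hKV, hVΩ, hVc⟩ := exists_open_between_and_isCompact_closure hK hΩ hKΩ
    obtain ⟨C, -, hC⟩ := exists_llogNorm_le hp hF hhom hK hV hKV (hvol V hVc)
    exact ⟨(hL.continuous hp).comp_aestronglyMeasurable (hDu K hK hKΩ).1,
      (hC Ω hΩ (subset_closure.trans hVΩ) u Du hu hDu (hmem V Ω Du ⟨hVc, hVΩ⟩ hDu)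
        hpos).trans_lt ENNReal.coe_lt_top⟩
  · intro U V _ hV hUV
    by_cases hVc : IsCompact (closure V)
    · obtain ⟨C, hCm, hC⟩ := exists_llogNorm_le hp hF hhom hUV.1 hV hUV.2 (hvol V hVc)
      exact ⟨C, hCm, fun Ω hΩ hVΩ u Du hu hDu hpos =>
        (llogNorm_mono_measure _ (Measure.restrict_mono subset_closure le_rfl)).trans
          (hC Ω hΩ (subset_closure.trans hVΩ.2) u Du hu hDu (hmem V Ω Du hVΩ hDu) hpos)⟩
    · exact ⟨0, monotone_const, fun Ω _ hVΩ => absurd hVΩ.1 hVc⟩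
  · intro c hc
    obtain ⟨ε₀, hε₀, hest⟩ := exists_eLpNorm_le hp hF hhom hc
    refine ⟨ε₀, hε₀, ?_, ?_⟩
    · intro ε hε hεlt Ω hΩ u Du hu hDu hcF K hK hKΩ
      obtain ⟨V, hV, hKV, hVΩ, hVc⟩ := exists_open_between_and_isCompact_closure hK hΩ hKΩ
      obtain ⟨C, -, hC⟩ := hest K V hK hV hKV (hvol V hVc)
      exact ⟨(hDu K hK hKΩ).1, (hC ε hε hεlt Ω hΩ (subset_closure.trans hVΩ) u Du hu hDu
        (hmem V Ω Du ⟨hVc, hVΩ⟩ hDu) hcF).trans_lt ENNReal.coe_lt_top⟩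
    · intro U V _ hV hUV
      by_cases hVc : IsCompact (closure V)
      · obtain ⟨C, hCm, hC⟩ := hest _ V hUV.1 hV hUV.2 (hvol V hVc)
        exact ⟨C, hCm, fun ε hε hεlt Ω hΩ hVΩ u Du hu hDu hcF =>
          (eLpNorm_mono_measure _ (Measure.restrict_mono subset_closure le_rfl)).trans
            (hC ε hε hεlt Ω hΩ (subset_closure.trans hVΩ.2) u Du hu hDu (hmem V Ω Du hVΩ hDu)
              hcF)⟩
      · exact ⟨0, monotone_const, fun ε _ _ Ω _ hVΩ => absurd hVΩ.1 hVc⟩
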